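/- **Setting.** A *labelled quantitative control improvisation (LQCI) instance* over a finite alphabet $\Sigma$ consists of length bounds $m\le n$ in $\mathbb N$, a hard specification $\mathcal H\subseteq\Sigma^*$, a cost function $\mathcal K:\Sigma^*\to\mathbb Q$, a label function $L:\Sigma^*\to\Omega$ into a finite set $\Omega=\{\ell_1,\dots,\ell_{|\Omega|}\}$, and rationals $c\ge 0$, $0\le\lambda\le\rho\le1$ and $0\le\hat\alpha_i\le\hat\beta_i\le 1$ for $1\le i\le|\Omega|$. Let $I=\{w\in\mathcal H: m\le|w|\le n\}$ and $I_i=\{w\in I: L(w)=\ell_i\}$. A probability distribution $D$ on $\Sigma^*$ is an *improvising distribution* if 1. $\Pr_{w\leftarrow D}[w\in I]=1$; 2. $\mathbb E_{w\leftarrow D}[\mathcal K(w)]\le c$; 3. $\lambda\le\Pr_{w\leftarrow D}[w\in I_i]\le\rho$ for every $i$; 4. $\hat\alpha_i\le\Pr_{w\leftarrow D}[w=y\mid w\in I_i]\le\hat\beta_i$ for every $i$ with $\Pr_{w\leftarrow D}[w\in I_i]>0$ and every $y\in I_i$. The instance is *feasible* if an improvising distribution exists. An *improviser* for it is a probabilistic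 algorithm without input, of finite expected running time, whose output distribution is an improvising distribution. **Theorem.** Consider the class of LQCI instances in which $\mathcal H$ is the language of a DFA, and $\mathcal K$ and $L$ are given by complete deterministic finite automata with an integer attached to each state, the cost (respectively the label) of a word being the integer attached to the state on which the word ends, and $\Omega$ is a finite set of integers. The instance is described by listing $\Sigma$, the automata, $\Omega$ and the parameters, with $m$ and $n$ in unary and all other numbers in binary; its size is the length of this description. This class has a polynomial-time improvisation scheme: there are a probabilistic algorithm $S$ and polynomials $P,Q$ such that for every instance $\mathcal C$ of the class, $S$ on input $\mathcal C$ halts with probability one, every halting run takes time at most $P(|\mathcal C|)$, and $S$ outputs * "infeasible" if $\mathcal C$ is infeasible, and * otherwise (the code of) an improviser for $\mathcal C$ whose expected running time is at most $Q(|\mathcal C|)$. Here probabilistic algorithms are programs that toss fair coins, and running time is measured by bit cost. -/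

import Mathlib

open scoped ENNReal

namespace LQCI

/-! ### A probabilistic programming language with bit-cost semantics -/

/-- Data: finite binary trees whose leaves are integers. -/
inductive Val : Type
  | num (n : ℤ) : Val
  | pair (a b : Val) : Val

namespace Val

/-- The number of symbols needed to write a value down: integers are written in binary
(`Nat.size` is the number of binary digits), with one further symbol per node. -/
def size : Val → ℕ
  | num n => 1 + n.natAbs.size
  | pair a b => 1 + a.size + b.size

def fst : Val → Val
  | num _ => num 0
  | pair a _ => a

def snd : Val → Val
  | num _ => num 0
  | pair _ b => b

def toInt : Val → ℤ
  | num n => n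
  | pair _ _ => 0

def isNum : Val → Bool
  | num _ => true
  | pair _ _ => false

/-- The truth values `1` and `0`. -/
def ofBool (b : Bool) : Val := num (if b then 1 else 0)

/-- Lists as right-nested pairs, ended by the integer `0`. -/
def ofList : List Val → Val
  | [] => num 0
  | a :: l => pair a (ofList l)

/-- Natural numbers in unary. -/
def unary (k : ℕ) : Val := ofList (List.replicate k (num 0))

/-- Natural numbers in binary. -/
def ofNat (k : ℕ) : Val := num (k : ℤ)

/-- Rational numbers in lowest terms, numerator and denominator in binary. -/
def ofRat (r : ℚ) : Val := pair (num r.num) (ofNat r.den)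

end Val

/-- The deterministic elementary operations. -/
inductive Op : Type
  | id | const (v : Val) | fst | snd | isNum | add | sub | mul | div | le

/-- The effect of an elementary operation; the arithmetic ones read a pair of integers. -/
def Op.app : Op → Val → Val
  | .id, v => v
  | .const w, _ => w
  | .fst, v => v.fst
  | .snd, v => v.snd
  | .isNum, v => Val.ofBool v.isNum
  | .add, v => Val.num (v.fst.toInt + v.snd.toInt)
  | .sub, v => Val.num (v.fst.toInt - v.snd.toInt)
  | .mul, v => Val.num (v.fst.toInt * v.snd.toInt)
  | .div, v => Val.num (v.fst.toInt / v.snd.toInt)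
  | .le, v => Val.ofBool (decide (v.fst.toInt ≤ v.snd.toInt))

/-- Programs. Each transforms one value into another: elementary operations, tossing a fair coin,
running two programs on copies of the same value and pairing the results, sequential composition
(`seq p q` runs `p` first), branching, and while loops. -/
inductive Prog : Type
  | op (o : Op)
  | flip
  | pair (p q : Prog)
  | seq (p q : Prog)
  | ite (c p q : Prog)
  | loop (c p : Prog)

/-- `Eval p v s w t`: on the value `v` the program `p`, if its successive coin tosses come out as
listed in `s`, halts after exactly these tosses with the result `w` and has then used time `t`.
An elementary step takes as much time as its argument and its result have symbols (so every value
that is read, copied or written is paid for in full), and each control step takes one further time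
unit. -/
inductive Eval : Prog → Val → List Bool → Val → ℕ → Prop
  | op (o : Op) (v : Val) : Eval (.op o) v [] (o.app v) (v.size + (o.app v).size)
  | flip (v : Val) (b : Bool) :
      Eval .flip v [b] (Val.ofBool b) (v.size + (Val.ofBool b).size)
  | pair {p q : Prog} {v a b : Val} {s s' : List Bool} {t t' : ℕ} :
      Eval p v s a t → Eval q v s' b t' → Eval (.pair p q) v (s ++ s') (.pair a b) (t + t' + 1)
  | seq {p q : Prog} {v a b : Val} {s s' : List Bool} {t t' : ℕ} :
      Eval p v s a t → Eval q a s' b t' → Eval (.seq p q) v (s ++ s') b (t + t' + 1)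
  | iteTrue {c p q : Prog} {v x w : Val} {s s' : List Bool} {t t' : ℕ} :
      Eval c v s x t → x ≠ .num 0 → Eval p v s' w t' →
      Eval (.ite c p q) v (s ++ s') w (t + t' + 1)
  | iteFalse {c p q : Prog} {v x w : Val} {s s' : List Bool} {t t' : ℕ} :
      Eval c v s x t → x = .num 0 → Eval q v s' w t' →
      Eval (.ite c p q) v (s ++ s') w (t + t' + 1)
  | loopDone {c p : Prog} {v x : Val} {s : List Bool} {t : ℕ} :
      Eval c v s x t → x = .num 0 → Eval (.loop c p) v s v (t + 1)
  | loopStep {c p : Prog} {v x a w : Val} {s s' s'' : List Bool} {t t' t'' : ℕ} :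
      Eval c v s x t → x ≠ .num 0 → Eval p v s' a t' → Eval (.loop c p) a s'' w t'' →
      Eval (.loop c p) v (s ++ s' ++ s'') w (t + t' + t'' + 1)

/-- A halting computation: the coin tosses made, the result, and the time used. -/
structure Run (p : Prog) (v : Val) : Type where
  coins : List Bool
  out : Val
  time : ℕ
  eval : Eval p v coins out time

/-- The probability that a run happens: its coins are fair and independent. -/
noncomputable def Run.weight {p : Prog} {v : Val} (r : Run p v) : ℝ≥0∞ :=
  2⁻¹ ^ r.coins.length

/-- The probability that `p` halts on `v`. -/
noncomputable def haltProb (p : Prog) (v : Val) : ℝ≥0∞ :=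
  ∑' r : Run p v, r.weight

open Classical in
/-- The probability that `p` halts on `v` with the result `w`. -/
noncomputable def outProb (p : Prog) (v w : Val) : ℝ≥0∞ :=
  ∑' r : Run p v, if r.out = w then r.weight else 0

/-- The expected running time of a program `p` that halts on `v` with probability one. -/
noncomputable def expTime (p : Prog) (v : Val) : ℝ≥0∞ :=
  ∑' r : Run p v, r.weight * (r.time : ℝ≥0∞)

/-! Programs are written down as values, so that a program can produce a program. -/

def Op.code : Op → Val
  | .id => .pair (.num 0) (.num 0)
  | .const v => .pair (.num 1) v
  | .fst => .pair (.num 2) (.num 0)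
  | .snd => .pair (.num 3) (.num 0)
  | .isNum => .pair (.num 4) (.num 0)
  | .add => .pair (.num 5) (.num 0)
  | .sub => .pair (.num 6) (.num 0)
  | .mul => .pair (.num 7) (.num 0)
  | .div => .pair (.num 8) (.num 0)
  | .le => .pair (.num 9) (.num 0)

def Prog.code : Prog → Val
  | .op o => .pair (.num 0) o.code
  | .flip => .pair (.num 1) (.num 0)
  | .pair p q => .pair (.num 2) (.pair p.code q.code)
  | .seq p q => .pair (.num 3) (.pair p.code q.code)
  | .ite c p q => .pair (.num 4) (.pair c.code (.pair p.code q.code))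
  | .loop c p => .pair (.num 5) (.pair c.code p.code)

/-! ### Labelled quantitative control improvisation -/

/-- The numerical parameters of an instance with `N` labels `ℓ_0, …, ℓ_{N-1}`. -/
structure Params (N : ℕ) : Type where
  /-- bounds on the word length -/
  m : ℕ
  n : ℕ
  /-- bound on the expected cost -/
  c : ℚ
  /-- bounds on the probability of each label -/
  lam : ℚ
  rho : ℚ
  /-- bounds on the conditional probability of the words of each label class -/
  alpha : Fin N → ℚ
  beta : Fin N → ℚ
  m_le_n : m ≤ n
  c_nonneg : 0 ≤ c
  lam_nonneg : 0 ≤ lam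
  lam_le_rho : lam ≤ rho
  rho_le_one : rho ≤ 1
  alpha_nonneg : ∀ i, 0 ≤ alpha i
  alpha_le_beta : ∀ i, alpha i ≤ beta i
  beta_le_one : ∀ i, beta i ≤ 1

/-- An LQCI instance over the alphabet `α`, its specifications being given semantically: `L w = i`
means that the label of `w` is the `i`-th label. -/
structure Inst (α : Type) : Type where
  hard : Language α
  cost : List α → ℚ
  numLabels : ℕ
  label : List α → Fin numLabels
  params : Params numLabels

namespace Inst

variable {α : Type} (C : Inst α)

/-- The set `I` of improvisations. -/
def improvisations : Set (List α) :=
  {w | C.params.m ≤ w.length ∧ w.length ≤ C.params.n ∧ w ∈ C.hard}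

/-- The label class `I_i`. -/
def labelClass (i : Fin C.numLabels) : Set (List α) :=
  {w | w ∈ C.improvisations ∧ C.label w = i}

end Inst

/-- The probability of the event `A` under `D`. -/
noncomputable def pr {β : Type} (D : PMF β) (A : Set β) : ℝ :=
  (D.toOuterMeasure A).toReal

/-- The conditional probability of `A` given `B` (meaningful if `B` has positive probability). -/
noncomputable def condPr {β : Type} (D : PMF β) (A B : Set β) : ℝ :=
  pr D (A ∩ B) / pr D B

/-- `D` is an improvising distribution. Over a finite alphabet the series for the expected cost has
only finitely many nonzero terms, by the hard constraint. The randomness over words within a label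
class is required where the conditional probabilities exist, that is, if the class has positive
probability. -/
structure IsImprovising {α : Type} (C : Inst α) (D : PMF (List α)) : Prop where
  hard : pr D C.improvisations = 1
  cost : ∑' w, (D w).toReal * (C.cost w : ℝ) ≤ (C.params.c : ℝ)
  labels : ∀ i, (C.params.lam : ℝ) ≤ pr D (C.labelClass i) ∧
    pr D (C.labelClass i) ≤ (C.params.rho : ℝ)
  words : ∀ i, 0 < pr D (C.labelClass i) → ∀ y ∈ C.labelClass i,
    (C.params.alpha i : ℝ) ≤ condPr D {y} (C.labelClass i) ∧
    condPr D {y} (C.labelClass i) ≤ (C.params.beta i : ℝ)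

def Feasible {α : Type} (C : Inst α) : Prop := ∃ D : PMF (List α), IsImprovising C D

/-! ### Instances given by automata -/

/-- A complete deterministic finite automaton over the alphabet `{0, …, s-1}`, with an output
attached to each state. -/
structure OutDFA (s : ℕ) (β : Type) : Type where
  numStates : ℕ
  start : Fin numStates
  step : Fin numStates → Fin s → Fin numStates
  out : Fin numStates → β

namespace OutDFA

variable {s : ℕ} {β : Type}

/-- The output at the state on which the word ends. -/
def output (A : OutDFA s β) (w : List (Fin s)) : β :=
  A.out (w.foldl A.step A.start)

/-- An automaton with Boolean outputs as an ordinary DFA. -/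
def toDFA (A : OutDFA s Bool) : DFA (Fin s) (Fin A.numStates) where
  step := A.step
  start := A.start
  accept := {q | A.out q = true}

/-- The start state, the rows of the transition table, and the outputs of the states. -/
def code (f : β → Val) (A : OutDFA s β) : Val :=
  Val.ofList
    [Val.ofNat A.start,
     Val.ofList (List.ofFn fun q => Val.ofList (List.ofFn fun a => Val.ofNat (A.step q a))),
     Val.ofList (List.ofFn fun q => f (A.out q))]

end OutDFA

/-- An LQCI instance over the alphabet `{0, …, s-1}` whose hard specification is a DFA and whose
cost and label functions are given by DFAs with an integer attached to each state. The set of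
labels is the set of the distinct integers `labels 0, …, labels (N-1)`. -/
structure DFAInst : Type where
  s : ℕ
  hard : OutDFA s Bool
  cost : OutDFA s ℤ
  label : OutDFA s ℤ
  numLabels : ℕ
  labels : Fin numLabels → ℤ
  labels_injective : Function.Injective labels
  label_mem : ∀ w, ∃ i, labels i = label.output w
  params : Params numLabels

namespace DFAInst

/-- The LQCI instance that is described by the automata. -/
noncomputable def toInst (C : DFAInst) : Inst (Fin C.s) where
  hard := C.hard.toDFA.accepts
  cost w := (C.cost.output w : ℚ)
  numLabels := C.numLabels
  label w := (C.label_mem w).choose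
  params := C.params

theorem labels_label (C : DFAInst) (w : List (Fin C.s)) :
    C.labels (C.toInst.label w) = C.label.output w :=
  (C.label_mem w).choose_spec

/-- The input format: the length bounds in unary, all other numbers in binary. -/
def code (C : DFAInst) : Val :=
  Val.ofList
    [Val.ofNat C.s,
     C.hard.code Val.ofBool,
     C.cost.code Val.num,
     C.label.code Val.num,
     Val.ofList (List.ofFn fun i => Val.num (C.labels i)),
     Val.unary C.params.m,
     Val.unary C.params.n,
     Val.ofRat C.params.c,
     Val.ofRat C.params.lam,
     Val.ofRat C.params.rho,
     Val.ofList (List.ofFn fun i => Val.ofRat (C.params.alpha i)),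
     Val.ofList (List.ofFn fun i => Val.ofRat (C.params.beta i))]

/-- The size of an instance is the number of symbols of its description. -/
def size (C : DFAInst) : ℕ := C.code.size

end DFAInst

/-- A word is written as the list of its letters. -/
def wordCode {s : ℕ} (w : List (Fin s)) : Val :=
  Val.ofList (w.map fun a => Val.ofNat a)

/-- `G`, run without input (on the dummy value `0`), is an improviser: it halts with probability
one (as `D` has total mass one) in finite expected time, and its output distribution is an
improvising distribution. -/
def IsImproviser {s : ℕ} (C : Inst (Fin s)) (G : Prog) : Prop :=
  expTime G (.num 0) < ⊤ ∧
  ∃ D : PMF (List (Fin s)), IsImprovising C D ∧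
    ∀ w, outProb G (.num 0) (wordCode w) = D w

/-- `S` is a polynomial-time improvisation scheme for the instances given by automata: on every
such instance it halts, within a time polynomial in the size of the instance whatever the coin
tosses, and returns `0` if the instance is infeasible, and otherwise the code (marked by `1`) of an
improviser whose expected running time is polynomial in the size of the instance. -/
def IsPolyTimeScheme (S : Prog) : Prop :=
  ∃ P Q : Polynomial ℕ, ∀ C : DFAInst,
    haltProb S C.code = 1 ∧
    ∀ r : Run S C.code, r.time ≤ P.eval C.size ∧
      ((¬ Feasible C.toInst ∧ r.out = .num 0) ∨
       (Feasible C.toInst ∧ ∃ G : Prog, r.out = .pair (.num 1) G.code ∧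
          IsImproviser C.toInst G ∧
          expTime G (.num 0) ≤ ((Q.eval C.size : ℕ) : ℝ≥0∞)))

end LQCI

/-! # Polynomial-time improvisation for automata with labels and costs

An improvising distribution may be taken to give the same probability to all words that lead to the
same state of the product of the three automata: these words have the same label and the same cost,
and averaging over them keeps all constraints. The numbers of the words that lead to the states can
be large, but they are computed by dynamic programming over the word length (`DFAInst.table`,
`DFAInst.value_eq_sum`).

Feasibility then splits into two fractional knapsack problems, one inside the other. Within a label
class each state `q` with `n` words must get a share between `α n` and `β n` of the class, and the
shares add up to one; the cheapest choice is greedy (`greedy`, `greedy_optimal`), because there is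
a threshold such that cheaper states get their upper bounds and more expensive ones their lower
bounds. A class without any admissible choice must have probability zero. The classes themselves
must get probabilities between `λ` and `ρ`, where the cost of a class is that of its cheapest
distribution; again the cheapest choice is greedy. The instance is feasible if and only if the
resulting distribution exists and its cost is at most `c` (`DFAInst.feasible_iff_ok`). All shares
are kept as integers over common denominators, whose sizes are polynomial.

If the instance is feasible, this distribution gives each word a probability proportional to an
integral weight that depends only on the state that the word reaches. The same dynamic program,
with these weights, yields the total weight `Z` and a bijection of the numbers below `Z` with the
words, each repeated according to its weight (`DFAInst.unrank`, `DFAInst.sum_unrank`). The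
improviser draws a uniform number below `Z` by rejection sampling and outputs its word. Its runs
correspond to a list of rejected numbers together with an accepted one, since the coin sequences of
a program form a prefix code (`Eval.unique`), so its output distribution and its expected running
time are geometric series (`outProb_of_sample`, `expTime_of_sample`).

That all this takes polynomial time is proved with a small calculus of the functions that are
computable in polynomial time (`PT`). It is closed under composition, branching, and folds over
lists whose intermediate results have polynomial size; the closure properties are registered with
`fun_prop`, which then derives `PT f` from the definition of `f`. The improviser is a fixed program
preceded by an instruction that loads the description of the instance, so that the scheme only has
to test feasibility and to insert this description (`pt_scheme`).
-/

namespace LQCI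

/-! ### Evaluation is deterministic and pays for its data -/

/-- Every computation pays for its argument and for its result, so a time bound is also a bound
for the size of the result. -/
theorem Eval.size_le {p : Prog} {v w : Val} {s : List Bool} {t : ℕ} (h : Eval p v s w t) :
    v.size ≤ t ∧ w.size ≤ t := by
  induction h with
  | op o v => omega
  | flip v b => omega
  | pair _ _ ih ih' => simp only [Val.size]; omega
  | seq _ _ ih ih' => omega
  | iteTrue _ _ _ ih ih' => omega
  | iteFalse _ _ _ ih ih' => omega
  | loopDone _ _ ih => omega
  | loopStep _ _ _ _ ih ih' ih'' => omega

/-- The coins determine the computation; moreover the coin sequences of the computations of a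
program on a fixed argument form a prefix code. -/
theorem Eval.unique {p : Prog} {v w : Val} {s : List Bool} {t : ℕ} (h : Eval p v s w t) :
    ∀ {s' w' t'} (r r' : List Bool), Eval p v s' w' t' → s ++ r = s' ++ r' →
      s = s' ∧ w = w' ∧ t = t' := by
  induction h with
  | op o v =>
    intro s' w' t' r r' h' _
    cases h'; simp
  | flip v b =>
    intro s' w' t' r r' h' e
    cases h'; simp_all
  | pair _ _ ih ih' =>
    intro s' w' t' r r' h' e
    cases h' with
    | pair h1 h2 =>
      simp only [List.append_assoc] at e
      obtain ⟨rfl, rfl, rfl⟩ := ih _ _ h1 e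
      obtain ⟨rfl, rfl, rfl⟩ := ih' _ _ h2 (List.append_cancel_left e)
      simp
  | seq _ _ ih ih' =>
    intro s' w' t' r r' h' e
    cases h' with
    | seq h1 h2 =>
      simp only [List.append_assoc] at e
      obtain ⟨rfl, rfl, rfl⟩ := ih _ _ h1 e
      obtain ⟨rfl, rfl, rfl⟩ := ih' _ _ h2 (List.append_cancel_left e)
      simp
  | iteTrue _ hx _ ih ih' =>
    intro s' w' t' r r' h' e
    cases h' with
    | iteTrue h1 hx' h2 =>
      simp only [List.append_assoc] at e
      obtain ⟨rfl, rfl, rfl⟩ := ih _ _ h1 e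
      obtain ⟨rfl, rfl, rfl⟩ := ih' _ _ h2 (List.append_cancel_left e)
      simp
    | iteFalse h1 hx' h2 =>
      simp only [List.append_assoc] at e
      obtain ⟨rfl, rfl, rfl⟩ := ih _ _ h1 e
      exact absurd hx' hx
  | iteFalse _ hx _ ih ih' =>
    intro s' w' t' r r' h' e
    cases h' with
    | iteFalse h1 hx' h2 =>
      simp only [List.append_assoc] at e
      obtain ⟨rfl, rfl, rfl⟩ := ih _ _ h1 e
      obtain ⟨rfl, rfl, rfl⟩ := ih' _ _ h2 (List.append_cancel_left e)
      simp
    | iteTrue h1 hx' h2 =>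
      simp only [List.append_assoc] at e
      obtain ⟨rfl, rfl, rfl⟩ := ih _ _ h1 e
      exact absurd hx hx'
  | loopDone _ hx ih =>
    intro s' w' t' r r' h' e
    cases h' with
    | loopDone h1 hx' =>
      obtain ⟨rfl, rfl, rfl⟩ := ih _ _ h1 e
      simp
    | loopStep h1 hx' h2 h3 =>
      simp only [List.append_assoc] at e
      obtain ⟨rfl, rfl, rfl⟩ := ih _ _ h1 e
      exact absurd hx hx'
  | loopStep _ hx _ _ ih ih' ih'' =>
    intro s' w' t' r r' h' e
    cases h' with
    | loopDone h1 hx' =>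
      simp only [List.append_assoc] at e
      obtain ⟨rfl, rfl, rfl⟩ := ih _ _ h1 e
      exact absurd hx' hx
    | loopStep h1 hx' h2 h3 =>
      simp only [List.append_assoc] at e
      obtain ⟨rfl, rfl, rfl⟩ := ih _ _ h1 e
      have e := List.append_cancel_left e
      obtain ⟨rfl, rfl, rfl⟩ := ih' _ _ h2 e
      obtain ⟨rfl, rfl, rfl⟩ := ih'' _ _ h3 (List.append_cancel_left e)
      simp

/-! ### Functions computable in polynomial time -/

/-- Types whose elements are written down as values. -/
class Enc (α : Type) where
  /-- The description of an element. -/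
  enc : α → Val

open Enc (enc)


namespace Enc

instance : Enc Val := ⟨fun v => v⟩
instance : Enc ℤ := ⟨Val.num⟩
instance : Enc ℕ := ⟨Val.ofNat⟩
instance : Enc Bool := ⟨Val.ofBool⟩
instance : Enc Unit := ⟨fun _ => Val.num 0⟩
instance : Enc ℚ := ⟨Val.ofRat⟩
instance {α β : Type} [Enc α] [Enc β] : Enc (α × β) := ⟨fun x => .pair (enc x.1) (enc x.2)⟩
instance {α : Type} [Enc α] : Enc (List α) := ⟨fun l => Val.ofList (l.map enc)⟩

end Enc

section Encodings

variable {α β : Type} [Enc α] [Enc β]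

@[simp] theorem enc_prod (x : α × β) : enc x = .pair (enc x.1) (enc x.2) := rfl
@[simp] theorem enc_nil : enc ([] : List α) = .num 0 := rfl
@[simp] theorem enc_cons (a : α) (l : List α) : enc (a :: l) = .pair (enc a) (enc l) := rfl
theorem enc_int (n : ℤ) : enc n = .num n := rfl
theorem enc_nat (n : ℕ) : enc n = .num (n : ℤ) := rfl
theorem enc_rat (r : ℚ) : enc r = .pair (.num r.num) (.num (r.den : ℤ)) := rfl
theorem enc_true : enc true = .num 1 := rfl
theorem enc_false : enc false = .num 0 := rfl

/-- The length of the description of an element. -/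
def sz (a : α) : ℕ := (enc a).size

theorem sz_pos (a : α) : 1 ≤ sz a := by
  unfold sz
  cases enc a <;> simp only [Val.size] <;> omega

@[simp] theorem sz_prod (x : α × β) : sz x = 1 + sz x.1 + sz x.2 := rfl
@[simp] theorem sz_nil : sz ([] : List α) = 1 := by simp [sz, Val.size]
@[simp] theorem sz_cons (a : α) (l : List α) : sz (a :: l) = 1 + sz a + sz l := rfl
theorem sz_int (n : ℤ) : sz n = 1 + n.natAbs.size := rfl
theorem sz_nat (n : ℕ) : sz n = 1 + n.size := rfl
theorem sz_bool (b : Bool) : sz b ≤ 2 := by cases b <;> decide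

theorem sz_append (l l' : List α) : sz (l ++ l') + 1 = sz l + sz l' := by
  induction l with
  | nil => simp; omega
  | cons a l ih => simp; omega

theorem length_lt_sz (l : List α) : l.length < sz l := by
  induction l with
  | nil => simp
  | cons a l ih => simp; omega

theorem sz_le_of_mem {a : α} {l : List α} (h : a ∈ l) : sz a ≤ sz l := by
  induction l with
  | nil => simp at h
  | cons b l ih =>
    rcases List.mem_cons.1 h with rfl | h
    · simp; omega
    · have := ih h
      simp; omega

theorem sz_le_of_prefix {l l' : List α} (h : l <+: l') : sz l ≤ sz l' := by
  obtain ⟨r, rfl⟩ := h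
  have := sz_append l r
  have := sz_pos r
  omega

theorem sz_le_of_suffix {l l' : List α} (h : l <:+ l') : sz l ≤ sz l' := by
  obtain ⟨r, rfl⟩ := h
  have := sz_append r l
  have := sz_pos r
  omega

/-- A list is at most as long to write down as its length and the size of its elements admit. -/
theorem sz_list_le (l : List α) (B : ℕ) (h : ∀ a ∈ l, sz a ≤ B) :
    sz l ≤ 1 + l.length * (1 + B) := by
  induction l with
  | nil => simp
  | cons a l ih =>
    have h1 := h a (by simp)
    have h2 := ih fun b hb => h b (by simp [hb])
    simp only [sz_cons, List.length_cons]
    ring_nf at h2 ⊢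
    omega

end Encodings

theorem nat_size_add_le (a b : ℕ) : (a + b).size ≤ a.size + b.size + 1 := by
  rw [Nat.size_le]
  have ha := Nat.lt_size_self a
  have hb := Nat.lt_size_self b
  have h1 : 2 ^ a.size ≤ 2 ^ (a.size + b.size) := Nat.pow_le_pow_right (by norm_num) (by omega)
  have h2 : 2 ^ b.size ≤ 2 ^ (a.size + b.size) := Nat.pow_le_pow_right (by norm_num) (by omega)
  rw [pow_succ]
  omega

theorem nat_size_mul_le (a b : ℕ) : (a * b).size ≤ a.size + b.size := by
  rw [Nat.size_le, pow_add]
  exact Nat.mul_lt_mul'' (Nat.lt_size_self a) (Nat.lt_size_self b)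

theorem nat_size_pow_le (a k : ℕ) : (a ^ k).size ≤ k * a.size + 1 := by
  induction k with
  | zero => simp
  | succ k ih =>
    rw [pow_succ]
    have := nat_size_mul_le (a ^ k) a
    rw [add_mul]
    omega

theorem sz_add_le (a b : ℕ) : sz (a + b) ≤ sz a + sz b := by
  have := nat_size_add_le a b
  simp only [sz_nat]; omega

theorem sz_int_add_le (a b : ℤ) : sz (a + b) ≤ sz a + sz b := by
  have := nat_size_add_le a.natAbs b.natAbs
  have := Nat.size_le_size (Int.natAbs_add_le a b)
  simp only [sz_int]; omega

theorem sz_mul_le (a b : ℕ) : sz (a * b) ≤ sz a + sz b := by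
  have := nat_size_mul_le a b
  simp only [sz_nat]; omega

theorem sz_nat_mono {a b : ℕ} (h : a ≤ b) : sz a ≤ sz b := by
  have := Nat.size_le_size h
  simp only [sz_nat]; omega

theorem poly_mono (P : Polynomial ℕ) {x y : ℕ} (h : x ≤ y) : P.eval x ≤ P.eval y := by
  induction P using Polynomial.induction_on' with
  | add p q hp hq => simp only [Polynomial.eval_add]; omega
  | monomial n a =>
    simp only [Polynomial.eval_monomial]
    exact Nat.mul_le_mul_left _ (Nat.pow_le_pow_left h n)

section PolyBdd

variable {α : Type} [Enc α]

/-- The number `g a` is bounded by a polynomial in the size of `a`. -/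
def PolyBdd (g : α → ℕ) : Prop := ∃ P : Polynomial ℕ, ∀ a, g a ≤ P.eval (sz a)

namespace PolyBdd

variable {g g' : α → ℕ}

theorem mono (h : PolyBdd g') (hle : ∀ a, g a ≤ g' a) : PolyBdd g :=
  let ⟨P, hP⟩ := h
  ⟨P, fun a => (hle a).trans (hP a)⟩

theorem const (k : ℕ) : PolyBdd (fun _ : α => k) := ⟨Polynomial.C k, fun a => by simp⟩

theorem self : PolyBdd (fun a : α => sz a) := ⟨Polynomial.X, fun a => by simp⟩

theorem add (h : PolyBdd g) (h' : PolyBdd g') : PolyBdd (fun a => g a + g' a) :=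
  let ⟨P, hP⟩ := h
  let ⟨Q, hQ⟩ := h'
  ⟨P + Q, fun a => by simpa using Nat.add_le_add (hP a) (hQ a)⟩

theorem mul (h : PolyBdd g) (h' : PolyBdd g') : PolyBdd (fun a => g a * g' a) :=
  let ⟨P, hP⟩ := h
  let ⟨Q, hQ⟩ := h'
  ⟨P * Q, fun a => by simpa using Nat.mul_le_mul (hP a) (hQ a)⟩

theorem eval (h : PolyBdd g) (Q : Polynomial ℕ) : PolyBdd (fun a => Q.eval (g a)) :=
  let ⟨P, hP⟩ := h
  ⟨Q.comp P, fun a => by simpa using poly_mono Q (hP a)⟩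

end PolyBdd

end PolyBdd

/-- `f` is computed, on all descriptions of elements, by a program that tosses no coins and whose
running time is bounded by a polynomial in the size of the argument. -/
@[fun_prop]
def PT {α β : Type} [Enc α] [Enc β] (f : α → β) : Prop :=
  ∃ p : Prog, ∃ P : Polynomial ℕ, ∀ a, ∃ t ≤ P.eval (sz a), Eval p (enc a) [] (enc (f a)) t

/-- The predicate `p` is decided in polynomial time. -/
@[fun_prop]
def PTPred {α : Type} [Enc α] (p : α → Prop) : Prop :=
  ∃ b : α → Bool, PT b ∧ ∀ a, b a = true ↔ p a

namespace PT

variable {α β γ σ : Type} [Enc α] [Enc β] [Enc γ] [Enc σ]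

/-- The form in which running times are usually given. -/
theorem intro {f : α → β} (p : Prog) (T : α → ℕ) (hT : PolyBdd T)
    (h : ∀ a, ∃ t ≤ T a, Eval p (enc a) [] (enc (f a)) t) : PT f := by
  obtain ⟨P, hP⟩ := hT
  refine ⟨p, P, fun a => ?_⟩
  obtain ⟨t, ht, he⟩ := h a
  exact ⟨t, ht.trans (hP a), he⟩

/-- The result of a polynomial-time computation has polynomial size. -/
theorem size {f : α → β} (hf : PT f) : PolyBdd (fun a => sz (f a)) := by
  obtain ⟨p, P, h⟩ := hf
  refine ⟨P, fun a => ?_⟩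
  obtain ⟨t, ht, he⟩ := h a
  exact he.size_le.2.trans ht

theorem of_op {f : α → β} (o : Op) (h : ∀ a, o.app (enc a) = enc (f a))
    (hs : PolyBdd (fun a => sz (f a))) : PT f := by
  refine intro (.op o) (fun a => sz a + sz (f a)) (PolyBdd.self.add hs) fun a => ?_
  refine ⟨_, le_rfl, ?_⟩
  have := Eval.op o (enc a)
  rw [h a] at this
  exact this

@[fun_prop]
theorem id : PT (fun a : α => a) := of_op .id (fun _ => rfl) PolyBdd.self

@[fun_prop]
theorem const (b : β) : PT (fun _ : α => b) :=
  of_op (.const (enc b)) (fun _ => rfl) (PolyBdd.const _)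

@[fun_prop]
theorem comp {g : β → γ} {f : α → β} (hg : PT g) (hf : PT f) : PT (fun a => g (f a)) := by
  have hs := hf.size
  obtain ⟨p, P, hp⟩ := hf
  obtain ⟨q, Q, hq⟩ := hg
  refine intro (.seq p q) (fun a => P.eval (sz a) + Q.eval (sz (f a)) + 1)
    (((PolyBdd.self.eval P).add (hs.eval Q)).add (PolyBdd.const 1)) fun a => ?_
  obtain ⟨t, ht, he⟩ := hp a
  obtain ⟨t', ht', he'⟩ := hq (f a)
  exact ⟨_, by omega, .seq he he'⟩

@[fun_prop]
theorem prodMk {f : α → β} {g : α → γ} (hf : PT f) (hg : PT g) : PT (fun a => (f a, g a)) := by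
  obtain ⟨p, P, hp⟩ := hf
  obtain ⟨q, Q, hq⟩ := hg
  refine intro (.pair p q) (fun a => P.eval (sz a) + Q.eval (sz a) + 1)
    (((PolyBdd.self.eval P).add (PolyBdd.self.eval Q)).add (PolyBdd.const 1)) fun a => ?_
  obtain ⟨t, ht, he⟩ := hp a
  obtain ⟨t', ht', he'⟩ := hq a
  exact ⟨_, by omega, .pair he he'⟩

theorem fst' : PT (Prod.fst : α × β → α) :=
  of_op .fst (fun _ => rfl) (PolyBdd.self.mono fun a => by rw [sz_prod]; omega)

theorem snd' : PT (Prod.snd : α × β → β) :=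
  of_op .snd (fun _ => rfl) (PolyBdd.self.mono fun a => by rw [sz_prod]; omega)

@[fun_prop]
theorem fst {f : α → β × γ} (hf : PT f) : PT (fun a => (f a).1) := fst'.comp hf

@[fun_prop]
theorem snd {f : α → β × γ} (hf : PT f) : PT (fun a => (f a).2) := snd'.comp hf

/-- Two elements with the same description are interchangeable. -/
theorem of_enc_eq {f : α → β} {g : α → γ} (hf : PT f) (h : ∀ a, enc (f a) = enc (g a)) : PT g := by
  obtain ⟨p, P, hp⟩ := hf
  exact ⟨p, P, fun a => h a ▸ hp a⟩

/-! ### Branching and iteration -/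

theorem cond {c : α → Bool} {f g : α → β} (hc : PT c) (hf : PT f) (hg : PT g) :
    PT (fun a => bif c a then f a else g a) := by
  obtain ⟨r, R, hr⟩ := hc
  obtain ⟨p, P, hp⟩ := hf
  obtain ⟨q, Q, hq⟩ := hg
  refine intro (.ite r p q) (fun a => R.eval (sz a) + P.eval (sz a) + Q.eval (sz a) + 1)
    ((((PolyBdd.self.eval R).add (PolyBdd.self.eval P)).add (PolyBdd.self.eval Q)).add
      (PolyBdd.const 1)) fun a => ?_
  obtain ⟨u, hu, hc⟩ := hr a
  obtain ⟨t, ht, he⟩ := hp a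
  obtain ⟨t', ht', he'⟩ := hq a
  cases h : c a
  · rw [h] at hc
    exact ⟨_, by omega, .iteFalse hc rfl he'⟩
  · rw [h] at hc
    exact ⟨_, by omega, .iteTrue hc (by simp [enc_true]) he⟩

@[fun_prop]
theorem ite {c : α → Prop} [∀ a, Decidable (c a)] {f g : α → β} (hc : PTPred c) (hf : PT f)
    (hg : PT g) : PT (fun a => if c a then f a else g a) := by
  obtain ⟨b, hb, h⟩ := hc
  have := cond hb hf hg
  convert this using 2 with a
  by_cases hca : c a
  · simp [hca, (h a).2 hca]
  · have : b a = false := by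
      rw [← Bool.not_eq_true, h a]
      exact hca
    simp [hca, this]

theorem listCases {l : α → List β} {g : α → γ} {h : α → β → List β → γ} (hl : PT l) (hg : PT g)
    (hh : PT (fun x : α × β × List β => h x.1 x.2.1 x.2.2)) :
    PT (fun a => match l a with
      | [] => g a
      | b :: t => h a b t) := by
  have hls := hl.size
  obtain ⟨r, R, hr⟩ := hl
  obtain ⟨p, P, hp⟩ := hg
  obtain ⟨q, Q, hq⟩ := hh
  refine intro (.ite (.seq r (.op .isNum)) p (.seq (.pair (.op .id) r) q))
    (fun a => 2 * R.eval (sz a) + P.eval (sz a) + Q.eval (2 + sz a + sz (l a)) +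
      3 * sz a + sz (l a) + 10) ?_ fun a => ?_
  · exact ((((((PolyBdd.const 2).mul (PolyBdd.self.eval R)).add (PolyBdd.self.eval P)).add
      ((((PolyBdd.const 2).add PolyBdd.self).add hls).eval Q)).add
      ((PolyBdd.const 3).mul PolyBdd.self)).add hls).add (PolyBdd.const 10)
  · obtain ⟨u, hu, hc⟩ := hr a
    obtain ⟨t, ht, he⟩ := hp a
    cases hla : l a with
    | nil =>
      rw [hla] at hc
      have e1 := Eval.seq hc (Eval.op .isNum (enc ([] : List β)))
      refine ⟨_, ?_, .iteTrue e1 (by simp [Op.app, Val.isNum, Val.ofBool]) he⟩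
      simp [Val.size, Op.app, Val.ofBool, Val.isNum]
      omega
    | cons b m =>
      rw [hla] at hc
      have e1 := Eval.seq hc (Eval.op .isNum (enc (b :: m)))
      obtain ⟨t', ht', he'⟩ := hq (a, b, m)
      have e2 : Eval (.pair (.op .id) r) (enc a) [] (enc (a, b, m)) _ := .pair (.op .id _) hc
      refine ⟨_, ?_, .iteFalse e1 rfl (.seq e2 he')⟩
      have hsz : sz (a, b, m) ≤ 2 + sz a + sz (b :: m) := by simp only [sz_prod, sz_cons]; omega
      have h1 := poly_mono Q hsz
      have h2 : ((Op.id).app (enc a)).size = sz a := rfl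
      have h3 : (enc a).size = sz a := rfl
      have h4 : ((Op.isNum).app (enc (b :: m))).size = 1 := by
        simp [Op.app, Val.isNum, Val.ofBool, Val.size]
      have h5 : (enc (b :: m)).size = sz (b :: m) := rfl
      omega

end PT

namespace PT

variable {α β γ σ : Type} [Enc α] [Enc β] [Enc γ] [Enc σ]

/-- A while loop runs in polynomial time if the number of its rounds and the sizes of all
intermediate states are polynomially bounded. -/
theorem iterate_while {c : σ → Bool} {f : σ → σ} {init : α → σ} {k : α → ℕ} (hc : PT c)
    (hf : PT f) (hi : PT init) (h1 : ∀ a, ∀ i < k a, c (f^[i] (init a)) = true)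
    (h0 : ∀ a, c (f^[k a] (init a)) = false) (hk : PolyBdd k)
    (hs : ∃ P : Polynomial ℕ, ∀ a, ∀ i ≤ k a, sz (f^[i] (init a)) ≤ P.eval (sz a)) :
    PT (fun a => f^[k a] (init a)) := by
  obtain ⟨r, R, hr⟩ := hc
  obtain ⟨p, P, hp⟩ := hf
  obtain ⟨q, Q, hq⟩ := hi
  obtain ⟨S, hS⟩ := hs
  refine intro (.seq q (.loop r p)) (fun a => Q.eval (sz a) +
    (k a + 1) * (R.eval (S.eval (sz a)) + P.eval (S.eval (sz a)) + 1) + 1) ?_ fun a => ?_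
  · exact ((PolyBdd.self.eval Q).add ((hk.add (PolyBdd.const 1)).mul
      ((((PolyBdd.self.eval S).eval R).add ((PolyBdd.self.eval S).eval P)).add
        (PolyBdd.const 1)))).add (PolyBdd.const 1)
  · have key : ∀ j ≤ k a, ∃ t ≤ (j + 1) * (R.eval (S.eval (sz a)) + P.eval (S.eval (sz a)) + 1),
        Eval (.loop r p) (enc (f^[k a - j] (init a))) [] (enc (f^[k a] (init a))) t := by
      intro j
      induction j with
      | zero =>
        intro _
        obtain ⟨u, hu, e⟩ := hr (f^[k a] (init a))
        have := poly_mono R (hS a (k a) le_rfl)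
        rw [h0] at e
        exact ⟨_, by omega, .loopDone e rfl⟩
      | succ j ih =>
        intro hj
        obtain ⟨t, ht, e⟩ := ih (by omega)
        obtain ⟨u, hu, e1⟩ := hr (f^[k a - (j + 1)] (init a))
        obtain ⟨u', hu', e2⟩ := hp (f^[k a - (j + 1)] (init a))
        have hR := poly_mono R (hS a (k a - (j + 1)) (by omega))
        have hP := poly_mono P (hS a (k a - (j + 1)) (by omega))
        rw [h1 a _ (by omega)] at e1
        rw [← Function.iterate_succ_apply' f, show (k a - (j + 1)).succ = k a - j by omega] at e2
        refine ⟨_, ?_, .loopStep e1 (by simp [enc_true]) e2 e⟩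
        rw [add_mul (j + 1) 1]
        omega
    obtain ⟨t, ht, e⟩ := hq a
    obtain ⟨t', ht', e'⟩ := key (k a) le_rfl
    rw [Nat.sub_self] at e'
    exact ⟨_, by omega, .seq e e'⟩

theorem isCons : PT (fun l : List β => !l.isEmpty) := by
  have := listCases (l := fun l : List β => l) (g := fun _ => false) (h := fun _ _ _ => true)
    id (const _) (const _)
  convert this using 2 with l
  cases l <;> rfl

/-- Folding over a list, provided that the intermediate results stay small. -/
theorem foldl {l : α → List β} {f : α → σ → β → σ} {init : α → σ} (hl : PT l)
    (hf : PT (fun x : α × σ × β => f x.1 x.2.1 x.2.2)) (hi : PT init)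
    (hs : ∃ P : Polynomial ℕ, ∀ a, ∀ l', l' <+: l a →
      sz (l'.foldl (f a) (init a)) ≤ P.eval (sz a)) :
    PT (fun a => (l a).foldl (f a) (init a)) := by
  let F : List β × α × σ → List β × α × σ := fun x => match x.1 with
    | [] => x
    | b :: t => (t, x.2.1, f x.2.1 x.2.2 b)
  have hF : PT F := by
    refine listCases (l := fun x : List β × α × σ => x.1) (g := fun x => x)
      (h := fun x b t => (t, x.2.1, f x.2.1 x.2.2 b)) (by fun_prop) (by fun_prop) ?_
    refine prodMk (by fun_prop) (prodMk (by fun_prop) ?_)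
    exact hf.comp (f := fun x : (List β × α × σ) × β × List β => (x.1.2.1, x.1.2.2, x.2.1))
      (by fun_prop)
  have hit : ∀ a i, i ≤ (l a).length → F^[i] (l a, a, init a) =
      ((l a).drop i, a, ((l a).take i).foldl (f a) (init a)) := by
    intro a i
    induction i with
    | zero => simp
    | succ i ih =>
      intro hi
      rw [Function.iterate_succ_apply', ih (by omega)]
      have hd : (l a).drop i = (l a)[i] :: (l a).drop (i + 1) := List.drop_eq_getElem_cons hi
      have ht : (l a).take (i + 1) = (l a).take i ++ [(l a)[i]] := by
        rw [List.take_append_getElem]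
      simp only [F]
      rw [hd]
      simp only [ht, List.foldl_append, List.foldl_cons, List.foldl_nil]
  have hls := hl.size
  obtain ⟨P, hP⟩ := hs
  obtain ⟨Q, hQ⟩ := hls
  have hloop : PT (fun a => F^[(l a).length] (l a, a, init a)) := by
    refine iterate_while (c := fun x => !x.1.isEmpty) (k := fun a => (l a).length)
      (isCons.comp (by fun_prop)) hF (by fun_prop) ?_ ?_ ?_ ?_
    · intro a i hi
      rw [hit a i hi.le, List.drop_eq_getElem_cons hi]
      rfl
    · intro a
      rw [hit a _ le_rfl]
      simp
    · exact PolyBdd.mono ⟨Q, hQ⟩ fun a => (length_lt_sz _).le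
    · refine ⟨Q + Polynomial.X + P + Polynomial.C 2, fun a i hi => ?_⟩
      rw [hit a i hi]
      have h1 := hP a _ (List.take_prefix i (l a))
      have h2 : sz (l a) ≤ _ := hQ a
      have h3 := sz_le_of_suffix (List.drop_suffix i (l a))
      simp only [sz_prod, Polynomial.eval_add, Polynomial.eval_X, Polynomial.eval_C]
      omega
  convert (snd (snd hloop)) using 2 with a
  rw [hit a _ le_rfl]
  simp

/-- Folding over a list, provided that each step adds only little to the result. -/
theorem foldl_of_add {l : α → List β} {f : α → σ → β → σ} {init : α → σ} (hl : PT l)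
    (hf : PT (fun x : α × σ × β => f x.1 x.2.1 x.2.2)) (hi : PT init)
    (hs : ∃ P : Polynomial ℕ, ∀ a s, ∀ b ∈ l a, sz (f a s b) ≤ sz s + P.eval (sz a)) :
    PT (fun a => (l a).foldl (f a) (init a)) := by
  refine foldl hl hf hi ?_
  obtain ⟨P, hP⟩ := hs
  obtain ⟨Q, hQ⟩ := hl.size
  obtain ⟨R, hR⟩ := hi.size
  refine ⟨R + Q * P, fun a l' hl' => ?_⟩
  have key : ∀ l' : List β, ∀ s, (∀ b ∈ l', b ∈ l a) →
      sz (l'.foldl (f a) s) ≤ sz s + l'.length * P.eval (sz a) := by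
    intro l'
    induction l' with
    | nil => intro s _; simp
    | cons b t ih =>
      intro s h
      have h1 := ih (f a s b) fun b hb => h b (by simp [hb])
      have h2 := hP a s b (h b (by simp))
      simp only [List.foldl_cons, List.length_cons, add_mul]
      omega
  have h1 := key l' (init a) fun b hb => hl'.subset hb
  have h2 : l'.length ≤ Q.eval (sz a) :=
    (length_lt_sz l').le.trans ((sz_le_of_prefix hl').trans (hQ a))
  have h3 := Nat.mul_le_mul_right (P.eval (sz a)) h2
  have h4 : sz (init a) ≤ _ := hR a
  simp only [Polynomial.eval_add, Polynomial.eval_mul]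
  omega

/-! ### Arithmetic -/

theorem of_op₂ {f : α → ℤ} {g : α → ℤ} {h : ℤ → ℤ → ℤ} (o : Op) (hf : PT f) (hg : PT g)
    (ho : ∀ a b : ℤ, o.app (enc (a, b)) = enc (h a b))
    (hs : ∀ a b : ℤ, sz (h a b) ≤ sz a + sz b) : PT (fun a => h (f a) (g a)) := by
  have h1 : PT (fun x : ℤ × ℤ => h x.1 x.2) := of_op o (fun x => ho x.1 x.2)
    (PolyBdd.self.mono fun x => by have := hs x.1 x.2; rw [sz_prod]; omega)
  exact h1.comp (prodMk hf hg)

@[fun_prop]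
theorem intAdd {f g : α → ℤ} (hf : PT f) (hg : PT g) : PT (fun a => f a + g a) :=
  of_op₂ (h := fun a b => a + b) .add hf hg (fun _ _ => rfl) sz_int_add_le

@[fun_prop]
theorem intSub {f g : α → ℤ} (hf : PT f) (hg : PT g) : PT (fun a => f a - g a) :=
  of_op₂ (h := fun a b => a - b) .sub hf hg (fun _ _ => rfl) fun a b => by
    have := sz_int_add_le a (-b)
    simpa [sz_int, sub_eq_add_neg] using this

@[fun_prop]
theorem intMul {f g : α → ℤ} (hf : PT f) (hg : PT g) : PT (fun a => f a * g a) :=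
  of_op₂ (h := fun a b => a * b) .mul hf hg (fun _ _ => rfl) fun a b => by
    have := nat_size_mul_le a.natAbs b.natAbs
    simp only [sz_int, Int.natAbs_mul]; omega

@[fun_prop]
theorem natCast {f : α → ℕ} (hf : PT f) : PT (fun a => (f a : ℤ)) :=
  of_enc_eq hf fun _ => rfl

/-- A function with values in the natural numbers is computed on the integers. -/
theorem of_cast {f : α → ℕ} (hf : PT (fun a => (f a : ℤ))) : PT f :=
  of_enc_eq hf fun _ => rfl

@[fun_prop]
theorem natAdd {f g : α → ℕ} (hf : PT f) (hg : PT g) : PT (fun a => f a + g a) :=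
  of_cast (by push_cast; fun_prop)

@[fun_prop]
theorem natMul {f g : α → ℕ} (hf : PT f) (hg : PT g) : PT (fun a => f a * g a) :=
  of_cast (by push_cast; fun_prop)

@[fun_prop]
theorem natDiv {f g : α → ℕ} (hf : PT f) (hg : PT g) : PT (fun a => f a / g a) := by
  have h1 : PT (fun x : ℕ × ℕ => x.1 / x.2) := by
    refine of_op .div (fun x => ?_) (PolyBdd.self.mono fun x => ?_)
    · simp [Op.app, enc_nat, Val.fst, Val.snd, Val.toInt]
    · have := sz_nat_mono (Nat.div_le_self x.1 x.2)
      rw [sz_prod]; omega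
  exact h1.comp (prodMk hf hg)

@[fun_prop]
theorem ratNum {f : α → ℚ} (hf : PT f) : PT (fun a => (f a).num) :=
  (of_op (f := fun r : ℚ => r.num) .fst (fun _ => rfl) (PolyBdd.self.mono fun r => by
    simp only [sz, enc_rat, Val.size, enc_int]; omega)).comp hf

@[fun_prop]
theorem ratDen {f : α → ℚ} (hf : PT f) : PT (fun a => (f a).den) :=
  (of_op (f := fun r : ℚ => r.den) .snd (fun _ => rfl) (PolyBdd.self.mono fun r => by
    simp only [sz, enc_rat, Val.size, enc_nat]; omega)).comp hf

end PT

/-! ### Decidable predicates -/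

namespace PTPred

variable {α β : Type} [Enc α] [Enc β]

theorem of_iff {p q : α → Prop} (hp : PTPred p) (h : ∀ a, q a ↔ p a) : PTPred q := by
  obtain ⟨b, hb, hbp⟩ := hp
  exact ⟨b, hb, fun a => (hbp a).trans (h a).symm⟩

@[fun_prop]
theorem bool {f : α → Bool} (hf : PT f) : PTPred (fun a => f a = true) := ⟨f, hf, fun _ => Iff.rfl⟩

@[fun_prop]
theorem intLe {f g : α → ℤ} (hf : PT f) (hg : PT g) : PTPred (fun a => f a ≤ g a) := by
  refine ⟨fun a => decide (f a ≤ g a), ?_, fun a => by simp⟩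
  have : PT (fun x : ℤ × ℤ => decide (x.1 ≤ x.2)) :=
    PT.of_op .le (fun _ => rfl) ((PolyBdd.const 2).mono fun _ => sz_bool _)
  exact this.comp (hf.prodMk hg)

@[fun_prop]
theorem natLe {f g : α → ℕ} (hf : PT f) (hg : PT g) : PTPred (fun a => f a ≤ g a) :=
  (intLe hf.natCast hg.natCast).of_iff fun a => by simp

@[fun_prop]
theorem not {p : α → Prop} (hp : PTPred p) : PTPred (fun a => ¬ p a) := by
  obtain ⟨b, hb, hbp⟩ := hp
  refine ⟨_, PT.cond hb (PT.const false) (PT.const true), fun a => ?_⟩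
  change _ ↔ ¬ p a
  rw [← hbp a]
  cases b a <;> simp

@[fun_prop]
theorem and {p q : α → Prop} (hp : PTPred p) (hq : PTPred q) : PTPred (fun a => p a ∧ q a) := by
  obtain ⟨b, hb, hbp⟩ := hp
  obtain ⟨c, hc, hcq⟩ := hq
  refine ⟨_, PT.cond hb hc (PT.const false), fun a => ?_⟩
  change _ ↔ p a ∧ q a
  rw [← hbp a, ← hcq a]
  cases b a <;> simp

@[fun_prop]
theorem or {p q : α → Prop} (hp : PTPred p) (hq : PTPred q) : PTPred (fun a => p a ∨ q a) :=
  ((hp.not.and hq.not).not).of_iff fun a => by tauto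

@[fun_prop]
theorem intLt {f g : α → ℤ} (hf : PT f) (hg : PT g) : PTPred (fun a => f a < g a) :=
  (intLe hg hf).not.of_iff fun a => by simp

@[fun_prop]
theorem natLt {f g : α → ℕ} (hf : PT f) (hg : PT g) : PTPred (fun a => f a < g a) :=
  (natLe hg hf).not.of_iff fun a => by simp

@[fun_prop]
theorem intEq {f g : α → ℤ} (hf : PT f) (hg : PT g) : PTPred (fun a => f a = g a) :=
  ((intLe hf hg).and (intLe hg hf)).of_iff fun _ => le_antisymm_iff

@[fun_prop]
theorem natEq {f g : α → ℕ} (hf : PT f) (hg : PT g) : PTPred (fun a => f a = g a) :=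
  ((natLe hf hg).and (natLe hg hf)).of_iff fun _ => le_antisymm_iff

end PTPred

theorem PT.decide {α : Type} [Enc α] {p : α → Prop} [∀ a, Decidable (p a)] (hp : PTPred p) :
    PT (fun a => Decidable.decide (p a)) := by
  have := PT.ite hp (PT.const true) (PT.const false)
  convert this using 2 with a
  by_cases h : p a <;> simp [h]

namespace PT

variable {α β γ σ : Type} [Enc α] [Enc β] [Enc γ] [Enc σ]

@[fun_prop]
theorem natSub {f g : α → ℕ} (hf : PT f) (hg : PT g) : PT (fun a => f a - g a) := by
  have : PT (fun a => if g a ≤ f a then (f a : ℤ) - g a else 0) := by fun_prop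
  refine of_cast ?_
  convert this using 2 with a
  split_ifs with h <;> omega

@[fun_prop]
theorem natMin {f g : α → ℕ} (hf : PT f) (hg : PT g) : PT (fun a => min (f a) (g a)) := by
  have : PT (fun a => if f a ≤ g a then f a else g a) := by fun_prop
  exact this

@[fun_prop]
theorem intToNat {f : α → ℤ} (hf : PT f) : PT (fun a => (f a).toNat) := by
  have : PT (fun a => if 0 ≤ f a then f a else 0) := by fun_prop
  refine of_cast ?_
  convert this using 2 with a
  split_ifs with h <;> omega

end PT

/-! ### Lists -/

namespace PT

variable {α β γ σ : Type} [Enc α] [Enc β] [Enc γ] [Enc σ]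

@[fun_prop]
theorem cons {f : α → β} {l : α → List β} (hf : PT f) (hl : PT l) : PT (fun a => f a :: l a) :=
  of_enc_eq (prodMk hf hl) fun _ => rfl

@[fun_prop]
theorem tail {l : α → List β} (hl : PT l) : PT (fun a => (l a).tail) := by
  have := listCases hl (const ([] : List β)) (h := fun _ _ t => t) (by fun_prop)
  convert this using 2 with a
  cases l a <;> rfl

/-- The size of an entry of a computed list is polynomial in the size of the argument. -/
theorem size_mem {l : α → List β} (hl : PT l) {f : α → β → γ}
    (hf : PT (fun x : α × β => f x.1 x.2)) :
    ∃ P : Polynomial ℕ, ∀ a, ∀ b ∈ l a, sz (f a b) ≤ P.eval (sz a) := by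
  obtain ⟨P, hP⟩ := hl.size
  obtain ⟨Q, hQ⟩ := hf.size
  refine ⟨Q.comp (Polynomial.C 1 + Polynomial.X + P), fun a b hb => ?_⟩
  refine (hQ (a, b)).trans ?_
  rw [Polynomial.eval_comp]
  refine poly_mono Q ?_
  have := (sz_le_of_mem hb).trans (hP a)
  simp only [sz_prod, Polynomial.eval_add, Polynomial.eval_X, Polynomial.eval_C]
  omega

theorem revAppend {l l' : α → List β} (hl : PT l) (hl' : PT l') :
    PT (fun a => (l a).reverse ++ l' a) := by
  have := foldl_of_add (f := fun _ s b => b :: s) hl (by fun_prop) hl' (by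
    obtain ⟨P, hP⟩ := size_mem (f := fun _ b => b) hl (by fun_prop)
    refine ⟨P + Polynomial.C 1, fun a s b hb => ?_⟩
    have := hP a b hb
    simp only [sz_cons, Polynomial.eval_add, Polynomial.eval_C]
    omega)
  convert this using 2 with a
  generalize l' a = m
  induction l a generalizing m with
  | nil => rfl
  | cons b t ih => simp [← ih]

@[fun_prop]
theorem reverse {l : α → List β} (hl : PT l) : PT (fun a => (l a).reverse) := by
  simpa using revAppend hl (const [])

@[fun_prop]
theorem append {l l' : α → List β} (hl : PT l) (hl' : PT l') : PT (fun a => l a ++ l' a) := by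
  simpa using revAppend hl.reverse hl'

/-- Folding from the right, provided that the intermediate results stay small. -/
theorem foldr {l : α → List β} {f : α → β → σ → σ} {init : α → σ} (hl : PT l)
    (hf : PT (fun x : α × β × σ => f x.1 x.2.1 x.2.2)) (hi : PT init)
    (hs : ∃ P : Polynomial ℕ, ∀ a, ∀ l', l' <:+ l a →
      sz (l'.foldr (f a) (init a)) ≤ P.eval (sz a)) :
    PT (fun a => (l a).foldr (f a) (init a)) := by
  have := foldl (f := fun a s b => f a b s) hl.reverse
    (hf.comp (f := fun x : α × σ × β => (x.1, x.2.2, x.2.1)) (by fun_prop)) hi (by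
      obtain ⟨P, hP⟩ := hs
      refine ⟨P, fun a l' h => ?_⟩
      have := hP a l'.reverse (by simpa using List.reverse_suffix.2 h)
      simpa using this)
  simpa using this

@[fun_prop]
theorem map {l : α → List β} {f : α → β → γ} (hl : PT l) (hf : PT (fun x : α × β => f x.1 x.2)) :
    PT (fun a => (l a).map (f a)) := by
  have := foldl_of_add (f := fun a (s : List γ) b => f a b :: s) (init := fun _ => [])
    hl.reverse ((hf.comp (f := fun x : α × List γ × β => (x.1, x.2.2)) (by fun_prop)).cons
      (by fun_prop)) (const _) (by
      obtain ⟨P, hP⟩ := size_mem hl hf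
      refine ⟨P + Polynomial.C 1, fun a s b hb => ?_⟩
      have := hP a b (by simpa using hb)
      simp only [sz_cons, Polynomial.eval_add, Polynomial.eval_C]
      omega)
  simpa using this

theorem flatten {l : α → List (List β)} (hl : PT l) : PT (fun a => (l a).flatten) := by
  have := foldl_of_add (f := fun a (s : List β) b => b ++ s) (init := fun _ => [])
    hl.reverse (by fun_prop) (const _) (by
      obtain ⟨P, hP⟩ := size_mem (f := fun _ b => b) hl (by fun_prop)
      refine ⟨P, fun a s b hb => ?_⟩
      have := hP a b (by simpa using hb)
      have := sz_append b s
      omega)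
  convert this using 2 with a
  rw [List.foldl_reverse]
  induction l a with
  | nil => rfl
  | cons b t ih => simp [ih]

@[fun_prop]
theorem product {l : α → List β} {l' : α → List γ} (hl : PT l) (hl' : PT l') :
    PT (fun a => l a ×ˢ l' a) := by
  have : PT (fun a => ((l a).map fun b => (l' a).map fun c => (b, c)).flatten) := by
    refine flatten (map hl (map (f := fun (x : α × β) c => (x.2, c)) ?_ ?_)) <;> fun_prop
  convert this using 2 with a
  generalize l a = m
  induction m with
  | nil => rfl
  | cons b t ih => simp [← ih]

@[fun_prop]
theorem natListSum {l : α → List ℕ} (hl : PT l) : PT (fun a => (l a).sum) := by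
  have := foldl_of_add (f := fun a (s : ℕ) b => s + b) (init := fun _ => 0)
    hl (by fun_prop) (const _) (by
      obtain ⟨P, hP⟩ := size_mem (f := fun _ b => b) hl (by fun_prop)
      refine ⟨P, fun a s b hb => ?_⟩
      have := hP a b (by simpa using hb)
      have := sz_add_le s b
      omega)
  convert this using 2 with a
  rw [List.sum_eq_foldl]

@[fun_prop]
theorem intListSum {l : α → List ℤ} (hl : PT l) : PT (fun a => (l a).sum) := by
  have := foldl_of_add (f := fun a (s : ℤ) b => s + b) (init := fun _ => 0)
    hl (by fun_prop) (const _) (by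
      obtain ⟨P, hP⟩ := size_mem (f := fun _ b => b) hl (by fun_prop)
      refine ⟨P, fun a s b hb => ?_⟩
      have := hP a b (by simpa using hb)
      have := sz_int_add_le s b
      omega)
  convert this using 2 with a
  rw [List.sum_eq_foldl]

@[fun_prop]
theorem natListProd {l : α → List ℕ} (hl : PT l) : PT (fun a => (l a).prod) := by
  have := foldl_of_add (f := fun a (s : ℕ) b => s * b) (init := fun _ => 1)
    hl (by fun_prop) (const _) (by
      obtain ⟨P, hP⟩ := size_mem (f := fun _ b => b) hl (by fun_prop)
      refine ⟨P, fun a s b hb => ?_⟩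
      have := hP a b (by simpa using hb)
      have := sz_mul_le s b
      omega)
  convert this using 2 with a
  rw [List.prod_eq_foldl]

@[fun_prop]
theorem length {l : α → List β} (hl : PT l) : PT (fun a => (l a).length) := by
  have : PT (fun a => ((l a).map fun _ => 1).sum) := by fun_prop
  simpa using this

/-- The numbers below a number that is given in unary. -/
@[fun_prop]
theorem range_length {l : α → List β} (hl : PT l) : PT (fun a => List.range (l a).length) := by
  have key : ∀ m : List β, m.foldl (fun (s : List ℕ) _ => s ++ [s.length]) [] =
      List.range m.length := by
    intro m
    induction m using List.reverseRecOn with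
    | nil => rfl
    | append_singleton m b ih =>
      rw [List.foldl_append, ih]
      simp [List.range_succ]
  have := foldl (f := fun a (s : List ℕ) (b : β) => s ++ [s.length]) (init := fun _ => [])
    hl (by fun_prop) (const _) (by
      obtain ⟨P, hP⟩ := hl.size
      refine ⟨(P + 1) * (P + 4), fun a l' h => ?_⟩
      have h1 : sz (l a) ≤ _ := hP a
      have h2 := length_lt_sz l'
      have h3 := sz_le_of_prefix h
      rw [key]
      refine (sz_list_le _ (2 + l'.length) fun b hb => ?_).trans ?_
      · have := List.mem_range.1 hb
        have h4 := Nat.size_le_size this.le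
        have h5 : l'.length.size ≤ l'.length := Nat.size_le.2 Nat.lt_two_pow_self
        rw [sz_nat]; omega
      · have h6 : l'.length + 1 ≤ P.eval (sz a) := by omega
        simp only [Polynomial.eval_mul, Polynomial.eval_add, Polynomial.eval_one,
          Polynomial.eval_ofNat, List.length_range]
        nlinarith)
  simpa only [key] using this

@[fun_prop]
theorem getD {l : α → List β} {i : α → ℕ} (d : β) (hl : PT l) (hi : PT i) :
    PT (fun a => (l a).getD (i a) d) := by
  have key : ∀ (m : List β) (i c : ℕ) (e : β),
      (m.foldl (fun (s : ℕ × β) b => (s.1 + 1, if s.1 = i then b else s.2)) (c, e)).2 =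
        if c ≤ i then m.getD (i - c) e else e := by
    intro m
    induction m with
    | nil => intros; simp
    | cons b t ih =>
      intro i c e
      rw [List.foldl_cons, ih]
      dsimp only
      rcases lt_trichotomy c i with h | h | h
      · obtain ⟨k, rfl⟩ : ∃ k, i = c + 1 + k := ⟨i - (c + 1), by omega⟩
        rw [if_pos (by omega), if_neg (by omega), if_pos (by omega),
          show c + 1 + k - c = k + 1 by omega, show c + 1 + k - (c + 1) = k by omega]
        cases hk : t[k]? <;> simp [List.getD, hk]
      · subst h
        simp
      · rw [if_neg (by omega), if_neg (by omega), if_neg (by omega)]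
  have := foldl_of_add (f := fun a (s : ℕ × β) b => (s.1 + 1, if s.1 = i a then b else s.2))
    (init := fun _ => (0, d)) hl (by fun_prop) (const _) (by
      obtain ⟨P, hP⟩ := size_mem (f := fun _ b => b) hl (by fun_prop)
      refine ⟨P + 4, fun a s b hb => ?_⟩
      have := hP a b hb
      have := sz_add_le s.1 1
      have h1 : sz 1 = 2 := rfl
      have := sz_pos s.2
      simp only [sz_prod, Polynomial.eval_add, Polynomial.eval_ofNat]
      split_ifs <;> omega)
  have h2 := snd this
  simp only [key] at h2
  simpa using h2

/-- A sum over the entries of a list without repetitions. -/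
theorem natFinsetSum [DecidableEq β] {l : α → List β} {f : α → β → ℕ} (hl : PT l)
    (hnd : ∀ a, (l a).Nodup) (hf : PT (fun x : α × β => f x.1 x.2)) :
    PT (fun a => ∑ b ∈ (l a).toFinset, f a b) := by
  have := natListSum (map hl hf)
  convert this using 2 with a
  exact List.sum_toFinset _ (hnd a)

theorem intFinsetSum [DecidableEq β] {l : α → List β} {f : α → β → ℤ} (hl : PT l)
    (hnd : ∀ a, (l a).Nodup) (hf : PT (fun x : α × β => f x.1 x.2)) :
    PT (fun a => ∑ b ∈ (l a).toFinset, f a b) := by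
  have := intListSum (map hl hf)
  convert this using 2 with a
  exact List.sum_toFinset _ (hnd a)

@[fun_prop]
theorem natSumRange {n : α → ℕ} {f : α → ℕ → ℕ} (hn : PT (fun a => List.range (n a)))
    (hf : PT (fun x : α × ℕ => f x.1 x.2)) : PT (fun a => ∑ b ∈ Finset.range (n a), f a b) := by
  have := natFinsetSum hn (fun _ => List.nodup_range) hf
  convert this using 3 with a
  ext; simp

@[fun_prop]
theorem intSumRange {n : α → ℕ} {f : α → ℕ → ℤ} (hn : PT (fun a => List.range (n a)))
    (hf : PT (fun x : α × ℕ => f x.1 x.2)) : PT (fun a => ∑ b ∈ Finset.range (n a), f a b) := by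
  have := intFinsetSum hn (fun _ => List.nodup_range) hf
  convert this using 3 with a
  ext; simp

end PT

theorem PTPred.forall_mem {α β : Type} [Enc α] [Enc β] {l : α → List β} {p : α → β → Prop}
    (hl : PT l) (hp : PTPred (fun x : α × β => p x.1 x.2)) :
    PTPred (fun a => ∀ b ∈ l a, p a b) := by
  classical
  have h : PT (fun a => ((l a).map fun b => if p a b then 0 else 1).sum) :=
    PT.natListSum (PT.map hl (PT.ite hp (PT.const 0) (PT.const 1)))
  refine (PTPred.natEq h (PT.const 0)).of_iff fun a => ?_
  rw [List.sum_eq_zero_iff]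
  simp

/-! ### Reading an instance -/

instance : Enc DFAInst := ⟨DFAInst.code⟩

namespace PT

theorem valFst : PT Val.fst :=
  of_op .fst (fun _ => rfl) ((PolyBdd.self.add (PolyBdd.const 1)).mono fun v => by
    change (Val.fst v).size ≤ v.size + 1
    cases v <;> simp only [Val.fst, Val.size, Int.natAbs_zero, Nat.size_zero] <;> omega)

theorem valSnd : PT Val.snd :=
  of_op .snd (fun _ => rfl) ((PolyBdd.self.add (PolyBdd.const 1)).mono fun v => by
    change (Val.snd v).size ≤ v.size + 1
    cases v <;> simp only [Val.snd, Val.size, Int.natAbs_zero, Nat.size_zero] <;> omega)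

theorem instCode : PT (fun C : DFAInst => C.code) := of_enc_eq id fun _ => rfl

theorem valTails (k : ℕ) : PT (fun v => Val.snd^[k] v) := by
  induction k with
  | zero => exact id
  | succ k ih => simpa only [Function.iterate_succ_apply'] using valSnd.comp ih

/-- The entries of the description of an instance. -/
theorem instEntry (k : ℕ) : PT (fun C : DFAInst => (Val.snd^[k] C.code).fst) :=
  valFst.comp ((valTails k).comp instCode)

/-- The entries of the description of an automaton in the description of an instance. -/
theorem instEntryEntry (k j : ℕ) :
    PT (fun C : DFAInst => (Val.snd^[j] (Val.snd^[k] C.code).fst).fst) :=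
  valFst.comp ((valTails j).comp (instEntry k))

end PT

namespace OutDFA

variable {s : ℕ} {β : Type}

/-- The transition table. -/
def rows (A : OutDFA s β) : List (List ℕ) :=
  List.ofFn fun q => List.ofFn fun a => (A.step q a : ℕ)

/-- The outputs of the states. -/
def outs (A : OutDFA s β) : List β := List.ofFn A.out

/-- The transition function on the numbers of the states and the letters. -/
def stepN (A : OutDFA s β) (q a : ℕ) : ℕ := (A.rows.getD q []).getD a 0

theorem getD_ofFn {γ : Type} {n : ℕ} (f : Fin n → γ) (d : γ) (i : Fin n) :
    (List.ofFn f).getD i d = f i := by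
  simp [List.getD]

theorem stepN_eq (A : OutDFA s β) (q : Fin A.numStates) (a : Fin s) :
    A.stepN q a = A.step q a := by
  rw [stepN, rows, getD_ofFn, getD_ofFn]

theorem outs_getD (A : OutDFA s β) (d : β) (q : Fin A.numStates) :
    A.outs.getD q d = A.out q := getD_ofFn _ _ _

end OutDFA

namespace DFAInst

section Fields

theorem pt_hardStart : PT (fun C : DFAInst => (C.hard.start : ℕ)) :=
  (PT.instEntryEntry 1 0).of_enc_eq fun _ => rfl
theorem pt_costStart : PT (fun C : DFAInst => (C.cost.start : ℕ)) :=
  (PT.instEntryEntry 2 0).of_enc_eq fun _ => rfl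
theorem pt_labelStart : PT (fun C : DFAInst => (C.label.start : ℕ)) :=
  (PT.instEntryEntry 3 0).of_enc_eq fun _ => rfl

theorem enc_rows {s : ℕ} {β : Type} (A : OutDFA s β) : enc A.rows =
    Val.ofList (List.ofFn fun q => Val.ofList (List.ofFn fun a => Val.ofNat (A.step q a))) := by
  simp only [OutDFA.rows, enc, List.map_ofFn, Function.comp_def]

theorem pt_hardRows : PT (fun C : DFAInst => C.hard.rows) :=
  (PT.instEntryEntry 1 1).of_enc_eq fun C => (enc_rows C.hard).symm
theorem pt_costRows : PT (fun C : DFAInst => C.cost.rows) :=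
  (PT.instEntryEntry 2 1).of_enc_eq fun C => (enc_rows C.cost).symm
theorem pt_labelRows : PT (fun C : DFAInst => C.label.rows) :=
  (PT.instEntryEntry 3 1).of_enc_eq fun C => (enc_rows C.label).symm

theorem enc_ofFn {β : Type} [Enc β] {n : ℕ} (f : Fin n → β) :
    enc (List.ofFn f) = Val.ofList (List.ofFn fun i => enc (f i)) := by
  change Val.ofList _ = _
  simp only [List.map_ofFn, Function.comp_def]

theorem pt_hardOuts : PT (fun C : DFAInst => C.hard.outs) :=
  (PT.instEntryEntry 1 2).of_enc_eq fun C => (enc_ofFn C.hard.out).symm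
theorem pt_costOuts : PT (fun C : DFAInst => C.cost.outs) :=
  (PT.instEntryEntry 2 2).of_enc_eq fun C => (enc_ofFn C.cost.out).symm
theorem pt_labelOuts : PT (fun C : DFAInst => C.label.outs) :=
  (PT.instEntryEntry 3 2).of_enc_eq fun C => (enc_ofFn C.label.out).symm

/-- The labels as a list. -/
def labelList (C : DFAInst) : List ℤ := List.ofFn C.labels
/-- The lower bounds for the conditional probabilities as a list. -/
def alphas (C : DFAInst) : List ℚ := List.ofFn C.params.alpha
/-- The upper bounds for the conditional probabilities as a list. -/
def betas (C : DFAInst) : List ℚ := List.ofFn C.params.beta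

theorem pt_labelList : PT (fun C : DFAInst => C.labelList) :=
  (PT.instEntry 4).of_enc_eq fun C => (enc_ofFn C.labels).symm
theorem pt_alphas : PT (fun C : DFAInst => C.alphas) :=
  (PT.instEntry 10).of_enc_eq fun C => (enc_ofFn C.params.alpha).symm
theorem pt_betas : PT (fun C : DFAInst => C.betas) :=
  (PT.instEntry 11).of_enc_eq fun C => (enc_ofFn C.params.beta).symm

theorem enc_unary (k : ℕ) : enc (List.replicate k ()) = Val.unary k := by
  change Val.ofList _ = _
  rw [List.map_replicate]
  rfl

theorem pt_unaryM : PT (fun C : DFAInst => List.replicate C.params.m ()) :=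
  (PT.instEntry 5).of_enc_eq fun _ => (enc_unary _).symm
theorem pt_unaryN : PT (fun C : DFAInst => List.replicate C.params.n ()) :=
  (PT.instEntry 6).of_enc_eq fun _ => (enc_unary _).symm
theorem pt_c : PT (fun C : DFAInst => C.params.c) := (PT.instEntry 7).of_enc_eq fun _ => rfl
theorem pt_lam : PT (fun C : DFAInst => C.params.lam) := (PT.instEntry 8).of_enc_eq fun _ => rfl
theorem pt_rho : PT (fun C : DFAInst => C.params.rho) := (PT.instEntry 9).of_enc_eq fun _ => rfl

end Fields

variable {α : Type} [Enc α] {C : α → DFAInst}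

@[fun_prop]
theorem pt_letters (hC : PT C) : PT (fun a => List.range (C a).s) := by
  have h : PT (fun C : DFAInst => List.range (C.hard.rows.getD C.hard.start []).length) :=
    PT.range_length (PT.getD _ pt_hardRows pt_hardStart)
  have h' : PT (fun C : DFAInst => List.range C.s) := by
    convert h using 3 with C
    rw [OutDFA.rows, OutDFA.getD_ofFn, List.length_ofFn]
  exact h'.comp hC

@[fun_prop]
theorem pt_labelIndices (hC : PT C) : PT (fun a => List.range (C a).numLabels) := by
  have h : PT (fun C : DFAInst => List.range C.labelList.length) := PT.range_length pt_labelList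
  simp only [labelList, List.length_ofFn] at h
  exact h.comp hC

/-- The states of the product of the three automata. -/
def states (C : DFAInst) : List (ℕ × ℕ × ℕ) :=
  List.range C.hard.numStates ×ˢ (List.range C.cost.numStates ×ˢ List.range C.label.numStates)

/-- The start state of the product. -/
def start (C : DFAInst) : ℕ × ℕ × ℕ := (C.hard.start, C.cost.start, C.label.start)

/-- The transitions of the product. -/
def next (C : DFAInst) (q : ℕ × ℕ × ℕ) (a : ℕ) : ℕ × ℕ × ℕ :=
  (C.hard.stepN q.1 a, C.cost.stepN q.2.1 a, C.label.stepN q.2.2 a)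

/-- Whether a state of the product is accepting. -/
def accN (C : DFAInst) (q : ℕ × ℕ × ℕ) : Bool := C.hard.outs.getD q.1 false

/-- The cost attached to a state of the product. -/
def costN (C : DFAInst) (q : ℕ × ℕ × ℕ) : ℤ := C.cost.outs.getD q.2.1 0

/-- The label attached to a state of the product. -/
def labelN (C : DFAInst) (q : ℕ × ℕ × ℕ) : ℤ := C.label.outs.getD q.2.2 0

/-- For each word length up to the upper bound, whether it also satisfies the lower bound. -/
def flags (C : DFAInst) : List Bool :=
  (List.range (C.params.n + 1)).map fun j => decide (C.params.m ≤ j)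

@[fun_prop]
theorem pt_states (hC : PT C) : PT (fun a => (C a).states) := by
  have h : PT (fun C : DFAInst => List.range C.hard.outs.length ×ˢ
      (List.range C.cost.outs.length ×ˢ List.range C.label.outs.length)) :=
    PT.product (PT.range_length pt_hardOuts)
      (PT.product (PT.range_length pt_costOuts) (PT.range_length pt_labelOuts))
  simp only [OutDFA.outs, List.length_ofFn] at h
  exact h.comp hC

@[fun_prop]
theorem pt_start (hC : PT C) : PT (fun a => (C a).start) :=
  (PT.prodMk pt_hardStart (PT.prodMk pt_costStart pt_labelStart)).comp hC

@[fun_prop]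
theorem pt_next {q : α → ℕ × ℕ × ℕ} {b : α → ℕ} (hC : PT C) (hq : PT q) (hb : PT b) :
    PT (fun a => (C a).next (q a) (b a)) := by
  have h1 := pt_hardRows.comp hC
  have h2 := pt_costRows.comp hC
  have h3 := pt_labelRows.comp hC
  unfold next OutDFA.stepN
  fun_prop

@[fun_prop]
theorem pt_accN {q : α → ℕ × ℕ × ℕ} (hC : PT C) (hq : PT q) :
    PT (fun a => (C a).accN (q a)) := by
  have h1 := pt_hardOuts.comp hC
  unfold accN
  fun_prop

@[fun_prop]
theorem pt_costN {q : α → ℕ × ℕ × ℕ} (hC : PT C) (hq : PT q) :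
    PT (fun a => (C a).costN (q a)) := by
  have h1 := pt_costOuts.comp hC
  unfold costN
  fun_prop

@[fun_prop]
theorem pt_labelN {q : α → ℕ × ℕ × ℕ} (hC : PT C) (hq : PT q) :
    PT (fun a => (C a).labelN (q a)) := by
  have h1 := pt_labelOuts.comp hC
  unfold labelN
  fun_prop

@[fun_prop]
theorem pt_flags (hC : PT C) : PT (fun a => (C a).flags) := by
  have h1 : PT (fun C : DFAInst => C.params.m) := by simpa using PT.length pt_unaryM
  have h2 : PT (fun C : DFAInst => List.range (C.params.n + 1)) := by
    simpa using PT.range_length ((PT.const ()).cons pt_unaryN)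
  have h3 : PT (fun C : DFAInst => C.flags) :=
    PT.map h2 (PT.decide (PTPred.natLe (h1.comp PT.fst') PT.snd'))
  exact h3.comp hC

end DFAInst

@[fun_prop]
theorem PTPred.tripleEq {α : Type} [Enc α] {f g : α → ℕ × ℕ × ℕ} (hf : PT f) (hg : PT g) :
    PTPred (fun a => f a = g a) := by
  have : PTPred (fun a => (f a).1 = (g a).1 ∧ (f a).2.1 = (g a).2.1 ∧ (f a).2.2 = (g a).2.2) := by
    fun_prop
  exact this.of_iff fun a => by simp [Prod.ext_iff]

/-! ### Weighted counting of words -/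

/-- The number that is attached to `q` in an association list. -/
def lookup (T : List ((ℕ × ℕ × ℕ) × ℕ)) (q : ℕ × ℕ × ℕ) : ℕ :=
  (T.map fun e => if e.1 = q then e.2 else 0).sum

@[fun_prop]
theorem pt_lookup {α : Type} [Enc α] {T : α → List ((ℕ × ℕ × ℕ) × ℕ)} {q : α → ℕ × ℕ × ℕ}
    (hT : PT T) (hq : PT q) : PT (fun a => lookup (T a) (q a)) := by
  unfold lookup
  fun_prop

theorem lookup_map {l : List (ℕ × ℕ × ℕ)} (hl : l.Nodup) (f : ℕ × ℕ × ℕ → ℕ) (q : ℕ × ℕ × ℕ) :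
    lookup (l.map fun p => (p, f p)) q = if q ∈ l then f q else 0 := by
  unfold lookup
  rw [List.map_map]
  change (l.map fun p => if p = q then f p else 0).sum = _
  rw [← List.sum_toFinset _ hl, Finset.sum_ite_eq']
  simp

theorem lookup_le (T : List ((ℕ × ℕ × ℕ) × ℕ)) (q : ℕ × ℕ × ℕ) :
    lookup T q ≤ (T.map fun e => e.2).sum := by
  unfold lookup
  refine List.sum_le_sum fun e _ => ?_
  split_ifs <;> simp

namespace DFAInst

theorem nodup_states (C : DFAInst) : C.states.Nodup :=
  List.nodup_range.product (List.nodup_range.product List.nodup_range)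

/-- The tables of a backward dynamic program. The value that `C.table T l` attaches to a state `q`
is the sum, over the words `w` that are shorter than `l` and are marked in `l` according to their
length, of the number that `T` attaches to the state reached from `q` by `w`. -/
def table (C : DFAInst) (T : List ((ℕ × ℕ × ℕ) × ℕ)) (l : List Bool) :
    List ((ℕ × ℕ × ℕ) × ℕ) :=
  l.foldr (fun b T' => C.states.map fun q =>
    (q, (if b = true then lookup T q else 0) +
      ∑ a ∈ Finset.range C.s, lookup T' (C.next q a))) []

/-- The value of a state in the dynamic program. -/
def value (C : DFAInst) (T : List ((ℕ × ℕ × ℕ) × ℕ)) (l : List Bool) (q : ℕ × ℕ × ℕ) : ℕ :=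
  lookup (C.table T l) q

theorem value_nil (C : DFAInst) (T : List ((ℕ × ℕ × ℕ) × ℕ)) (q : ℕ × ℕ × ℕ) :
    C.value T [] q = 0 := rfl

theorem value_cons (C : DFAInst) (T : List ((ℕ × ℕ × ℕ) × ℕ)) (b : Bool) (l : List Bool)
    (q : ℕ × ℕ × ℕ) : C.value T (b :: l) q = if q ∈ C.states then
      (if b = true then lookup T q else 0) + ∑ a ∈ Finset.range C.s, C.value T l (C.next q a)
      else 0 := by
  rw [value, table, List.foldr_cons]
  exact lookup_map C.nodup_states _ _

theorem value_le (C : DFAInst) (T : List ((ℕ × ℕ × ℕ) × ℕ)) (l : List Bool) (q : ℕ × ℕ × ℕ) :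
    C.value T l q ≤ (T.map fun e => e.2).sum * (C.s + 1) ^ l.length := by
  induction l generalizing q with
  | nil => simp [value_nil]
  | cons b l ih =>
    rw [value_cons]
    split_ifs with h1 h2
    · calc lookup T q + ∑ a ∈ Finset.range C.s, C.value T l (C.next q a)
          ≤ (T.map fun e => e.2).sum * (C.s + 1) ^ l.length +
            ∑ a ∈ Finset.range C.s, (T.map fun e => e.2).sum * (C.s + 1) ^ l.length := by
            gcongr
            · exact (lookup_le T q).trans (Nat.le_mul_of_pos_right _ (by positivity))
            · exact ih _
        _ = _ := by simp; ring
    · calc 0 + ∑ a ∈ Finset.range C.s, C.value T l (C.next q a)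
          ≤ (T.map fun e => e.2).sum * (C.s + 1) ^ l.length +
            ∑ a ∈ Finset.range C.s, (T.map fun e => e.2).sum * (C.s + 1) ^ l.length := by
            gcongr
            · exact Nat.zero_le _
            · exact ih _
        _ = _ := by simp; ring
    · exact Nat.zero_le _

theorem sz_table_le (C : DFAInst) (T : List ((ℕ × ℕ × ℕ) × ℕ)) (l : List Bool) :
    sz (C.table T l) ≤ 1 + sz C.states * (1 + (1 + sz C.states +
      (sz (T.map fun e => e.2).sum + (l.length * sz (C.s + 1) + 2)))) := by
  have hlen : (C.table T l).length ≤ sz C.states := by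
    cases l with
    | nil => simp [table]
    | cons b l =>
      rw [table, List.foldr_cons, List.length_map]
      exact (length_lt_sz _).le
  refine (sz_list_le _ _ fun e he => ?_).trans (Nat.add_le_add_left (Nat.mul_le_mul_right _ hlen) 1)
  have h1 : e.1 ∈ C.states ∧ e.2 = C.value T l e.1 := by
    cases l with
    | nil => simp [table] at he
    | cons b l =>
      rw [table, List.foldr_cons, List.mem_map] at he
      obtain ⟨q, hq, rfl⟩ := he
      refine ⟨hq, ?_⟩
      rw [value_cons, if_pos hq]
      rfl
  have h2 := sz_le_of_mem h1.1
  have h3 := sz_nat_mono (C.value_le T l e.1)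
  have h4 := sz_mul_le (T.map fun e => e.2).sum ((C.s + 1) ^ l.length)
  have h5 := nat_size_pow_le (C.s + 1) l.length
  have h6 : l.length * (C.s + 1).size ≤ l.length * sz (C.s + 1) :=
    Nat.mul_le_mul_left _ (by rw [sz_nat]; omega)
  rw [sz_nat ((C.s + 1) ^ _)] at h4
  rw [sz_prod, h1.2]
  omega

variable {α : Type} [Enc α] {C : α → DFAInst}

@[fun_prop]
theorem pt_s (hC : PT C) : PT (fun a => (C a).s) := by
  simpa using PT.length (pt_letters hC)

@[fun_prop]
theorem pt_table {T : α → List ((ℕ × ℕ × ℕ) × ℕ)} {l : α → List Bool} (hC : PT C) (hT : PT T)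
    (hl : PT l) : PT (fun a => (C a).table (T a) (l a)) := by
  refine PT.foldr hl ?_ (PT.const _) ?_
  · fun_prop
  · obtain ⟨P, hP⟩ := (pt_states hC).size
    obtain ⟨Q, hQ⟩ : PolyBdd (fun a => sz ((T a).map fun e => e.2).sum) := PT.size (by fun_prop)
    obtain ⟨R, hR⟩ : PolyBdd (fun a => sz ((C a).s + 1)) := PT.size (by fun_prop)
    obtain ⟨L, hL⟩ := hl.size
    refine ⟨1 + P * (1 + (1 + P + (Q + (L * R + 2)))), fun a l' hl' => ?_⟩
    refine (sz_table_le (C a) (T a) l').trans ?_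
    have h1 := (length_lt_sz l').le.trans ((sz_le_of_suffix hl').trans (hL a))
    have hP := hP a
    have hQ := hQ a
    have hR := hR a
    simp only [Polynomial.eval_add, Polynomial.eval_mul, Polynomial.eval_one,
      Polynomial.eval_ofNat]
    gcongr

@[fun_prop]
theorem pt_value {T : α → List ((ℕ × ℕ × ℕ) × ℕ)} {l : α → List Bool} {q : α → ℕ × ℕ × ℕ}
    (hC : PT C) (hT : PT T) (hl : PT l) (hq : PT q) :
    PT (fun a => (C a).value (T a) (l a) (q a)) := by
  unfold value
  fun_prop

end DFAInst

/-! ### The greedy distribution -/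

section Greedy

variable {ι : Type}

/-- `i` comes before `j` in the order of increasing cost, ties being broken by the key `κ`. -/
def Before (c : ι → ℤ) (κ : ι → ℕ) (i j : ι) : Prop := c i < c j ∨ c i = c j ∧ κ i < κ j

instance (c : ι → ℤ) (κ : ι → ℕ) (i j : ι) : Decidable (Before c κ i j) :=
  inferInstanceAs (Decidable (_ ∨ _))

/-- The cheapest way to distribute the amount `T` over the items in `J`, if item `j` has cost
`c j` per unit and takes between `lo j` and `lo j + w j` units: after the lower bounds have been
served, the rest is given to the items in the order of their costs. -/
def greedy (J : Finset ι) (c : ι → ℤ) (κ : ι → ℕ) (lo w : ι → ℕ) (T : ℕ) (j : ι) : ℕ :=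
  lo j + min (w j) (T - ∑ i ∈ J, lo i - ∑ i ∈ J, if Before c κ i j then w i else 0)

end Greedy

@[fun_prop]
theorem pt_greedy {α ι : Type} [Enc α] [Enc ι] [DecidableEq ι] {J : α → List ι} {c : α → ι → ℤ}
    {κ : α → ι → ℕ} {lo w : α → ι → ℕ} {T : α → ℕ} {j : α → ι} (hJ : PT J)
    (hnd : ∀ a, (J a).Nodup) (hc : PT (fun x : α × ι => c x.1 x.2))
    (hκ : PT (fun x : α × ι => κ x.1 x.2)) (hlo : PT (fun x : α × ι => lo x.1 x.2))
    (hw : PT (fun x : α × ι => w x.1 x.2)) (hT : PT T) (hj : PT j) :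
    PT (fun a => greedy (J a).toFinset (c a) (κ a) (lo a) (w a) (T a) (j a)) := by
  have h1 : PT (fun a => lo a (j a)) := hlo.comp (PT.id.prodMk hj)
  have h2 : PT (fun a => w a (j a)) := hw.comp (PT.id.prodMk hj)
  have h3 : PT (fun a => ∑ i ∈ (J a).toFinset, lo a i) := PT.natFinsetSum hJ hnd hlo
  have h4 : PT (fun a => ∑ i ∈ (J a).toFinset,
      if Before (c a) (κ a) i (j a) then w a i else 0) := by
    refine PT.natFinsetSum (f := fun a i => if Before (c a) (κ a) i (j a) then w a i else 0)
      hJ hnd (PT.ite ?_ hw (PT.const 0))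
    have h5 : PT (fun x : α × ι => c x.1 (j x.1)) :=
      hc.comp (f := fun x : α × ι => (x.1, j x.1)) (by fun_prop)
    have h6 : PT (fun x : α × ι => κ x.1 (j x.1)) :=
      hκ.comp (f := fun x : α × ι => (x.1, j x.1)) (by fun_prop)
    exact (PTPred.intLt hc h5).or ((PTPred.intEq hc h5).and (PTPred.natLt hκ h6))
  unfold greedy
  fun_prop

/-! ### The criterion for feasibility -/

namespace DFAInst

variable (C : DFAInst)

/-- The number of words of admissible length that lead to the state `q`. -/
def count (q : ℕ × ℕ × ℕ) : ℕ := C.value [(q, 1)] C.flags C.start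

/-- The lower bound for the conditional probabilities in the `i`-th class. -/
def alphaN (i : ℕ) : ℚ := C.alphas.getD i 0

/-- The upper bound for the conditional probabilities in the `i`-th class. -/
def betaN (i : ℕ) : ℚ := C.betas.getD i 0

/-- A common denominator of the bounds for the conditional probabilities. -/
def wordDenom : ℕ := (C.alphas.map fun r => r.den).prod * (C.betas.map fun r => r.den).prod

/-- A rational number, as an integral multiple of `1 / M`. -/
def scaled (r : ℚ) (M : ℕ) : ℕ := r.num.toNat * (M / r.den)

/-- Whether the words that lead to the state `q` belong to the `i`-th class. -/
def InGroup (i : ℕ) (q : ℕ × ℕ × ℕ) : Prop :=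
  C.accN q = true ∧ C.labelN q = C.labelList.getD i 0

instance (i : ℕ) (q : ℕ × ℕ × ℕ) : Decidable (C.InGroup i q) :=
  inferInstanceAs (Decidable (_ ∧ _))

/-- The least share of the `i`-th class that the words leading to `q` may have together, as a
multiple of `1 / C.wordDenom`. -/
def wordLo (i : ℕ) (q : ℕ × ℕ × ℕ) : ℕ :=
  if C.InGroup i q then scaled (C.alphaN i) C.wordDenom * C.count q else 0

/-- The width of the range of possible shares. -/
def wordWidth (i : ℕ) (q : ℕ × ℕ × ℕ) : ℕ :=
  if C.InGroup i q then
    (scaled (C.betaN i) C.wordDenom - scaled (C.alphaN i) C.wordDenom) * C.count q else 0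

/-- The share of the words leading to `q` in the cheapest distribution on the `i`-th class. -/
def wordShare (i : ℕ) (q : ℕ × ℕ × ℕ) : ℕ :=
  greedy C.states.toFinset C.costN (fun q => Nat.pair q.1 (Nat.pair q.2.1 q.2.2))
    (C.wordLo i) (C.wordWidth i) C.wordDenom q

/-- Whether there is a distribution on the `i`-th class that satisfies the bounds for the
conditional probabilities. -/
def Usable (i : ℕ) : Prop :=
  ∑ q ∈ C.states.toFinset, C.wordLo i q ≤ C.wordDenom ∧
    C.wordDenom ≤ ∑ q ∈ C.states.toFinset, (C.wordLo i q + C.wordWidth i q)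

instance (i : ℕ) : Decidable (C.Usable i) := inferInstanceAs (Decidable (_ ∧ _))

/-- The cost of the cheapest distribution on the `i`-th class, times `C.wordDenom`. -/
def classCost (i : ℕ) : ℤ := ∑ q ∈ C.states.toFinset, C.costN q * (C.wordShare i q : ℤ)

/-- A common denominator of the bounds for the probabilities of the classes. -/
def labelDenom : ℕ := C.params.lam.den * C.params.rho.den

/-- The least share of the `i`-th class, as a multiple of `1 / C.labelDenom`. -/
def labelLo (i : ℕ) : ℕ := if C.Usable i then scaled C.params.lam C.labelDenom else 0

/-- The width of the range of possible shares of the `i`-th class. -/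
def labelWidth (i : ℕ) : ℕ :=
  if C.Usable i then scaled C.params.rho C.labelDenom - scaled C.params.lam C.labelDenom else 0

/-- The share of the `i`-th class in the cheapest distribution. -/
def labelShare (i : ℕ) : ℕ :=
  greedy (List.range C.numLabels).toFinset C.classCost (fun i => i) C.labelLo C.labelWidth
    C.labelDenom i

/-- The criterion for feasibility. -/
def Ok : Prop :=
  (∀ i ∈ List.range C.numLabels, C.Usable i ∨ scaled C.params.lam C.labelDenom = 0) ∧
  ∑ i ∈ Finset.range C.numLabels, C.labelLo i ≤ C.labelDenom ∧
  C.labelDenom ≤ ∑ i ∈ Finset.range C.numLabels, (C.labelLo i + C.labelWidth i) ∧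
  (∑ i ∈ Finset.range C.numLabels, (C.labelShare i : ℤ) * C.classCost i) * C.params.c.den ≤
    C.params.c.num * (C.labelDenom * C.wordDenom : ℕ)

/-- A common multiple of all nonzero numbers `C.count q`. -/
def countProd : ℕ := (C.states.map fun q => if C.count q = 0 then 1 else C.count q).prod

/-- The probability of each of the words that lead to `q`, up to the normalizing factor. -/
def weight (q : ℕ × ℕ × ℕ) : ℕ :=
  ∑ i ∈ Finset.range C.numLabels, C.labelShare i * C.wordShare i q * (C.countProd / C.count q)

/-- The list of the weights. -/
def weights : List ((ℕ × ℕ × ℕ) × ℕ) := C.states.map fun q => (q, C.weight q)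

/-- The sum of the weights of all words of admissible length. -/
def total : ℕ := C.value C.weights C.flags C.start

end DFAInst

namespace DFAInst

variable {α : Type} [Enc α] {C : α → DFAInst}

@[fun_prop]
theorem pt_count {q : α → ℕ × ℕ × ℕ} (hC : PT C) (hq : PT q) :
    PT (fun a => (C a).count (q a)) := by
  unfold count
  fun_prop

@[fun_prop]
theorem pt_alphaN {i : α → ℕ} (hC : PT C) (hi : PT i) : PT (fun a => (C a).alphaN (i a)) :=
  PT.getD _ (pt_alphas.comp hC) hi

@[fun_prop]
theorem pt_betaN {i : α → ℕ} (hC : PT C) (hi : PT i) : PT (fun a => (C a).betaN (i a)) :=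
  PT.getD _ (pt_betas.comp hC) hi

@[fun_prop]
theorem pt_wordDenom (hC : PT C) : PT (fun a => (C a).wordDenom) := by
  have h1 := pt_alphas.comp hC
  have h2 := pt_betas.comp hC
  unfold wordDenom
  fun_prop

@[fun_prop]
theorem pt_scaled {r : α → ℚ} {M : α → ℕ} (hr : PT r) (hM : PT M) :
    PT (fun a => scaled (r a) (M a)) := by
  unfold scaled
  fun_prop

@[fun_prop]
theorem pt_inGroup {i : α → ℕ} {q : α → ℕ × ℕ × ℕ} (hC : PT C) (hi : PT i) (hq : PT q) :
    PTPred (fun a => (C a).InGroup (i a) (q a)) := by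
  have h1 := pt_labelList.comp hC
  unfold InGroup
  fun_prop

@[fun_prop]
theorem pt_wordLo {i : α → ℕ} {q : α → ℕ × ℕ × ℕ} (hC : PT C) (hi : PT i) (hq : PT q) :
    PT (fun a => (C a).wordLo (i a) (q a)) := by
  unfold wordLo
  fun_prop

@[fun_prop]
theorem pt_wordWidth {i : α → ℕ} {q : α → ℕ × ℕ × ℕ} (hC : PT C) (hi : PT i) (hq : PT q) :
    PT (fun a => (C a).wordWidth (i a) (q a)) := by
  unfold wordWidth
  fun_prop

theorem _root_.LQCI.PT.natPair {f g : α → ℕ} (hf : PT f) (hg : PT g) :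
    PT (fun a => Nat.pair (f a) (g a)) := by
  unfold Nat.pair
  fun_prop

@[fun_prop]
theorem pt_wordShare {i : α → ℕ} {q : α → ℕ × ℕ × ℕ} (hC : PT C) (hi : PT i) (hq : PT q) :
    PT (fun a => (C a).wordShare (i a) (q a)) := by
  unfold wordShare
  exact pt_greedy (pt_states hC) (fun a => (C a).nodup_states) (by fun_prop)
    (PT.natPair (by fun_prop) (PT.natPair (by fun_prop) (by fun_prop))) (by fun_prop)
    (by fun_prop) (by fun_prop) hq

@[fun_prop]
theorem pt_usable {i : α → ℕ} (hC : PT C) (hi : PT i) :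
    PTPred (fun a => (C a).Usable (i a)) := by
  have h1 : PT (fun a => ∑ q ∈ (C a).states.toFinset, (C a).wordLo (i a) q) :=
    PT.natFinsetSum (pt_states hC) (fun a => (C a).nodup_states) (by fun_prop)
  have h2 : PT (fun a => ∑ q ∈ (C a).states.toFinset,
      ((C a).wordLo (i a) q + (C a).wordWidth (i a) q)) :=
    PT.natFinsetSum (pt_states hC) (fun a => (C a).nodup_states)
      (f := fun a q => (C a).wordLo (i a) q + (C a).wordWidth (i a) q) (by fun_prop)
  unfold Usable
  fun_prop

@[fun_prop]
theorem pt_classCost {i : α → ℕ} (hC : PT C) (hi : PT i) :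
    PT (fun a => (C a).classCost (i a)) := by
  unfold classCost
  exact PT.intFinsetSum (pt_states hC) (fun a => (C a).nodup_states)
    (f := fun a q => (C a).costN q * ((C a).wordShare (i a) q : ℤ)) (by fun_prop)

@[fun_prop]
theorem pt_labelDenom (hC : PT C) : PT (fun a => (C a).labelDenom) := by
  have h1 := pt_lam.comp hC
  have h2 := pt_rho.comp hC
  unfold labelDenom
  fun_prop

@[fun_prop]
theorem pt_labelLo {i : α → ℕ} (hC : PT C) (hi : PT i) : PT (fun a => (C a).labelLo (i a)) := by
  have h1 := pt_lam.comp hC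
  unfold labelLo
  fun_prop

@[fun_prop]
theorem pt_labelWidth {i : α → ℕ} (hC : PT C) (hi : PT i) :
    PT (fun a => (C a).labelWidth (i a)) := by
  have h1 := pt_lam.comp hC
  have h2 := pt_rho.comp hC
  unfold labelWidth
  fun_prop

@[fun_prop]
theorem pt_labelShare {i : α → ℕ} (hC : PT C) (hi : PT i) :
    PT (fun a => (C a).labelShare (i a)) := by
  unfold labelShare
  exact pt_greedy (pt_labelIndices hC) (fun _ => List.nodup_range) (by fun_prop)
    (by fun_prop) (by fun_prop) (by fun_prop) (by fun_prop) hi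

theorem pt_ok (hC : PT C) : PTPred (fun a => (C a).Ok) := by
  have h1 := pt_lam.comp hC
  have h2 := pt_c.comp hC
  have h3 : PTPred (fun a => ∀ i ∈ List.range (C a).numLabels,
      (C a).Usable i ∨ scaled (C a).params.lam (C a).labelDenom = 0) := by
    refine PTPred.forall_mem (p := fun a i => (C a).Usable i ∨
      scaled (C a).params.lam (C a).labelDenom = 0) (pt_labelIndices hC) ?_
    have h1 : PT (fun x : α × ℕ => (C x.1).params.lam) := h1.comp PT.fst'
    fun_prop
  unfold Ok
  fun_prop

@[fun_prop]
theorem pt_countProd (hC : PT C) : PT (fun a => (C a).countProd) := by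
  unfold countProd
  fun_prop

@[fun_prop]
theorem pt_weight {q : α → ℕ × ℕ × ℕ} (hC : PT C) (hq : PT q) :
    PT (fun a => (C a).weight (q a)) := by
  unfold weight
  fun_prop

@[fun_prop]
theorem pt_weights (hC : PT C) : PT (fun a => (C a).weights) := by
  unfold weights
  fun_prop

@[fun_prop]
theorem pt_total (hC : PT C) : PT (fun a => (C a).total) := by
  unfold total
  fun_prop

end DFAInst

/-! ### Unranking -/

/-- Intervals of the lengths `f a`, for the letters `a` in a list, are laid end to end, starting
at `0`. The letter whose interval contains `u`, and the position of `u` in that interval. -/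
def pick (f : ℕ → ℕ) : List ℕ → ℕ → ℕ × ℕ
  | [], u => (0, u)
  | a :: l, u => if u < f a then (a, u) else pick f l (u - f a)

/-- The same as a left fold; the first component of the state tells whether the letter has been
found. -/
def pickStep (f : ℕ → ℕ) (x : Bool × ℕ × ℕ) (a : ℕ) : Bool × ℕ × ℕ :=
  if x.1 = true then x else if x.2.2 < f a then (true, a, x.2.2) else (false, 0, x.2.2 - f a)

theorem foldl_pickStep (f : ℕ → ℕ) (l : List ℕ) (u : ℕ) :
    (l.foldl (pickStep f) (false, 0, u)).2 = pick f l u := by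
  have h : ∀ (l : List ℕ) (x : ℕ × ℕ), l.foldl (pickStep f) (true, x) = (true, x) := by
    intro l x
    induction l with
    | nil => rfl
    | cons a l ih => rw [List.foldl_cons, pickStep, if_pos rfl, ih]
  induction l generalizing u with
  | nil => rfl
  | cons a l ih =>
    simp only [List.foldl_cons, pickStep, pick, Bool.false_eq_true, if_false]
    split_ifs with hu
    · rw [h]
    · exact ih _

theorem pick_snd_le (f : ℕ → ℕ) (l : List ℕ) (u : ℕ) : (pick f l u).2 ≤ u := by
  induction l generalizing u with
  | nil => rfl
  | cons a l ih =>
    rw [pick]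
    split_ifs
    · rfl
    · exact (ih _).trans (Nat.sub_le _ _)

theorem sz_pick_fst_le (f : ℕ → ℕ) (l : List ℕ) (u : ℕ) : sz (pick f l u).1 ≤ sz l := by
  induction l generalizing u with
  | nil => rfl
  | cons a l ih =>
    rw [pick, sz_cons]
    split_ifs
    · dsimp only
      omega
    · have := ih (u - f a)
      omega

theorem sum_pick (f : ℕ → ℕ) (l : List ℕ) (F : ℕ × ℕ → ℕ) :
    ∑ u ∈ Finset.range (l.map f).sum, F (pick f l u) =
      (l.map fun a => ∑ v ∈ Finset.range (f a), F (a, v)).sum := by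
  induction l with
  | nil => simp
  | cons a l ih =>
    simp only [List.map_cons, List.sum_cons]
    rw [Finset.sum_range_add, ← ih]
    congr 1
    · refine Finset.sum_congr rfl fun u hu => ?_
      rw [pick, if_pos (Finset.mem_range.1 hu)]
    · refine Finset.sum_congr rfl fun u hu => ?_
      rw [pick, if_neg (by omega), Nat.add_sub_cancel_left]

theorem pt_pick {α : Type} [Enc α] {f : α → ℕ → ℕ} {l : α → List ℕ} {u : α → ℕ}
    (hf : PT (fun x : α × ℕ => f x.1 x.2)) (hl : PT l) (hu : PT u) :
    PT (fun a => pick (f a) (l a) (u a)) := by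
  have h : PT (fun a => (l a).foldl (pickStep (f a)) (false, 0, u a)) := by
    refine PT.foldl_of_add hl ?_ (by fun_prop) ?_
    · have : PT (fun x : α × (Bool × ℕ × ℕ) × ℕ => f x.1 x.2.2) :=
        hf.comp (f := fun x : α × (Bool × ℕ × ℕ) × ℕ => (x.1, x.2.2)) (by fun_prop)
      unfold pickStep
      fun_prop
    · obtain ⟨P, hP⟩ := hl.size
      refine ⟨P + 5, fun a x b hb => ?_⟩
      have h1 := (sz_le_of_mem hb).trans (hP a)
      have h2 := sz_nat_mono (Nat.sub_le x.2.2 (f a b))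
      have h3 := sz_bool true
      have h4 := sz_bool false
      have h5 : sz 0 = 1 := rfl
      simp only [pickStep, Polynomial.eval_add, Polynomial.eval_ofNat]
      split_ifs
      · omega
      · simp only [sz_prod]; omega
      · simp only [sz_prod]; omega
  simpa only [foldl_pickStep] using h.snd

namespace DFAInst

/-- The word that has the number `u` among the words leading on from the state `q`, where each
word that `l` marks according to its length has as many numbers as the weight of the state to which
it leads. -/
def unrank (C : DFAInst) (T : List ((ℕ × ℕ × ℕ) × ℕ)) :
    List Bool → ℕ → ℕ × ℕ × ℕ → List ℕ
  | [], _, _ => []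
  | b :: l, u, q =>
    if b = true ∧ u < lookup T q then [] else
      let x := pick (fun a => C.value T l (C.next q a)) (List.range C.s)
        (u - if b = true then lookup T q else 0)
      x.1 :: unrank C T l x.2 (C.next q x.1)

/-- A step of the computation of `unrank`. The state consists of a mark for the end of the
computation, the number, the current state of the product automaton, the remaining list, and the
word in reverse. -/
def unrankStep (C : DFAInst) (T : List ((ℕ × ℕ × ℕ) × ℕ))
    (x : Bool × ℕ × (ℕ × ℕ × ℕ) × List Bool × List ℕ) (b : Bool) :
    Bool × ℕ × (ℕ × ℕ × ℕ) × List Bool × List ℕ :=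
  if x.1 = true then x else if b = true ∧ x.2.1 < lookup T x.2.2.1 then (true, x.2) else
    (fun y : ℕ × ℕ => (false, y.2, C.next x.2.2.1 y.1, x.2.2.2.1.tail, y.1 :: x.2.2.2.2))
      (pick (fun a => C.value T x.2.2.2.1.tail (C.next x.2.2.1 a)) (List.range C.s)
        (x.2.1 - if b = true then lookup T x.2.2.1 else 0))

theorem foldl_unrankStep (C : DFAInst) (T : List ((ℕ × ℕ × ℕ) × ℕ)) (l : List Bool) (u : ℕ)
    (q : ℕ × ℕ × ℕ) (w : List ℕ) :
    (l.foldl (C.unrankStep T) (false, u, q, l, w)).2.2.2.2 = (C.unrank T l u q).reverse ++ w := by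
  have h : ∀ (l : List Bool) (x : ℕ × (ℕ × ℕ × ℕ) × List Bool × List ℕ),
      l.foldl (C.unrankStep T) (true, x) = (true, x) := by
    intro l x
    induction l with
    | nil => rfl
    | cons a l ih => rw [List.foldl_cons, unrankStep, if_pos rfl, ih]
  induction l generalizing u q w with
  | nil => rfl
  | cons b l ih =>
    rw [List.foldl_cons, unrankStep, unrank, if_neg (by simp)]
    by_cases hu : b = true ∧ u < lookup T q
    · rw [if_pos hu, if_pos hu, h]
      rfl
    · rw [if_neg hu, if_neg hu]
      dsimp only
      rw [List.tail_cons, ih]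
      simp

theorem sz_next_le (C : DFAInst) (q : ℕ × ℕ × ℕ) (a : ℕ) :
    sz (C.next q a) ≤ sz C.hard.rows + sz C.cost.rows + sz C.label.rows + 5 := by
  have h : ∀ {β : Type} (A : OutDFA C.s β) (q : ℕ), sz (A.stepN q a) ≤ 1 + sz A.rows := by
    intro β A q
    have h1 : ∀ {γ : Type} [Enc γ] (l : List γ) (i : ℕ) (d : γ), sz (l.getD i d) ≤ sz d + sz l := by
      intro γ _ l i d
      by_cases hi : i < l.length
      · rw [List.getD_eq_getElem _ _ hi]
        have := sz_le_of_mem (List.getElem_mem hi)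
        omega
      · rw [List.getD_eq_default _ _ (by omega)]
        omega
    have h2 : sz (A.rows.getD q []) ≤ sz A.rows := by
      by_cases hi : q < A.rows.length
      · rw [List.getD_eq_getElem _ _ hi]
        exact sz_le_of_mem (List.getElem_mem hi)
      · rw [List.getD_eq_default _ _ (by omega), sz_nil]
        exact sz_pos _
    have h3 := h1 (A.rows.getD q []) a 0
    have h4 : sz 0 = 1 := rfl
    unfold OutDFA.stepN
    omega
  have h1 := h C.hard q.1
  have h2 := h C.cost q.2.1
  have h3 := h C.label q.2.2
  simp only [next, sz_prod]
  omega

variable {α : Type} [Enc α] {C : α → DFAInst}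

@[fun_prop]
theorem pt_unrank {T : α → List ((ℕ × ℕ × ℕ) × ℕ)} {l : α → List Bool} {u : α → ℕ}
    {q : α → ℕ × ℕ × ℕ} (hC : PT C) (hT : PT T) (hl : PT l) (hu : PT u) (hq : PT q) :
    PT (fun a => (C a).unrank (T a) (l a) (u a) (q a)) := by
  have h : PT (fun a => (l a).foldl ((C a).unrankStep (T a)) (false, u a, q a, l a, [])) := by
    refine PT.foldl_of_add hl ?_ (by fun_prop) ?_
    · unfold unrankStep
      refine PT.ite (by fun_prop) (by fun_prop) (PT.ite (by fun_prop) (by fun_prop) ?_)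
      have h1 : PT (fun x : α × (Bool × ℕ × (ℕ × ℕ × ℕ) × List Bool × List ℕ) × Bool =>
          (x, pick (fun a => (C x.1).value (T x.1) x.2.1.2.2.2.1.tail
            ((C x.1).next x.2.1.2.2.1 a)) (List.range (C x.1).s)
            (x.2.1.2.1 - if x.2.2 = true then lookup (T x.1) x.2.1.2.2.1 else 0))) :=
        PT.id.prodMk (pt_pick (by fun_prop) (by fun_prop) (by fun_prop))
      exact PT.comp (g := fun z : (α × (Bool × ℕ × (ℕ × ℕ × ℕ) × List Bool × List ℕ) × Bool) ×
        ℕ × ℕ => (false, z.2.2, (C z.1.1).next z.1.2.1.2.2.1 z.2.1, z.1.2.1.2.2.2.1.tail,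
          z.2.1 :: z.1.2.1.2.2.2.2)) (by fun_prop) h1
    · obtain ⟨P, hP⟩ := (pt_letters hC).size
      obtain ⟨Q, hQ⟩ : PolyBdd (fun a => sz (C a).hard.rows) := (pt_hardRows.comp hC).size
      obtain ⟨R, hR⟩ : PolyBdd (fun a => sz (C a).cost.rows) := (pt_costRows.comp hC).size
      obtain ⟨S, hS⟩ : PolyBdd (fun a => sz (C a).label.rows) := (pt_labelRows.comp hC).size
      refine ⟨P + Q + R + S + 20, fun a x b hb => ?_⟩
      have h3 := sz_bool true
      have h4 := sz_bool false
      have hP : sz (List.range (C a).s) ≤ _ := hP a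
      have hQ : sz (C a).hard.rows ≤ _ := hQ a
      have hR : sz (C a).cost.rows ≤ _ := hR a
      have hS : sz (C a).label.rows ≤ _ := hS a
      simp only [unrankStep, Polynomial.eval_add, Polynomial.eval_ofNat]
      split_ifs with h1 h2
      · omega
      · simp only [sz_prod]; omega
      all_goals
        generalize hy : pick _ _ _ = y
        have h5 : y.2 ≤ x.2.1 := by
          rw [← hy]
          exact (pick_snd_le _ _ _).trans (Nat.sub_le _ _)
        have h5 := sz_nat_mono h5
        have h6 : sz y.1 ≤ sz (List.range (C a).s) := by
          rw [← hy]
          exact sz_pick_fst_le _ _ _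
        have h7 := (C a).sz_next_le x.2.2.1 y.1
        have h8 : sz x.2.2.2.1.tail ≤ sz x.2.2.2.1 := sz_le_of_suffix (List.tail_suffix _)
        simp only [sz_prod, sz_cons] at h7 ⊢
        omega
  have h2 := h.snd.snd.snd.snd.reverse
  simp only [foldl_unrankStep] at h2
  simpa using h2

end DFAInst

/-- A number in unary that is the number of binary digits of a computed number. -/
theorem pt_digits : PT (fun z : ℕ => List.replicate z.size ()) := by
  have hit : ∀ (i z : ℕ), (fun x : ℕ × List Unit => (x.1 / 2, () :: x.2))^[i] (z, []) =
      (z / 2 ^ i, List.replicate i ()) := by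
    intro i z
    induction i with
    | zero => simp
    | succ i ih =>
      rw [Function.iterate_succ_apply', ih, Nat.div_div_eq_div_mul, pow_succ]
      rfl
  have h := PT.iterate_while (c := fun x : ℕ × List Unit => !decide (x.1 ≤ 0))
    (f := fun x : ℕ × List Unit => (x.1 / 2, () :: x.2)) (init := fun z : ℕ => (z, []))
    (k := fun z => z.size) ?_ (by fun_prop) (by fun_prop) ?_ ?_ ?_ ?_
  · simpa only [hit] using h.snd
  · have : PT (fun x : ℕ × List Unit => decide (¬ x.1 ≤ 0)) := PT.decide (by fun_prop)
    simpa only [decide_not] using this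
  · intro z i hi
    have : 0 < z / 2 ^ i := Nat.div_pos (Nat.lt_size.1 hi) (by positivity)
    rw [hit]
    simpa using this.ne'
  · intro z
    rw [hit, Nat.div_eq_of_lt (Nat.lt_size_self z)]
    rfl
  · exact PolyBdd.self.mono fun z => by rw [sz_nat]; omega
  · refine ⟨3 * Polynomial.X + 2, fun z i hi => ?_⟩
    rw [hit, sz_prod]
    have h1 := sz_nat_mono (Nat.div_le_self z (2 ^ i))
    have h2 := sz_list_le (List.replicate i ()) 1 fun a _ => le_of_eq rfl
    have h3 := sz_nat z
    simp only [List.length_replicate, Polynomial.eval_add, Polynomial.eval_mul,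
      Polynomial.eval_X, Polynomial.eval_ofNat] at h2 ⊢
    omega

/-! ### Sampling by rejection -/

/-- The number with the binary digits `s`, the most significant one first, after the digits of
`r`. -/
def bitsVal (r : ℕ) (s : List Bool) : ℕ := s.foldl (fun r b => 2 * r + b.toNat) r

/-- The last `k` binary digits of `r`, the most significant one first. -/
def bitsOf : ℕ → ℕ → List Bool
  | 0, _ => []
  | k + 1, r => bitsOf k (r / 2) ++ [decide (r % 2 = 1)]

@[simp]
theorem length_bitsOf (k r : ℕ) : (bitsOf k r).length = k := by
  induction k generalizing r with
  | zero => rfl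
  | succ k ih => simp [bitsOf, ih]

theorem bitsVal_bitsOf {k r : ℕ} (h : r < 2 ^ k) : bitsVal 0 (bitsOf k r) = r := by
  induction k generalizing r with
  | zero => simp at h; simp [h, bitsOf, bitsVal]
  | succ k ih =>
    have := @ih (r / 2) (by rw [pow_succ] at h; omega)
    unfold bitsVal at this ⊢
    rw [bitsOf, List.foldl_append, this]
    rcases Nat.mod_two_eq_zero_or_one r with h | h <;> simp [h] <;> omega

theorem bitsVal_lt (r : ℕ) (s : List Bool) : bitsVal r s + 1 ≤ (r + 1) * 2 ^ s.length := by
  induction s generalizing r with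
  | nil => simp [bitsVal]
  | cons b s ih =>
    have h1 := ih (2 * r + b.toNat)
    have h2 : b.toNat ≤ 1 := by cases b <;> simp
    have h3 := Nat.mul_le_mul_right (2 ^ s.length) (show 2 * r + b.toNat + 1 ≤ 2 * (r + 1) by omega)
    have h4 : (r + 1) * 2 ^ (s.length + 1) = 2 * (r + 1) * 2 ^ s.length := by ring
    rw [List.length_cons, h4]
    exact h1.trans h3

theorem bitsOf_bitsVal (s : List Bool) : bitsOf s.length (bitsVal 0 s) = s := by
  induction s using List.reverseRecOn with
  | nil => rfl
  | append_singleton s b ih =>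
    have h : bitsVal 0 (s ++ [b]) = 2 * bitsVal 0 s + b.toNat := by
      simp [bitsVal, List.foldl_append]
    rw [List.length_append, List.length_singleton, bitsOf, h]
    have h1 : (2 * bitsVal 0 s + b.toNat) / 2 = bitsVal 0 s := by
      have : b.toNat ≤ 1 := by cases b <;> simp
      omega
    have h2 : decide ((2 * bitsVal 0 s + b.toNat) % 2 = 1) = b := by
      cases b <;> simp [Nat.add_mod]
    rw [h1, h2, ih]

/-- The coin tosses of a run of rejection sampling: the numbers `Z + i` for the `i` in `l` are
rejected, then the number `u` is accepted. Each number takes `k` tosses. -/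
def sampleCoins (k Z : ℕ) {c : ℕ} (l : List (Fin c)) (u : ℕ) : List Bool :=
  (l.flatMap fun i : Fin c => bitsOf k (Z + (i : ℕ))) ++ bitsOf k u

theorem length_sampleCoins (k Z : ℕ) {c : ℕ} (l : List (Fin c)) (u : ℕ) :
    (sampleCoins k Z l u).length = k * (l.length + 1) := by
  induction l with
  | nil => simp [sampleCoins]
  | cons i l ih =>
    simp only [sampleCoins, List.flatMap_cons, List.append_assoc, List.length_append,
      length_bitsOf, List.length_cons] at ih ⊢
    rw [ih]; ring

theorem sampleCoins_cons (k Z : ℕ) {c : ℕ} (i : Fin c) (l : List (Fin c)) (u : ℕ) :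
    sampleCoins k Z (i :: l) u = bitsOf k (Z + i) ++ sampleCoins k Z l u := by
  simp [sampleCoins]

theorem bitsOf_injOn {k r r' : ℕ} (h : r < 2 ^ k) (h' : r' < 2 ^ k) (e : bitsOf k r = bitsOf k r') :
    r = r' := by
  rw [← bitsVal_bitsOf h, e, bitsVal_bitsOf h']

theorem sampleCoins_inj {k Z : ℕ} (hZ : Z ≤ 2 ^ k) (l l' : List (Fin (2 ^ k - Z))) (u u' : Fin Z)
    (e : sampleCoins k Z l u = sampleCoins k Z l' u') : l = l' ∧ u = u' := by
  induction l generalizing l' with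
  | nil =>
    cases l' with
    | nil =>
      simp only [sampleCoins, List.flatMap_nil, List.nil_append] at e
      exact ⟨rfl, Fin.ext (bitsOf_injOn (by omega) (by omega) e)⟩
    | cons i l' =>
      rw [sampleCoins_cons] at e
      simp only [sampleCoins, List.flatMap_nil, List.nil_append] at e
      rw [← List.append_nil (bitsOf k u)] at e
      have := bitsOf_injOn (by omega) (by omega) (List.append_inj_left e (by simp))
      omega
  | cons i l ih =>
    cases l' with
    | nil =>
      rw [sampleCoins_cons] at e
      simp only [sampleCoins, List.flatMap_nil, List.nil_append] at e
      rw [← List.append_nil (bitsOf k u')] at e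
      have := bitsOf_injOn (by omega) (by omega) (List.append_inj_left e (by simp))
      omega
    | cons i' l' =>
      rw [sampleCoins_cons, sampleCoins_cons] at e
      have h1 := bitsOf_injOn (by omega) (by omega) (List.append_inj_left e (by simp))
      obtain ⟨h2, h3⟩ := ih l' (List.append_inj_right e (by simp))
      exact ⟨by rw [h2, Fin.ext (Nat.add_left_cancel h1)], h3⟩

/-- Every sequence of coin tosses is comparable with the tosses of a run. -/
theorem exists_sampleCoins {k Z : ℕ} (hZ : 0 < Z) (hk : Z < 2 ^ k) (s : List Bool) :
    ∃ (l : List (Fin (2 ^ k - Z))) (u : Fin Z) (e e' : List Bool),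
      sampleCoins k Z l u ++ e' = s ++ e := by
  have hk0 : 0 < k := by
    rcases Nat.eq_zero_or_pos k with rfl | h
    · simp at hk; omega
    · exact h
  have block : ∀ b : List Bool, b.length = k →
      (∃ u : Fin Z, bitsOf k u = b) ∨ ∃ i : Fin (2 ^ k - Z), bitsOf k (Z + i) = b := by
    intro b hb
    have h1 := bitsVal_lt 0 b
    have h2 := bitsOf_bitsVal b
    rw [hb] at h1 h2
    by_cases h : bitsVal 0 b < Z
    · exact Or.inl ⟨⟨_, h⟩, h2⟩
    · refine Or.inr ⟨⟨bitsVal 0 b - Z, by omega⟩, ?_⟩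
      have h3 : Z + (bitsVal 0 b - Z) = bitsVal 0 b := by omega
      simp only [h3, h2]
  induction hn : s.length using Nat.strong_induction_on generalizing s with
  | _ n ih =>
    by_cases hs : s.length < k
    · rcases block (s ++ List.replicate (k - s.length) false) (by simp; omega) with
        ⟨u, hu⟩ | ⟨i, hi⟩
      · exact ⟨[], u, _, [], by rw [List.append_nil]; exact hu⟩
      · refine ⟨[i], ⟨0, hZ⟩, List.replicate (k - s.length) false ++ bitsOf k 0, [], ?_⟩
        rw [sampleCoins_cons, hi]
        simp [sampleCoins]
    · rcases block (s.take k) (by simp; omega) with ⟨u, hu⟩ | ⟨i, hi⟩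
      · refine ⟨[], u, [], s.drop k, ?_⟩
        simp only [sampleCoins, List.flatMap_nil, List.nil_append, hu, List.append_nil,
          List.take_append_drop]
      · obtain ⟨l, u, e, e', h⟩ := ih (s.drop k).length (by simp; omega) (s.drop k) rfl
        refine ⟨i :: l, u, e, e', ?_⟩
        rw [sampleCoins_cons, hi, List.append_assoc, h, ← List.append_assoc,
          List.take_append_drop]

/-- Summation over all lists, sorted by their lengths. -/
theorem tsum_list_length {c : ℕ} (g : ℕ → ℝ≥0∞) :
    ∑' l : List (Fin c), g l.length = ∑' n, (c : ℝ≥0∞) ^ n * g n := by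
  rw [← (Equiv.sigmaFiberEquiv (List.length : List (Fin c) → ℕ)).tsum_eq, ENNReal.tsum_sigma']
  refine tsum_congr fun n => ?_
  have h : ∀ x : {l : List (Fin c) // l.length = n},
      g (Equiv.sigmaFiberEquiv List.length ⟨n, x⟩ : List (Fin c)).length = g n := by
    rintro ⟨l, hl⟩
    simp [hl]
  rw [tsum_congr h]
  change ∑' _ : List.Vector (Fin c) n, g n = _
  rw [tsum_fintype, Finset.sum_const, Finset.card_univ, card_vector, Fintype.card_fin, nsmul_eq_mul]
  push_cast
  rfl

theorem tsum_succ_mul_half_pow_le : ∑' n : ℕ, ((n : ℝ≥0∞) + 1) * 2⁻¹ ^ n ≤ 8 := by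
  have h1 : ∀ n : ℕ, (n + 1) * 2 ^ n ≤ 2 * 3 ^ n := by
    intro n
    induction n with
    | zero => norm_num
    | succ n ih =>
      rcases Nat.eq_zero_or_pos n with rfl | hn
      · norm_num
      · have : (n + 1 + 1) * 2 ≤ 3 * (n + 1) := by omega
        calc (n + 1 + 1) * 2 ^ (n + 1) = ((n + 1 + 1) * 2) * 2 ^ n := by ring
          _ ≤ (3 * (n + 1)) * 2 ^ n := Nat.mul_le_mul_right _ this
          _ = 3 * ((n + 1) * 2 ^ n) := by ring
          _ ≤ 3 * (2 * 3 ^ n) := Nat.mul_le_mul_left _ ih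
          _ = _ := by ring
  have h4 : (2 : ℝ≥0∞)⁻¹ = 2 * 4⁻¹ := by
    rw [show (4 : ℝ≥0∞) = 2 * 2 by norm_num, ENNReal.mul_inv (by simp) (by simp), ← mul_assoc,
      ENNReal.mul_inv_cancel (by simp) (by simp), one_mul]
  have h2 : ∀ n : ℕ, ((n : ℝ≥0∞) + 1) * 2⁻¹ ^ n ≤ 2 * (3 * 4⁻¹) ^ n := by
    intro n
    rw [h4, mul_pow, mul_pow, ← mul_assoc, ← mul_assoc]
    refine mul_le_mul_left ?_ _
    exact_mod_cast h1 n
  refine (ENNReal.tsum_le_tsum h2).trans ?_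
  rw [ENNReal.tsum_mul_left, ENNReal.tsum_geometric]
  have h5 : (1 : ℝ≥0∞) - 3 * 4⁻¹ = 4⁻¹ := by
    have : (1 : ℝ≥0∞) = 4⁻¹ + 3 * 4⁻¹ := by
      rw [← one_add_mul, show (1 : ℝ≥0∞) + 3 = 4 by norm_num,
        ENNReal.mul_inv_cancel (by simp) (by simp)]
    rw [this]
    exact ENNReal.add_sub_cancel_right (ENNReal.mul_ne_top (by simp) (by simp))
  rw [h5, inv_inv]
  norm_num

/-- All runs of a program are known as soon as computations are known whose coin tosses are
comparable with every sequence of coin tosses. -/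
theorem exists_runEquiv {p : Prog} {v : Val} {X : Type} {s : X → List Bool} {o : X → Val}
    {t : X → ℕ} (h : ∀ x, Eval p v (s x) (o x) (t x)) (hinj : Function.Injective s)
    (hs : ∀ b : List Bool, ∃ x e e', s x ++ e' = b ++ e) :
    ∃ φ : X ≃ Run p v, ∀ x, (φ x).coins = s x ∧ (φ x).out = o x ∧ (φ x).time = t x := by
  refine ⟨Equiv.ofBijective (fun x => ⟨s x, o x, t x, h x⟩) ⟨fun x y e => ?_, fun r => ?_⟩,
    fun x => ⟨rfl, rfl, rfl⟩⟩
  · exact hinj (congrArg Run.coins e)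
  · obtain ⟨x, e, e', hx⟩ := hs r.coins
    obtain ⟨h1, h2, h3⟩ := (h x).unique _ _ r.eval hx
    refine ⟨x, ?_⟩
    obtain ⟨c, w, m, hr⟩ := r
    simp only at h1 h2 h3 ⊢
    subst h1 h2 h3
    rfl

section Sample

variable {p : Prog} {v : Val} {k Z : ℕ}

theorem exists_sampleRunEquiv (hZ : 0 < Z) (hk : Z < 2 ^ k) {g : ℕ → Val}
    {t : List (Fin (2 ^ k - Z)) → Fin Z → ℕ}
    (h : ∀ l (u : Fin Z), Eval p v (sampleCoins k Z l u) (g u) (t l u)) :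
    ∃ φ : List (Fin (2 ^ k - Z)) × Fin Z ≃ Run p v, ∀ x,
      (φ x).weight = 2⁻¹ ^ k * (2⁻¹ ^ k) ^ x.1.length ∧ (φ x).out = g x.2 ∧
      (φ x).time = t x.1 x.2 := by
  obtain ⟨φ, hφ⟩ := exists_runEquiv (X := List (Fin (2 ^ k - Z)) × Fin Z)
    (s := fun x => sampleCoins k Z x.1 x.2) (o := fun x => g x.2) (t := fun x => t x.1 x.2)
    (fun x => h x.1 x.2)
    (fun x y e => by
      obtain ⟨h1, h2⟩ := sampleCoins_inj hk.le _ _ _ _ e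
      exact Prod.ext h1 h2)
    (fun b => by
      obtain ⟨l, u, e, e', h⟩ := exists_sampleCoins hZ hk b
      exact ⟨(l, u), e, e', h⟩)
  refine ⟨φ, fun x => ⟨?_, (hφ x).2⟩⟩
  rw [Run.weight, (hφ x).1, length_sampleCoins, pow_mul, pow_succ, mul_comm]

/-- The total weight of the runs that accept a given number. -/
theorem tsum_weights (hk : Z < 2 ^ k) :
    (2⁻¹ ^ k : ℝ≥0∞) * ∑' l : List (Fin (2 ^ k - Z)), (2⁻¹ ^ k : ℝ≥0∞) ^ l.length =
      (Z : ℝ≥0∞)⁻¹ := by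
  have h1 : (2⁻¹ ^ k : ℝ≥0∞) * 2 ^ k = 1 := by
    rw [← mul_pow, ENNReal.inv_mul_cancel (by simp) (by simp), one_pow]
  have h2 : (1 : ℝ≥0∞) - (2 ^ k - Z : ℕ) * 2⁻¹ ^ k = Z * 2⁻¹ ^ k := by
    have : (1 : ℝ≥0∞) = Z * 2⁻¹ ^ k + (2 ^ k - Z : ℕ) * 2⁻¹ ^ k := by
      rw [← add_mul, ← Nat.cast_add, Nat.add_sub_cancel' hk.le, ← h1, mul_comm]
      push_cast
      rfl
    conv_lhs => rw [this]
    refine ENNReal.add_sub_cancel_right (ENNReal.mul_ne_top (by simp) (by simp))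
  rw [tsum_list_length (fun n => (2⁻¹ ^ k : ℝ≥0∞) ^ n)]
  simp only [← mul_pow]
  rw [ENNReal.tsum_geometric, h2]
  rw [ENNReal.mul_inv (by simp) (by simp), mul_comm, mul_assoc,
    ENNReal.inv_mul_cancel (by simp) (by simp), mul_one]

/-- If the runs of a program are those of rejection sampling of a number `u < Z`, then its output
distribution is that of the result for a uniform number `u < Z`. -/
theorem outProb_of_sample (hZ : 0 < Z) (hk : Z < 2 ^ k) {g : ℕ → Val}
    {t : List (Fin (2 ^ k - Z)) → Fin Z → ℕ}
    (h : ∀ l (u : Fin Z), Eval p v (sampleCoins k Z l u) (g u) (t l u)) (w : Val)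
    [DecidablePred fun u => g u = w] :
    outProb p v w = ((∑ u ∈ Finset.range Z, if g u = w then 1 else 0 : ℕ) : ℝ≥0∞) / Z := by
  obtain ⟨φ, hφ⟩ := exists_sampleRunEquiv hZ hk h
  rw [outProb, ← φ.tsum_eq, ENNReal.tsum_prod', ENNReal.tsum_comm, tsum_fintype,
    Finset.sum_range, div_eq_mul_inv, ← tsum_weights hk]
  push_cast
  rw [Finset.sum_mul]
  refine Finset.sum_congr rfl fun u _ => ?_
  simp only [(hφ _).1, (hφ _).2.1]
  by_cases hu : g u = w
  · simp only [hu, if_true, one_mul]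
    rw [ENNReal.tsum_mul_left]
  · simp [hu]

/-- The expected running time of rejection sampling. -/
theorem expTime_of_sample {B : ℕ} (hZ : 0 < Z) (hk : Z < 2 ^ k) (hk' : 2 ^ k ≤ 2 * Z) {g : ℕ → Val}
    {t : List (Fin (2 ^ k - Z)) → Fin Z → ℕ}
    (h : ∀ l (u : Fin Z), Eval p v (sampleCoins k Z l u) (g u) (t l u))
    (ht : ∀ l u, t l u ≤ (l.length + 1) * B) : expTime p v ≤ (8 * B : ℕ) := by
  obtain ⟨φ, hφ⟩ := exists_sampleRunEquiv hZ hk h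
  have h1 : (2 : ℝ≥0∞) ^ k * 2⁻¹ ^ k = 1 := by
    rw [← mul_pow, ENNReal.mul_inv_cancel (by simp) (by simp), one_pow]
  have h2 : ((2 ^ k - Z : ℕ) : ℝ≥0∞) * 2⁻¹ ^ k ≤ 2⁻¹ := by
    have h3 : ((2 ^ k - Z : ℕ) : ℝ≥0∞) * 2 ≤ 2 ^ k := by
      have : (2 ^ k - Z) * 2 ≤ 2 ^ k := by omega
      exact_mod_cast this
    rw [ENNReal.le_inv_iff_mul_le, mul_assoc, mul_comm _ (2 : ℝ≥0∞), ← mul_assoc]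
    exact (mul_le_mul_left h3 _).trans h1.le
  calc expTime p v = ∑' l : List (Fin (2 ^ k - Z)), ∑' u : Fin Z,
        2⁻¹ ^ k * (2⁻¹ ^ k) ^ l.length * (t l u : ℝ≥0∞) := by
        rw [expTime, ← φ.tsum_eq, ENNReal.tsum_prod']
        simp only [(hφ _).1, (hφ _).2.2]
    _ ≤ ∑' l : List (Fin (2 ^ k - Z)), ∑' _ : Fin Z,
        2⁻¹ ^ k * (2⁻¹ ^ k) ^ l.length * (((l.length + 1) * B : ℕ) : ℝ≥0∞) := by
        gcongr with l u
        exact ht l u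
    _ = (Z * 2⁻¹ ^ k) * B * ∑' l : List (Fin (2 ^ k - Z)),
        ((2⁻¹ ^ k) ^ l.length * ((l.length : ℝ≥0∞) + 1)) := by
        rw [← ENNReal.tsum_mul_left]
        refine tsum_congr fun l => ?_
        rw [tsum_fintype, Finset.sum_const, Finset.card_univ, Fintype.card_fin, nsmul_eq_mul]
        push_cast
        ring
    _ = (Z * 2⁻¹ ^ k) * B * ∑' n : ℕ,
        ((n : ℝ≥0∞) + 1) * (((2 ^ k - Z : ℕ) : ℝ≥0∞) * 2⁻¹ ^ k) ^ n := by
        rw [tsum_list_length (fun n => (2⁻¹ ^ k : ℝ≥0∞) ^ n * ((n : ℝ≥0∞) + 1))]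
        congr 1
        refine tsum_congr fun n => ?_
        rw [mul_pow]
        ring
    _ ≤ (2 ^ k * 2⁻¹ ^ k) * B * ∑' n : ℕ, ((n : ℝ≥0∞) + 1) * 2⁻¹ ^ n := by
        have : (Z : ℝ≥0∞) ≤ 2 ^ k := by exact_mod_cast hk.le
        gcongr
    _ ≤ 1 * B * 8 := by
        rw [h1]
        gcongr
        exact tsum_succ_mul_half_pow_le
    _ = _ := by push_cast; ring

end Sample

/-! ### Programming rejection sampling -/

/-- Evaluation with a bound for the running time. -/
def EvalLe (p : Prog) (v : Val) (s : List Bool) (w : Val) (T : ℕ) : Prop :=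
  ∃ t ≤ T, Eval p v s w t

/-- There is a program that draws `k` random bits, if `k` is given in unary. -/
theorem exists_draw : ∃ (p : Prog) (P : Polynomial ℕ), ∀ s : List Bool,
    EvalLe p (enc (List.replicate s.length ())) s (enc (bitsVal 0 s)) (P.eval s.length) := by
  obtain ⟨pt, Pt, ht⟩ : PT (fun x : List Unit × ℕ => x.1.tail) := by fun_prop
  obtain ⟨pd, Pd, hd⟩ : PT (fun x : List Unit × ℕ => 2 * x.2) := by fun_prop
  obtain ⟨p0, P0, h0⟩ : PT (fun l : List Unit => (l, 0)) := by fun_prop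
  obtain ⟨ps, Ps, hs⟩ : PT (fun x : List Unit × ℕ => x.2) := by fun_prop
  have hsz : ∀ (k : ℕ) (l : List Unit) (r : ℕ), l.length ≤ k → r < 2 ^ k →
      sz (l, r) ≤ 3 * k + 3 := by
    intro k l r hl hr
    have h1 := sz_list_le l 1 fun a _ => le_of_eq rfl
    have h2 := Nat.size_le.2 hr
    rw [sz_prod, sz_nat]
    dsimp only
    omega
  let step : Prog := .pair pt (.seq (.pair pd .flip) (.op .add))
  let B : ℕ → ℕ := fun S => Pt.eval S + Pd.eval S + 2 * S + 20
  have hstep : ∀ (k : ℕ) (l : List Unit) (r : ℕ) (b : Bool), l.length + 1 ≤ k → r < 2 ^ k →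
      EvalLe step (enc (() :: l, r)) [b] (enc (l, 2 * r + b.toNat)) (B (3 * k + 3)) := by
    intro k l r b hl hr
    have hS := hsz k (() :: l) r hl hr
    obtain ⟨t1, ht1, e1⟩ := ht (() :: l, r)
    obtain ⟨t2, ht2, e2⟩ := hd (() :: l, r)
    have h1 := poly_mono Pt hS
    have h2 := poly_mono Pd hS
    have e3 := Eval.flip (enc (() :: l, r)) b
    have e4 := Eval.op .add (.pair (enc (2 * r)) (Val.ofBool b))
    have hadd : Op.add.app (.pair (enc (2 * r)) (Val.ofBool b)) = enc (2 * r + b.toNat) := by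
      cases b <;> simp [Op.app, Val.fst, Val.snd, Val.ofBool, Val.toInt, enc_nat]
    rw [hadd] at e4
    have e5 := Eval.pair e1 (Eval.seq (Eval.pair e2 e3) e4)
    refine ⟨_, ?_, e5⟩
    have h3 : (Val.ofBool b).size ≤ 2 := sz_bool b
    have h4 : (enc (() :: l, r)).size ≤ 3 * k + 3 := hS
    have h5 : 2 * r + b.toNat < 2 ^ (k + 1) := by
      have : b.toNat ≤ 1 := by cases b <;> simp
      rw [pow_succ]; omega
    have h6 : (enc (2 * r)).size ≤ k + 2 := by
      have := Nat.size_le.2 (show 2 * r < 2 ^ (k + 1) by omega)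
      have h := sz_nat (2 * r)
      unfold sz at h
      omega
    have h7 : (enc (2 * r + b.toNat)).size ≤ k + 2 := by
      have := Nat.size_le.2 h5
      have h := sz_nat (2 * r + b.toNat)
      unfold sz at h
      omega
    simp only [Val.size, B]
    omega
  have hloop : ∀ (k : ℕ) (s : List Bool) (r : ℕ), s.length ≤ k → (r + 1) * 2 ^ s.length ≤ 2 ^ k →
      EvalLe (.loop (.op .fst) step) (enc (List.replicate s.length (), r)) s
        (enc (([] : List Unit), bitsVal r s))
        ((s.length + 1) * (B (3 * k + 3) + 2 * (3 * k + 3) + 1)) := by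
    intro k s
    induction s with
    | nil =>
      intro r hs hr
      have hS : (enc (([] : List Unit), r)).size ≤ 3 * k + 3 :=
        hsz k [] r hs (by rw [List.length_nil, pow_zero] at hr; omega)
      have e := Eval.loopDone (p := step) (Eval.op .fst (enc (([] : List Unit), r))) rfl
      refine ⟨_, ?_, e⟩
      have h1 : (Op.fst.app (enc (([] : List Unit), r))).size = 1 := sz_nil (α := Unit)
      simp only [List.length_nil]
      omega
    | cons b s ih =>
      intro r hs hr
      have hr' : r < 2 ^ k := lt_of_lt_of_le (Nat.lt_succ_self r)
        ((Nat.le_mul_of_pos_right _ (by positivity)).trans hr)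
      have hS : (enc (List.replicate (s.length + 1) (), r)).size ≤ 3 * k + 3 :=
        hsz k _ r (by simpa using hs) hr'
      have e1 := Eval.op .fst (enc (List.replicate (s.length + 1) (), r))
      obtain ⟨t2, ht2, e2⟩ := hstep k (List.replicate s.length ()) r b (by simpa using hs) hr'
      obtain ⟨t3, ht3, e3⟩ := ih (2 * r + b.toNat) ((Nat.le_succ _).trans hs) (by
        refine le_trans ?_ hr
        rw [List.length_cons, pow_succ, mul_comm (2 ^ _) 2, ← mul_assoc]
        refine Nat.mul_le_mul_right _ ?_
        have : b.toNat ≤ 1 := by cases b <;> simp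
        omega)
      refine ⟨_, ?_, .loopStep e1 (by simp [List.replicate_succ, Op.app, Val.fst]) e2 e3⟩
      have h1 : (Op.fst.app (enc (List.replicate (s.length + 1) (), r))).size ≤ 3 * k + 3 := by
        refine le_trans ?_ hS
        simp only [enc_prod, Op.app, Val.fst, Val.size]
        omega
      rw [List.length_cons, add_mul (s.length + 1) 1]
      omega
  refine ⟨.seq p0 (.seq (.loop (.op .fst) step) ps),
    P0.comp (2 * Polynomial.X + 1) + (Polynomial.X + 1) *
      (Pt.comp (3 * Polynomial.X + 3) + Pd.comp (3 * Polynomial.X + 3) +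
        2 * (3 * Polynomial.X + 3) + 20 + 2 * (3 * Polynomial.X + 3) + 1) +
      Ps.comp (3 * Polynomial.X + 3) + 2, fun s => ?_⟩
  obtain ⟨t1, ht1, e1⟩ := h0 (List.replicate s.length ())
  obtain ⟨t2, ht2, e2⟩ := hloop s.length s 0 le_rfl (by simp)
  obtain ⟨t3, ht3, e3⟩ := hs ([], bitsVal 0 s)
  have e := Eval.seq e1 (Eval.seq e2 e3)
  simp only [List.nil_append, List.append_nil] at e
  refine ⟨_, ?_, e⟩
  have h1 := sz_list_le (List.replicate s.length ()) 1 fun a _ => le_of_eq rfl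
  rw [List.length_replicate] at h1
  have h2 := poly_mono P0 (h1.trans (show _ ≤ 2 * s.length + 1 by omega))
  have h3 := bitsVal_lt 0 s
  have h4 := poly_mono Ps (hsz s.length [] (bitsVal 0 s) (by simp) (by omega))
  simp only [Polynomial.eval_add, Polynomial.eval_mul, Polynomial.eval_comp, Polynomial.eval_X,
    Polynomial.eval_ofNat, Polynomial.eval_one, B] at ht2 ⊢
  omega

/-- Rejection sampling can be programmed: for every computable number `Z a > 0` and every
computable function `f a` on the numbers below `Z a`, there is a program that applies `f a` to a
uniform random number, in expected polynomial time. -/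
theorem exists_sampler {α β : Type} [Enc α] [Enc β] {Z : α → ℕ} {f : α → ℕ → β} (hZ : PT Z)
    (hf : PT (fun x : α × ℕ => f x.1 x.2)) : ∃ (G : Prog) (Q : Polynomial ℕ), ∀ a, 0 < Z a →
      (∀ (w : Val) [DecidablePred fun u => enc (f a u) = w],
        outProb (.seq (.op (.const (enc a))) G) (.num 0) w =
          ((∑ u ∈ Finset.range (Z a), if enc (f a u) = w then 1 else 0 : ℕ) : ℝ≥0∞) / Z a) ∧
      expTime (.seq (.op (.const (enc a))) G) (.num 0) ≤ ((Q.eval (sz a) : ℕ) : ℝ≥0∞) := by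
  obtain ⟨pr, Pr, hr⟩ := exists_draw
  -- The state consists of the argument, the number of digits of `Z a`, `Z a` itself, and the
  -- current candidate; the first candidate is `Z a`, which is rejected.
  have hdig : PT (fun a => List.replicate (Z a).size ()) := pt_digits.comp hZ
  obtain ⟨pi, Pi, hi⟩ : PT (fun a => ((a, List.replicate (Z a).size (), Z a), Z a)) := by fun_prop
  obtain ⟨pc, Pc, hc⟩ : PT (fun x : (α × List Unit × ℕ) × ℕ => decide (x.1.2.2 ≤ x.2)) :=
    PT.decide (by fun_prop)
  obtain ⟨pb, Pb, hb⟩ : PT (fun x : (α × List Unit × ℕ) × ℕ => x.1.2.1) := by fun_prop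
  obtain ⟨pf, Pf, hf⟩ : PT (fun x : (α × List Unit × ℕ) × ℕ => f x.1.1 x.2) :=
    hf.comp (f := fun x : (α × List Unit × ℕ) × ℕ => (x.1.1, x.2)) (by fun_prop)
  let body : Prog := .pair (.op .fst) (.seq pb pr)
  let X : α → (α × List Unit × ℕ) := fun a => (a, List.replicate (Z a).size (), Z a)
  -- A bound for the sizes of all states.
  let S : α → ℕ := fun a => sz (X a) + (Z a).size + 2
  have hX : PolyBdd fun a => sz (X a) := PT.size (by fun_prop)
  have hk : PolyBdd fun a => (Z a).size := hZ.size.mono fun a => by rw [sz_nat]; omega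
  have hS : PolyBdd S := (hX.add hk).add (PolyBdd.const 2)
  have hsz : ∀ a u, u < 2 ^ (Z a).size → sz (X a, u) ≤ S a := by
    intro a u hu
    have := Nat.size_le.2 hu
    rw [sz_prod, sz_nat u]
    simp only [S]
    omega
  have hbody : ∀ a (u r : ℕ), u < 2 ^ (Z a).size → r < 2 ^ (Z a).size →
      EvalLe body (enc (X a, u)) (bitsOf (Z a).size r) (enc (X a, r))
        (2 * S a + Pb.eval (S a) + Pr.eval (Z a).size + 2) := by
    intro a u r hu hr
    have hS := hsz a u hu
    have e1 := Eval.op .fst (enc (X a, u))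
    obtain ⟨t2, ht2, e2⟩ := hb (X a, u)
    obtain ⟨t3, ht3, e3⟩ := ‹∀ s : List Bool, EvalLe pr _ _ _ _› (bitsOf (Z a).size r)
    rw [bitsVal_bitsOf hr, length_bitsOf] at e3
    rw [length_bitsOf] at ht3
    have e := Eval.pair e1 (Eval.seq e2 e3)
    refine ⟨_, ?_, e⟩
    have h1 := poly_mono Pb hS
    have h2 : (Op.fst.app (enc (X a, u))).size ≤ sz (X a, u) := by
      simp only [enc_prod, Op.app, Val.fst, Val.size, sz]
      omega
    have h3 : (enc (X a, u)).size = sz (X a, u) := rfl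
    omega
  -- A bound for the time of a round.
  let B : α → ℕ := fun a => 2 * S a + Pb.eval (S a) + Pr.eval (Z a).size + Pc.eval (S a) + 4
  have hloop : ∀ a (l : List (Fin (2 ^ (Z a).size - Z a))) (u : Fin (Z a)) (r : ℕ), Z a ≤ r →
      r < 2 ^ (Z a).size →
      EvalLe (.loop pc body) (enc (X a, r)) (sampleCoins (Z a).size (Z a) l u) (enc (X a, (u : ℕ)))
        ((l.length + 1) * B a + Pc.eval (S a) + 1) := by
    intro a l u
    have hlt := Nat.lt_size_self (Z a)
    have round : ∀ (r r' : ℕ) (s : List Bool) (T : ℕ), Z a ≤ r → r < 2 ^ (Z a).size →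
        r' < 2 ^ (Z a).size →
        EvalLe (.loop pc body) (enc (X a, r')) s (enc (X a, (u : ℕ))) T →
        EvalLe (.loop pc body) (enc (X a, r)) (bitsOf (Z a).size r' ++ s) (enc (X a, (u : ℕ)))
          (B a + T) := by
      intro r r' s T hZr hr hr' h
      obtain ⟨t1, ht1, e1⟩ := hc (X a, r)
      obtain ⟨t2, ht2, e2⟩ := hbody a r r' hr hr'
      obtain ⟨t3, ht3, e3⟩ := h
      have h1 := poly_mono Pc (hsz a r hr)
      have e := Eval.loopStep e1 (by simp [X, hZr, enc_true]) e2 e3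
      refine ⟨_, ?_, e⟩
      simp only [B]
      omega
    have last : EvalLe (.loop pc body) (enc (X a, (u : ℕ))) [] (enc (X a, (u : ℕ)))
        (Pc.eval (S a) + 1) := by
      obtain ⟨t1, ht1, e1⟩ := hc (X a, (u : ℕ))
      have h1 := poly_mono Pc (hsz a u (by omega))
      refine ⟨_, ?_, Eval.loopDone e1 ?_⟩
      · omega
      · have : decide (Z a ≤ u) = false := by simp
        change enc (decide (Z a ≤ u)) = _
        rw [this, enc_false]
    induction l with
    | nil =>
      intro r hZr hr
      have := round r u [] _ hZr hr (by omega) last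
      simpa [sampleCoins, add_assoc] using this
    | cons i l ih =>
      intro r hZr hr
      have := round r (Z a + i) _ _ hZr hr (by omega) (ih (Z a + i) (by omega) (by omega))
      rw [sampleCoins_cons, List.length_cons, add_mul (l.length + 1) 1]
      obtain ⟨t, ht, e⟩ := this
      exact ⟨t, by omega, e⟩
  have hbound : PolyBdd fun a => 8 * (B a + Pi.eval (sz a) + sz a + Pc.eval (S a) + Pf.eval (S a) +
      10) :=
    (PolyBdd.const 8).mul <| (((((((((PolyBdd.const 2).mul hS).add (hS.eval Pb)).add
      (hk.eval Pr)).add (hS.eval Pc)).add (PolyBdd.const 4)).add (PolyBdd.self.eval Pi)).add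
      PolyBdd.self).add (hS.eval Pc)).add (hS.eval Pf) |>.add (PolyBdd.const 10)
  obtain ⟨Q, hQ⟩ := hbound
  let G : Prog := .seq pi (.seq (.loop pc body) pf)
  refine ⟨G, Q, fun a ha => ?_⟩
  have hlt := Nat.lt_size_self (Z a)
  have hle : 2 ^ (Z a).size ≤ 2 * Z a := by
    have h1 : 0 < (Z a).size := Nat.size_pos.2 ha
    obtain ⟨j, hj⟩ : ∃ j, (Z a).size = j + 1 := ⟨(Z a).size - 1, by omega⟩
    have h2 : 2 ^ j ≤ Z a := Nat.lt_size.1 (by omega)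
    rw [hj, pow_succ]
    omega
  have hall : ∀ (l : List (Fin (2 ^ (Z a).size - Z a))) (u : Fin (Z a)),
      EvalLe (.seq (.op (.const (enc a))) G) (.num 0) (sampleCoins (Z a).size (Z a) l u)
        (enc (f a u)) ((l.length + 1) * (B a + Pi.eval (sz a) + sz a + Pc.eval (S a) +
          Pf.eval (S a) + 10)) := by
    intro l u
    have e1 := Eval.op (.const (enc a)) (.num 0)
    obtain ⟨t2, ht2, e2⟩ := hi a
    obtain ⟨t3, ht3, e3⟩ := hloop a l u (Z a) le_rfl hlt
    obtain ⟨t4, ht4, e4⟩ := hf (X a, (u : ℕ))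
    have e := Eval.seq e1 (Eval.seq e2 (Eval.seq e3 e4))
    simp only [List.nil_append, List.append_nil] at e
    refine ⟨_, ?_, e⟩
    have h1 := poly_mono Pf (hsz a u (by omega))
    have h2 : (Val.num 0).size = 1 := rfl
    have h3 : ((Op.const (enc a)).app (.num 0)).size = sz a := rfl
    have h4 : ∀ R L : ℕ, L * B a + B a + R ≤ (L + 1) * (B a + R) := fun R L => by
      nlinarith [Nat.zero_le (L * R)]
    have h5 := h4 (Pi.eval (sz a) + sz a + Pc.eval (S a) + Pf.eval (S a) + 10) l.length
    simp only [← add_assoc] at h5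
    rw [add_mul, one_mul] at ht3
    omega
  choose t ht e using hall
  refine ⟨fun w _ => outProb_of_sample ha hlt (g := fun u => enc (f a u)) e w, ?_⟩
  refine (expTime_of_sample ha hlt hle (g := fun u => enc (f a u)) e ht).trans ?_
  exact_mod_cast hQ a

/-! ### The greedy distribution is optimal -/

section Greedy

variable {ι : Type} {c : ι → ℤ} {κ : ι → ℕ} {lo w : ι → ℕ} {J : Finset ι} {T : ℕ}

theorem before_iff {i j : ι} : Before c κ i j ↔ toLex (c i, κ i) < toLex (c j, κ j) := by
  rw [Prod.Lex.toLex_lt_toLex]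
  rfl

theorem greedy_eq_zero {j : ι} (h : lo j = 0) (h' : w j = 0) : greedy J c κ lo w T j = 0 := by
  simp [greedy, h, h']

theorem le_greedy (j : ι) : lo j ≤ greedy J c κ lo w T j := Nat.le_add_right _ _

theorem greedy_le (j : ι) : greedy J c κ lo w T j ≤ lo j + w j :=
  Nat.add_le_add_left (min_le_left _ _) _

theorem sum_min_before (hκ : Set.InjOn κ J) (R : ℕ) :
    ∑ j ∈ J, min (w j) (R - ∑ i ∈ J, if Before c κ i j then w i else 0) = min R (∑ j ∈ J, w j) := by
  classical
  induction J using Finset.induction_on_max_value (fun i => toLex (c i, κ i)) with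
  | empty => simp
  | insert a s ha hmax ih =>
    have hlt : ∀ x ∈ s, Before c κ x a := by
      intro x hx
      rw [before_iff]
      refine lt_of_le_of_ne (hmax x hx) fun e => ha ?_
      have e' : κ x = κ a := (Prod.ext_iff.1 (toLex.injective e)).2
      rwa [← hκ (by simp [hx]) (by simp) e']
    have h1 : ∀ x ∈ s, ¬ Before c κ a x := by
      intro x hx h
      rw [before_iff] at h
      exact absurd (before_iff.1 (hlt x hx)) (lt_asymm h)
    have h2 : ¬ Before c κ a a := by rw [before_iff]; exact lt_irrefl _
    rw [Finset.sum_insert ha, Finset.sum_insert ha, Finset.sum_insert ha, if_neg h2]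
    have h3 : ∑ j ∈ s, min (w j) (R - ∑ i ∈ insert a s, if Before c κ i j then w i else 0) =
        ∑ j ∈ s, min (w j) (R - ∑ i ∈ s, if Before c κ i j then w i else 0) := by
      refine Finset.sum_congr rfl fun j hj => ?_
      rw [Finset.sum_insert ha, if_neg (h1 j hj), zero_add]
    have h4 : (∑ i ∈ s, if Before c κ i a then w i else 0) = ∑ i ∈ s, w i :=
      Finset.sum_congr rfl fun i hi => if_pos (hlt i hi)
    rw [h3, ih (hκ.mono (by simp)), h4]
    omega

theorem sum_greedy (hκ : Set.InjOn κ J) (h1 : ∑ j ∈ J, lo j ≤ T)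
    (h2 : T ≤ ∑ j ∈ J, (lo j + w j)) : ∑ j ∈ J, greedy J c κ lo w T j = T := by
  unfold greedy
  rw [Finset.sum_add_distrib, sum_min_before hκ]
  rw [Finset.sum_add_distrib] at h2
  omega

/-- Items that have not been filled up are no cheaper than items that got more than their lower
bounds. -/
theorem cost_le_of_greedy {i j : ι} (hi : i ∈ J) (h : greedy J c κ lo w T i < lo i + w i)
    (h' : lo j < greedy J c κ lo w T j) : c j ≤ c i := by
  classical
  by_contra! hc
  unfold greedy at h h'
  have h1 : (∑ k ∈ J, if Before c κ k i then w k else 0) + w i ≤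
      ∑ k ∈ J, if Before c κ k j then w k else 0 := by
    have h2 : w i = ∑ k ∈ J, if k = i then w k else 0 := by simp [hi]
    conv_lhs => rw [h2]
    rw [← Finset.sum_add_distrib]
    refine Finset.sum_le_sum fun k _ => ?_
    have hij : Before c κ i j := Or.inl hc
    by_cases hki : k = i
    · subst hki
      have : ¬ Before c κ k k := by rw [before_iff]; exact lt_irrefl _
      simp [this, hij]
    · by_cases hk : Before c κ k i
      · have : Before c κ k j := by
          rw [before_iff] at *
          exact hk.trans hij
        simp [hk, this, hki]
      · simp [hk, hki]
  omega

/-- The greedy distribution has the least cost among all distributions with the same bounds. -/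
theorem greedy_optimal (hκ : Set.InjOn κ J) {z : ι → ℝ} (h1 : ∀ j ∈ J, (lo j : ℝ) ≤ z j)
    (h2 : ∀ j ∈ J, z j ≤ lo j + w j) (hT : ∑ j ∈ J, z j = T) :
    ∑ j ∈ J, (c j : ℝ) * (greedy J c κ lo w T j : ℝ) ≤ ∑ j ∈ J, (c j : ℝ) * z j := by
  have hT1 : ∑ j ∈ J, lo j ≤ T := by
    have := Finset.sum_le_sum h1
    rw [hT] at this
    exact_mod_cast this
  have hT2 : T ≤ ∑ j ∈ J, (lo j + w j) := by
    have := Finset.sum_le_sum h2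
    rw [hT] at this
    exact_mod_cast this
  have hsum := sum_greedy (c := c) hκ hT1 hT2
  set x := greedy J c κ lo w T with hx
  have hle : ∀ j, lo j ≤ x j := le_greedy
  have hge : ∀ j, x j ≤ lo j + w j := greedy_le
  have hcost : ∀ i ∈ J, x i < lo i + w i → ∀ j, lo j < x j → c j ≤ c i :=
    fun i hi h j h' => cost_le_of_greedy hi h h'
  -- A threshold: cheaper items are filled up, more expensive items get their lower bounds.
  obtain ⟨θ, hθ1, hθ2⟩ : ∃ θ : ℤ, (∀ j ∈ J, c j < θ → x j = lo j + w j) ∧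
      ∀ j ∈ J, θ < c j → x j = lo j := by
    classical
    by_cases hA : (J.filter fun i => x i < lo i + w i).Nonempty
    · obtain ⟨i, hi, hmin⟩ := Finset.exists_min_image _ c hA
      rw [Finset.mem_filter] at hi
      refine ⟨c i, fun j hj hc => ?_, fun j hj hc => ?_⟩
      · by_contra hne
        have := hge j
        have := hmin j (Finset.mem_filter.2 ⟨hj, by omega⟩)
        omega
      · by_contra hne
        have := hle j
        have := hcost i hi.1 hi.2 j (by omega)
        omega
    · rw [Finset.not_nonempty_iff_eq_empty, Finset.filter_eq_empty_iff] at hA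
      refine ⟨∑ j ∈ J, |c j|, fun j hj _ => ?_, fun j hj hc => ?_⟩
      · have := hA hj
        have := hge j
        omega
      · have := Finset.single_le_sum (fun i _ => abs_nonneg (c i)) hj
        have := le_abs_self (c j)
        omega
  have key : 0 ≤ ∑ j ∈ J, ((c j : ℝ) - θ) * (z j - x j) := by
    refine Finset.sum_nonneg fun j hj => ?_
    rcases lt_trichotomy (c j) θ with h | h | h
    · have h3 : (c j : ℝ) < θ := by exact_mod_cast h
      have := h2 j hj
      rw [hθ1 j hj h]
      push_cast
      nlinarith
    · simp [h]
    · have h3 : (θ : ℝ) < c j := by exact_mod_cast h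
      have := h1 j hj
      rw [hθ2 j hj h]
      nlinarith
  have hsum' : ∑ j ∈ J, (x j : ℝ) = T := by exact_mod_cast hsum
  have : ∑ j ∈ J, ((c j : ℝ) - θ) * (z j - x j) = ∑ j ∈ J, (c j : ℝ) * z j -
      ∑ j ∈ J, (c j : ℝ) * x j - θ * (∑ j ∈ J, z j - ∑ j ∈ J, (x j : ℝ)) := by
    rw [mul_sub, Finset.mul_sum, Finset.mul_sum, ← Finset.sum_sub_distrib,
      ← Finset.sum_sub_distrib, ← Finset.sum_sub_distrib]
    exact Finset.sum_congr rfl fun j _ => by ring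
  rw [hT, hsum', sub_self, mul_zero, sub_zero] at this
  linarith

end Greedy

/-! ### Words and states -/

/-- The words that are shorter than `k`. -/
def wordsLT (s : ℕ) : ℕ → Finset (List (Fin s))
  | 0 => ∅
  | k + 1 => insert [] ((Finset.univ ×ˢ wordsLT s k).image fun x => x.1 :: x.2)

theorem mem_wordsLT {s k : ℕ} {w : List (Fin s)} : w ∈ wordsLT s k ↔ w.length < k := by
  induction k generalizing w with
  | zero => simp [wordsLT]
  | succ k ih =>
    cases w with
    | nil => simp [wordsLT]
    | cons a w => simp [wordsLT, ih]

theorem sum_wordsLT_succ {s k : ℕ} (f : List (Fin s) → ℕ) :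
    ∑ w ∈ wordsLT s (k + 1), f w = f [] + ∑ a : Fin s, ∑ w ∈ wordsLT s k, f (a :: w) := by
  rw [wordsLT, Finset.sum_insert (by simp), Finset.sum_image, Finset.sum_product]
  intro x _ y _ h
  simpa [Prod.ext_iff] using h

namespace DFAInst

variable (C : DFAInst)

/-- The state of the product automaton that the word `w` reaches from `q`. -/
def reach (q : ℕ × ℕ × ℕ) (w : List (Fin C.s)) : ℕ × ℕ × ℕ := w.foldl (fun q (a : Fin C.s) => C.next q a) q

variable {C}

theorem exists_fin_of_mem_states {q : ℕ × ℕ × ℕ} (hq : q ∈ C.states) :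
    ∃ (h : Fin C.hard.numStates) (k : Fin C.cost.numStates) (l : Fin C.label.numStates),
      q = (↑h, ↑k, ↑l) := by
  obtain ⟨h, k, l⟩ := q
  simp only [states, List.mem_product, List.mem_range] at hq
  exact ⟨⟨h, hq.1⟩, ⟨k, hq.2.1⟩, ⟨l, hq.2.2⟩, rfl⟩

theorem mem_states (h : Fin C.hard.numStates) (k : Fin C.cost.numStates)
    (l : Fin C.label.numStates) : ((h : ℕ), (k : ℕ), (l : ℕ)) ∈ C.states := by
  simp [states, List.mem_product]

theorem next_eq (h : Fin C.hard.numStates) (k : Fin C.cost.numStates)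
    (l : Fin C.label.numStates) (a : Fin C.s) :
    C.next (↑h, ↑k, ↑l) a = (↑(C.hard.step h a), ↑(C.cost.step k a), ↑(C.label.step l a)) := by
  simp [next, OutDFA.stepN_eq]

theorem next_mem {q : ℕ × ℕ × ℕ} (hq : q ∈ C.states) (a : Fin C.s) : C.next q a ∈ C.states := by
  obtain ⟨h, k, l, rfl⟩ := exists_fin_of_mem_states hq
  rw [next_eq]
  exact mem_states _ _ _

theorem start_mem : C.start ∈ C.states := mem_states _ _ _

theorem reach_eq (h : Fin C.hard.numStates) (k : Fin C.cost.numStates)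
    (l : Fin C.label.numStates) (w : List (Fin C.s)) :
    C.reach (↑h, ↑k, ↑l) w =
      (↑(w.foldl C.hard.step h), ↑(w.foldl C.cost.step k), ↑(w.foldl C.label.step l)) := by
  induction w generalizing h k l with
  | nil => rfl
  | cons a w ih =>
    rw [reach, List.foldl_cons, next_eq]
    exact ih _ _ _

theorem reach_mem (w : List (Fin C.s)) : C.reach C.start w ∈ C.states := by
  rw [start, reach_eq]
  exact mem_states _ _ _

/-- The dynamic program computes the weighted number of the marked words. -/
theorem value_eq_sum (T : List ((ℕ × ℕ × ℕ) × ℕ)) (l : List Bool) {q : ℕ × ℕ × ℕ}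
    (hq : q ∈ C.states) : C.value T l q = ∑ w ∈ wordsLT C.s l.length,
      if l.getD w.length false = true then lookup T (C.reach q w) else 0 := by
  induction l generalizing q with
  | nil => simp [value_nil, wordsLT]
  | cons b l ih =>
    rw [value_cons, if_pos hq, List.length_cons, sum_wordsLT_succ, Finset.sum_range]
    congr 1
    refine Finset.sum_congr rfl fun a _ => ?_
    rw [ih (next_mem hq a)]
    rfl

/-- The number of the numbers that a word has in `unrank`. -/
theorem sum_unrank (T : List ((ℕ × ℕ × ℕ) × ℕ)) (l : List Bool) {q : ℕ × ℕ × ℕ}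
    (hq : q ∈ C.states) (w : List (Fin C.s)) :
    ∑ u ∈ Finset.range (C.value T l q),
      (if C.unrank T l u q = w.map (fun a : Fin C.s => (a : ℕ)) then 1 else 0) =
      if l.getD w.length false = true then lookup T (C.reach q w) else 0 := by
  induction l generalizing q w with
  | nil => simp [value_nil]
  | cons b l ih =>
    have hsplit : ∀ F : List ℕ → ℕ, ∑ u ∈ Finset.range (C.value T (b :: l) q),
        F (C.unrank T (b :: l) u q) = (if b = true then lookup T q else 0) * F [] +
          ∑ a : Fin C.s, ∑ v ∈ Finset.range (C.value T l (C.next q a)),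
            F ((a : ℕ) :: C.unrank T l v (C.next q a)) := by
      intro F
      rw [value_cons, if_pos hq, Finset.sum_range_add]
      congr 1
      · rw [Finset.sum_congr rfl (g := fun _ => F []), Finset.sum_const, Finset.card_range,
          smul_eq_mul]
        intro u hu
        rw [Finset.mem_range] at hu
        rw [unrank, if_pos]
        split_ifs at hu with hb
        · exact ⟨hb, hu⟩
        · omega
      · have h1 : ∀ u, F (C.unrank T (b :: l) ((if b = true then lookup T q else 0) + u) q) =
            (fun x : ℕ × ℕ => F (x.1 :: C.unrank T l x.2 (C.next q x.1)))
              (pick (fun a => C.value T l (C.next q a)) (List.range C.s) u) := by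
          intro u
          rw [unrank, if_neg]
          · rw [Nat.add_sub_cancel_left]
          · rintro ⟨hb, hu⟩
            rw [if_pos hb] at hu
            omega
        simp only [h1]
        have h2 : ∑ a ∈ Finset.range C.s, C.value T l (C.next q a) =
            ((List.range C.s).map fun a => C.value T l (C.next q a)).sum := by
          rw [← List.sum_toFinset _ List.nodup_range, List.toFinset_range]
        rw [h2, sum_pick _ _ fun x : ℕ × ℕ => F (x.1 :: C.unrank T l x.2 (C.next q x.1)),
          ← List.sum_toFinset _ List.nodup_range, List.toFinset_range, Finset.sum_range]
    rw [hsplit fun v => if v = w.map (fun a : Fin C.s => (a : ℕ)) then 1 else 0]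
    cases w with
    | nil => simp [reach]
    | cons a w =>
      simp only [List.map_cons, List.cons.injEq, reduceCtorEq, if_false, mul_zero, zero_add,
        List.length_cons, List.getD_cons_succ]
      rw [Finset.sum_eq_single a]
      · simp only [true_and]
        rw [ih (next_mem hq a) w]
        rfl
      · intro a' _ ha'
        have : (a' : ℕ) ≠ a := fun e => ha' (Fin.ext e)
        simp [this]
      · simp

end DFAInst

/-! ### Words of admissible length and label classes -/

namespace DFAInst

variable (C : DFAInst)

/-- The words of admissible length. -/
def lengthWords : Finset (List (Fin C.s)) :=
  (wordsLT C.s (C.params.n + 1)).filter fun w => C.params.m ≤ w.length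

variable {C}

theorem mem_lengthWords {w : List (Fin C.s)} :
    w ∈ C.lengthWords ↔ C.params.m ≤ w.length ∧ w.length ≤ C.params.n := by
  rw [lengthWords, Finset.mem_filter, mem_wordsLT, Nat.lt_succ_iff, and_comm]

theorem flags_getD (w : List (Fin C.s)) :
    C.flags.getD w.length false = true ↔ w ∈ C.lengthWords := by
  rw [mem_lengthWords]
  by_cases h : w.length < C.params.n + 1
  · simp [flags, List.getD, h]
    omega
  · simp [flags, List.getD, h]
    omega

theorem value_flags (T : List ((ℕ × ℕ × ℕ) × ℕ)) :
    C.value T C.flags C.start = ∑ w ∈ C.lengthWords, lookup T (C.reach C.start w) := by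
  rw [value_eq_sum T _ start_mem, lengthWords, Finset.sum_filter]
  have hl : C.flags.length = C.params.n + 1 := by simp [flags]
  rw [hl]
  refine Finset.sum_congr rfl fun w hw => ?_
  rw [mem_wordsLT, Nat.lt_succ_iff] at hw
  simp only [flags_getD, mem_lengthWords, hw, and_true]

theorem count_eq (q : ℕ × ℕ × ℕ) :
    C.count q = {w ∈ C.lengthWords | C.reach C.start w = q}.card := by
  rw [count, value_flags, Finset.card_filter]
  refine Finset.sum_congr rfl fun w _ => ?_
  simp [lookup, eq_comm]

theorem lookup_weights {q : ℕ × ℕ × ℕ} (hq : q ∈ C.states) : lookup C.weights q = C.weight q := by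
  rw [weights, lookup_map C.nodup_states, if_pos hq]

theorem total_eq : C.total = ∑ w ∈ C.lengthWords, C.weight (C.reach C.start w) := by
  rw [total, value_flags]
  exact Finset.sum_congr rfl fun w _ => lookup_weights (reach_mem w)

/-- Each word has as many numbers as its weight says. -/
theorem sum_unrank_weights (w : List (Fin C.s)) :
    ∑ u ∈ Finset.range C.total, (if C.unrank C.weights C.flags u C.start =
      w.map (fun a : Fin C.s => (a : ℕ)) then 1 else 0) =
      if w ∈ C.lengthWords then C.weight (C.reach C.start w) else 0 := by
  rw [total, sum_unrank _ _ start_mem]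
  simp only [flags_getD, lookup_weights (reach_mem w)]

theorem accN_reach (w : List (Fin C.s)) :
    C.accN (C.reach C.start w) = true ↔ w ∈ C.hard.toDFA.accepts := by
  rw [start, reach_eq, accN, OutDFA.outs_getD, DFA.mem_accepts]
  rfl

theorem costN_reach (w : List (Fin C.s)) : C.costN (C.reach C.start w) = C.cost.output w := by
  rw [start, reach_eq, costN, OutDFA.outs_getD]
  rfl

theorem labelN_reach (w : List (Fin C.s)) : C.labelN (C.reach C.start w) = C.label.output w := by
  rw [start, reach_eq, labelN, OutDFA.outs_getD]
  rfl

theorem labelList_getD (i : Fin C.numLabels) : C.labelList.getD i 0 = C.labels i :=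
  OutDFA.getD_ofFn _ _ _

theorem mem_improvisations {w : List (Fin C.s)} : w ∈ C.toInst.improvisations ↔
    w ∈ C.lengthWords ∧ C.accN (C.reach C.start w) = true := by
  rw [accN_reach, mem_lengthWords, and_assoc]
  rfl

theorem mem_labelClass {w : List (Fin C.s)} {i : Fin C.numLabels} :
    w ∈ C.toInst.labelClass i ↔ w ∈ C.lengthWords ∧ C.InGroup i (C.reach C.start w) := by
  rw [InGroup, ← and_assoc, ← mem_improvisations, labelN_reach, labelList_getD,
    ← C.labels_label w]
  exact and_congr Iff.rfl C.labels_injective.eq_iff.symm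

theorem alphaN_eq (i : Fin C.numLabels) : C.alphaN i = C.params.alpha i := OutDFA.getD_ofFn _ _ _

theorem betaN_eq (i : Fin C.numLabels) : C.betaN i = C.params.beta i := OutDFA.getD_ofFn _ _ _

theorem wordDenom_pos : 0 < C.wordDenom := by
  refine Nat.mul_pos (List.prod_pos fun x hx => ?_) (List.prod_pos fun x hx => ?_) <;>
  · obtain ⟨r, _, rfl⟩ := List.mem_map.1 hx
    exact r.pos

theorem labelDenom_pos : 0 < C.labelDenom := Nat.mul_pos C.params.lam.pos C.params.rho.pos

theorem scaled_eq {r : ℚ} {M : ℕ} (hr : 0 ≤ r) (hM : r.den ∣ M) : (scaled r M : ℝ) = r * M := by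
  obtain ⟨k, rfl⟩ := hM
  have h1 : ((r.num.toNat : ℤ)) = r.num := Int.toNat_of_nonneg (Rat.num_nonneg.2 hr)
  have h2 : ((r.num.toNat : ℕ) : ℝ) = (r.num : ℝ) := by exact_mod_cast congrArg (Int.cast (R := ℝ)) h1
  have h3 : (r.den : ℝ) ≠ 0 := by exact_mod_cast r.den_nz
  rw [scaled, Nat.mul_div_cancel_left _ r.pos]
  push_cast
  rw [h2]
  conv_rhs => rw [Rat.cast_def r]
  field_simp

theorem scaled_alpha (i : Fin C.numLabels) :
    (scaled (C.alphaN i) C.wordDenom : ℝ) = C.params.alpha i * C.wordDenom := by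
  rw [alphaN_eq]
  refine scaled_eq (C.params.alpha_nonneg i) (dvd_mul_of_dvd_left (List.dvd_prod ?_) _)
  exact List.mem_map.2 ⟨_, (List.mem_ofFn' _ _).2 ⟨i, rfl⟩, rfl⟩

theorem scaled_beta (i : Fin C.numLabels) :
    (scaled (C.betaN i) C.wordDenom : ℝ) = C.params.beta i * C.wordDenom := by
  rw [betaN_eq]
  refine scaled_eq ((C.params.alpha_nonneg i).trans (C.params.alpha_le_beta i))
    (dvd_mul_of_dvd_right (List.dvd_prod ?_) _)
  exact List.mem_map.2 ⟨_, (List.mem_ofFn' _ _).2 ⟨i, rfl⟩, rfl⟩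

theorem scaled_lam : (scaled C.params.lam C.labelDenom : ℝ) = C.params.lam * C.labelDenom :=
  scaled_eq C.params.lam_nonneg (dvd_mul_right _ _)

theorem scaled_rho : (scaled C.params.rho C.labelDenom : ℝ) = C.params.rho * C.labelDenom :=
  scaled_eq (C.params.lam_nonneg.trans C.params.lam_le_rho) (dvd_mul_left _ _)

theorem wordLo_eq (i : Fin C.numLabels) (q : ℕ × ℕ × ℕ) : (C.wordLo i q : ℝ) =
    if C.InGroup i q then (C.params.alpha i : ℝ) * C.wordDenom * C.count q else 0 := by
  rw [wordLo]
  split_ifs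
  · rw [Nat.cast_mul, scaled_alpha]
  · simp

theorem wordHi_eq (i : Fin C.numLabels) (q : ℕ × ℕ × ℕ) : (C.wordLo i q : ℝ) + C.wordWidth i q =
    if C.InGroup i q then (C.params.beta i : ℝ) * C.wordDenom * C.count q else 0 := by
  rw [wordLo, wordWidth]
  split_ifs
  · have h : scaled (C.alphaN i) C.wordDenom ≤ scaled (C.betaN i) C.wordDenom := by
      have h : (C.params.alpha i : ℝ) ≤ C.params.beta i := by
        exact_mod_cast C.params.alpha_le_beta i
      have := mul_le_mul_of_nonneg_right h (Nat.cast_nonneg C.wordDenom)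
      rw [← scaled_alpha, ← scaled_beta] at this
      exact_mod_cast this
    rw [← Nat.cast_add, ← add_mul, Nat.add_sub_cancel' h, Nat.cast_mul, scaled_beta]
  · simp

theorem labelLo_eq (i : ℕ) : (C.labelLo i : ℝ) =
    if C.Usable i then (C.params.lam : ℝ) * C.labelDenom else 0 := by
  rw [labelLo]
  split_ifs
  · exact scaled_lam
  · simp

theorem labelHi_eq (i : ℕ) : (C.labelLo i : ℝ) + C.labelWidth i =
    if C.Usable i then (C.params.rho : ℝ) * C.labelDenom else 0 := by
  rw [labelLo, labelWidth]
  split_ifs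
  · have h : scaled C.params.lam C.labelDenom ≤ scaled C.params.rho C.labelDenom := by
      have h : (C.params.lam : ℝ) ≤ C.params.rho := by exact_mod_cast C.params.lam_le_rho
      have := mul_le_mul_of_nonneg_right h (Nat.cast_nonneg C.labelDenom)
      rw [← scaled_lam, ← scaled_rho] at this
      exact_mod_cast this
    rw [← Nat.cast_add, Nat.add_sub_cancel' h, scaled_rho]
  · simp

theorem injOn_key : Set.InjOn (fun q : ℕ × ℕ × ℕ => Nat.pair q.1 (Nat.pair q.2.1 q.2.2))
    (C.states.toFinset : Set (ℕ × ℕ × ℕ)) := by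
  rintro ⟨a, b, c⟩ _ ⟨a', b', c'⟩ _ h
  simpa using h

/-- Sums over a class of words can be computed state by state. -/
theorem sum_group (i : ℕ) (d g : List (Fin C.s) → ℝ) (g' : ℕ × ℕ × ℕ → ℝ)
    (hg : ∀ w, g w = g' (C.reach C.start w)) :
    ∑ w ∈ C.lengthWords with C.InGroup i (C.reach C.start w), d w * g w =
      ∑ q ∈ C.states.toFinset, if C.InGroup i q then
        (∑ w ∈ C.lengthWords with C.reach C.start w = q, d w) * g' q else 0 := by
  rw [Finset.sum_filter, ← Finset.sum_fiberwise_of_maps_to (t := C.states.toFinset)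
    (g := fun w => C.reach C.start w) (fun w _ => List.mem_toFinset.2 (reach_mem w))]
  refine Finset.sum_congr rfl fun q _ => ?_
  split_ifs with h
  · rw [Finset.sum_mul]
    refine Finset.sum_congr rfl fun w hw => ?_
    have := (Finset.mem_filter.1 hw).2
    rw [this, if_pos h, hg, this]
  · refine Finset.sum_eq_zero fun w hw => ?_
    rw [(Finset.mem_filter.1 hw).2, if_neg h]

/-- Each improvisation belongs to exactly one class. -/
theorem sum_classes (f : List (Fin C.s) → ℝ) (hf : ∀ w, w ∉ C.toInst.improvisations → f w = 0) :
    ∑ i : Fin C.numLabels, ∑ w ∈ C.lengthWords with C.InGroup i (C.reach C.start w), f w =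
      ∑ w ∈ C.lengthWords, f w := by
  simp only [Finset.sum_filter]
  rw [Finset.sum_comm]
  refine Finset.sum_congr rfl fun w hw => ?_
  by_cases h : w ∈ C.toInst.improvisations
  · let j : Fin C.numLabels := C.toInst.label w
    have : ∀ i : Fin C.numLabels, C.InGroup i (C.reach C.start w) ↔ j = i := by
      intro i
      have h1 := mem_labelClass (C := C) (w := w) (i := i)
      constructor
      · intro h2
        exact (h1.2 ⟨hw, h2⟩).2
      · intro h2
        exact (h1.1 ⟨h, h2⟩).2
    simp only [this, Finset.sum_ite_eq]
    exact if_pos (Finset.mem_univ _)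
  · simp [hf w h]

theorem pr_eq_sum (D : PMF (List (Fin C.s))) {A : Set (List (Fin C.s))}
    {F : Finset (List (Fin C.s))} (h : ∀ w, w ∈ A ↔ w ∈ F) :
    pr D A = ∑ w ∈ F, (D w).toReal := by
  have : A = (F : Set (List (Fin C.s))) := Set.ext fun w => h w
  rw [pr, this, PMF.toOuterMeasure_apply_finset,
    ENNReal.toReal_sum fun w _ => D.apply_ne_top w]

theorem pr_labelClass (D : PMF (List (Fin C.s))) (i : Fin C.numLabels) :
    pr D (C.toInst.labelClass i) =
      ∑ w ∈ C.lengthWords with C.InGroup i (C.reach C.start w), (D w).toReal :=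
  pr_eq_sum D fun w => by rw [mem_labelClass, Finset.mem_filter]

theorem pr_singleton_inter (D : PMF (List (Fin C.s))) {A : Set (List (Fin C.s))}
    {y : List (Fin C.s)} (hy : y ∈ A) : pr D ({y} ∩ A) = (D y).toReal := by
  rw [pr_eq_sum D (F := {y}), Finset.sum_singleton]
  intro w
  rw [Finset.mem_singleton]
  constructor
  · exact fun h => h.1
  · rintro rfl
    exact ⟨rfl, hy⟩

end DFAInst

namespace DFAInst

variable {C : DFAInst}

/-! ### Feasible instances satisfy the criterion -/

section Necessary

variable {D : PMF (List (Fin C.s))}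

theorem eq_zero_of_not_mem (hD : IsImprovising C.toInst D) {w : List (Fin C.s)}
    (hw : w ∉ C.toInst.improvisations) : (D w).toReal = 0 := by
  have h1 : D.toOuterMeasure C.toInst.improvisations = 1 :=
    (ENNReal.toReal_eq_one_iff _).1 hD.hard
  have h2 := (D.toOuterMeasure_apply_eq_one_iff _).1 h1
  have h3 : D w = 0 := by
    by_contra h
    exact hw (h2 ((D.mem_support_iff w).2 h))
  simp [h3]

theorem pr_nonneg (A : Set (List (Fin C.s))) : 0 ≤ pr D A := ENNReal.toReal_nonneg

theorem sum_eq_pr_improvisations (hD : ∀ w, w ∉ C.toInst.improvisations → (D w).toReal = 0) :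
    ∑ w ∈ C.lengthWords, (D w).toReal = pr D C.toInst.improvisations := by
  rw [pr_eq_sum D (F := C.lengthWords.filter fun w => C.accN (C.reach C.start w) = true)]
  · refine (Finset.sum_filter_of_ne fun w hw h => ?_).symm
    by_contra hacc
    exact h (hD w fun hw' => hacc (mem_improvisations.1 hw').2)
  · intro w
    rw [mem_improvisations, Finset.mem_filter]

theorem sum_pr_labelClass (hD : IsImprovising C.toInst D) :
    ∑ i : Fin C.numLabels, pr D (C.toInst.labelClass i) = 1 := by
  have h : ∀ i : Fin C.numLabels, pr D (C.toInst.labelClass i) =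
      ∑ w ∈ C.lengthWords with C.InGroup i (C.reach C.start w), (D w).toReal :=
    fun i => pr_labelClass D i
  rw [Finset.sum_congr rfl fun i _ => h i,
    sum_classes (fun w => (D w).toReal) fun w hw => eq_zero_of_not_mem hD hw,
    sum_eq_pr_improvisations fun w hw => eq_zero_of_not_mem hD hw, hD.hard]

theorem tsum_cost (hD : ∀ w, w ∉ C.toInst.improvisations → (D w).toReal = 0) :
    ∑' w, (D w).toReal * (C.toInst.cost w : ℝ) = ∑ i : Fin C.numLabels,
      ∑ w ∈ C.lengthWords with C.InGroup i (C.reach C.start w),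
        (D w).toReal * (C.costN (C.reach C.start w) : ℝ) := by
  rw [sum_classes (fun w => (D w).toReal * (C.costN (C.reach C.start w) : ℝ))
    fun w hw => by rw [hD w hw, zero_mul], tsum_eq_sum (s := C.lengthWords)]
  · refine Finset.sum_congr rfl fun w _ => ?_
    rw [costN_reach]
    congr 1
  · intro w hw
    rw [hD w fun h => hw (mem_improvisations.1 h).1, zero_mul]

/-- A class of positive probability is usable, and the words in it have on average at least the
cost of the cheapest distribution. -/
theorem usable_of_pos (hD : IsImprovising C.toInst D) (i : Fin C.numLabels)
    (hp : 0 < pr D (C.toInst.labelClass i)) : C.Usable i ∧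
      pr D (C.toInst.labelClass i) * C.classCost i ≤ C.wordDenom *
        ∑ w ∈ C.lengthWords with C.InGroup i (C.reach C.start w),
          (D w).toReal * (C.costN (C.reach C.start w) : ℝ) := by
  set p := pr D (C.toInst.labelClass i) with hpdef
  have hM : (0 : ℝ) < C.wordDenom := by exact_mod_cast C.wordDenom_pos
  let P : ℕ × ℕ × ℕ → ℝ := fun q => ∑ w ∈ C.lengthWords with C.reach C.start w = q, (D w).toReal
  let z : ℕ × ℕ × ℕ → ℝ := fun q => if C.InGroup i q then P q * (C.wordDenom / p) else 0
  have hword : ∀ w, w ∈ C.lengthWords → C.InGroup i (C.reach C.start w) →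
      (C.params.alpha i : ℝ) * p ≤ (D w).toReal ∧ (D w).toReal ≤ C.params.beta i * p := by
    intro w hw hi
    have hmem : w ∈ C.toInst.labelClass i := mem_labelClass.2 ⟨hw, hi⟩
    have := hD.words i hp w hmem
    rw [condPr, pr_singleton_inter D hmem, le_div_iff₀ hp, div_le_iff₀ hp] at this
    exact this
  have hlo : ∀ q ∈ C.states.toFinset, (C.wordLo i q : ℝ) ≤ z q := by
    intro q _
    rw [wordLo_eq]
    simp only [z]
    split_ifs with hq
    · have h1 : (C.count q : ℝ) * (C.params.alpha i * p) ≤ P q := by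
        rw [count_eq, ← nsmul_eq_mul]
        refine Finset.card_nsmul_le_sum _ _ _ fun w hw => ?_
        rw [Finset.mem_filter] at hw
        exact (hword w hw.1 (by rw [hw.2]; exact hq)).1
      rw [mul_div_assoc', le_div_iff₀ hp]
      nlinarith
    · exact le_rfl
  have hhi : ∀ q ∈ C.states.toFinset, z q ≤ C.wordLo i q + C.wordWidth i q := by
    intro q _
    rw [wordHi_eq]
    simp only [z]
    split_ifs with hq
    · have h1 : P q ≤ (C.count q : ℝ) * (C.params.beta i * p) := by
        rw [count_eq, ← nsmul_eq_mul]
        refine Finset.sum_le_card_nsmul _ _ _ fun w hw => ?_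
        rw [Finset.mem_filter] at hw
        exact (hword w hw.1 (by rw [hw.2]; exact hq)).2
      rw [mul_div_assoc', div_le_iff₀ hp]
      nlinarith
    · exact le_rfl
  have hz : ∀ g : ℕ × ℕ × ℕ → ℝ, ∑ q ∈ C.states.toFinset, g q * z q = (C.wordDenom / p) *
      ∑ w ∈ C.lengthWords with C.InGroup i (C.reach C.start w),
        (D w).toReal * g (C.reach C.start w) := by
    intro g
    rw [sum_group i _ _ g fun w => rfl, Finset.mul_sum]
    refine Finset.sum_congr rfl fun q _ => ?_
    simp only [z]
    split_ifs
    · ring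
    · simp
  have hsum : ∑ q ∈ C.states.toFinset, z q = C.wordDenom := by
    have := hz fun _ => 1
    simp only [one_mul, mul_one] at this
    rw [this, ← pr_labelClass, ← hpdef]
    field_simp
  refine ⟨⟨?_, ?_⟩, ?_⟩
  · have := Finset.sum_le_sum hlo
    rw [hsum] at this
    exact_mod_cast this
  · have := Finset.sum_le_sum hhi
    rw [hsum] at this
    exact_mod_cast this
  · have h1 := greedy_optimal (c := C.costN) injOn_key hlo hhi hsum
    rw [hz fun q => (C.costN q : ℝ)] at h1
    have h2 : (C.classCost i : ℝ) = ∑ q ∈ C.states.toFinset,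
        (C.costN q : ℝ) * (C.wordShare i q : ℝ) := by
      simp [classCost]
    rw [h2]
    refine (mul_le_mul_of_nonneg_left h1 hp.le).trans (le_of_eq ?_)
    field_simp

theorem ok_of_isImprovising (hD : IsImprovising C.toInst D) : C.Ok := by
  have hM : (0 : ℝ) < C.wordDenom := by exact_mod_cast C.wordDenom_pos
  have hL : (0 : ℝ) < C.labelDenom := by exact_mod_cast C.labelDenom_pos
  let p : Fin C.numLabels → ℝ := fun i => pr D (C.toInst.labelClass i)
  have hp0 : ∀ i, 0 ≤ p i := fun i => pr_nonneg _
  have hlam : ∀ i, (C.params.lam : ℝ) ≤ p i := fun i => (hD.labels i).1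
  have hrho : ∀ i, p i ≤ (C.params.rho : ℝ) := fun i => (hD.labels i).2
  have husable : ∀ i : Fin C.numLabels, ¬ C.Usable i → p i = 0 := by
    intro i hi
    by_contra h
    exact hi (usable_of_pos hD i (lt_of_le_of_ne (hp0 i) (Ne.symm h))).1
  have hcost : ∀ i, p i * C.classCost i ≤ C.wordDenom *
      ∑ w ∈ C.lengthWords with C.InGroup i (C.reach C.start w),
        (D w).toReal * (C.costN (C.reach C.start w) : ℝ) := by
    intro i
    rcases (hp0 i).eq_or_lt with h | h
    · have h1 : ∑ w ∈ C.lengthWords with C.InGroup i (C.reach C.start w), (D w).toReal = 0 := by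
        rw [← pr_labelClass]
        exact h.symm
      rw [Finset.sum_eq_zero_iff_of_nonneg fun w _ => ENNReal.toReal_nonneg] at h1
      rw [← h, zero_mul, Finset.sum_eq_zero fun w hw => by rw [h1 w hw, zero_mul], mul_zero]
    · exact (usable_of_pos hD i h).2
  let Y : ℕ → ℝ := fun i => if h : i < C.numLabels then C.labelDenom * p ⟨i, h⟩ else 0
  have hYfin : ∀ i : Fin C.numLabels, Y i = C.labelDenom * p i := fun i => by simp [Y]
  have hlo : ∀ i ∈ Finset.range C.numLabels, (C.labelLo i : ℝ) ≤ Y i := by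
    intro i hi
    obtain ⟨i, rfl⟩ : ∃ j : Fin C.numLabels, (j : ℕ) = i := ⟨⟨i, Finset.mem_range.1 hi⟩, rfl⟩
    rw [labelLo_eq, hYfin]
    split_ifs
    · rw [mul_comm]
      exact mul_le_mul_of_nonneg_left (hlam i) hL.le
    · exact mul_nonneg hL.le (hp0 i)
  have hhi : ∀ i ∈ Finset.range C.numLabels, Y i ≤ C.labelLo i + C.labelWidth i := by
    intro i hi
    obtain ⟨i, rfl⟩ : ∃ j : Fin C.numLabels, (j : ℕ) = i := ⟨⟨i, Finset.mem_range.1 hi⟩, rfl⟩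
    rw [labelHi_eq, hYfin]
    split_ifs with h
    · rw [mul_comm]
      exact mul_le_mul_of_nonneg_right (hrho i) hL.le
    · rw [husable i h, mul_zero]
  have hsum : ∑ i ∈ Finset.range C.numLabels, Y i = C.labelDenom := by
    rw [Finset.sum_range, Finset.sum_congr rfl fun i _ => hYfin i, ← Finset.mul_sum,
      sum_pr_labelClass hD, mul_one]
  refine ⟨fun i hi => ?_, ?_, ?_, ?_⟩
  · obtain ⟨i, rfl⟩ : ∃ j : Fin C.numLabels, (j : ℕ) = i := ⟨⟨i, List.mem_range.1 hi⟩, rfl⟩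
    by_cases h : C.Usable i
    · exact Or.inl h
    · right
      have h1 : (C.params.lam : ℝ) = 0 := le_antisymm ((hlam i).trans (husable i h).le)
        (by exact_mod_cast C.params.lam_nonneg)
      have h2 := scaled_lam (C := C)
      rw [h1, zero_mul] at h2
      exact_mod_cast h2
  · have := Finset.sum_le_sum hlo
    rw [hsum] at this
    exact_mod_cast this
  · have := Finset.sum_le_sum hhi
    rw [hsum] at this
    exact_mod_cast this
  · have h1 := greedy_optimal (c := C.classCost) (κ := fun i => i) (fun _ _ _ _ h => h) hlo hhi hsum
    have h2 : ∑ i ∈ Finset.range C.numLabels, (C.classCost i : ℝ) * Y i ≤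
        C.labelDenom * C.wordDenom * C.params.c := by
      calc ∑ i ∈ Finset.range C.numLabels, (C.classCost i : ℝ) * Y i
          = C.labelDenom * ∑ i : Fin C.numLabels, p i * C.classCost i := by
            rw [Finset.sum_range, Finset.mul_sum]
            refine Finset.sum_congr rfl fun i _ => ?_
            rw [hYfin]
            ring
        _ ≤ C.labelDenom * (C.wordDenom * C.params.c) := by
            refine mul_le_mul_of_nonneg_left ?_ hL.le
            refine (Finset.sum_le_sum fun i _ => hcost i).trans ?_
            rw [← Finset.mul_sum, ← tsum_cost fun w hw => eq_zero_of_not_mem hD hw]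
            exact mul_le_mul_of_nonneg_left hD.cost hM.le
        _ = _ := by ring
    have h3 : (∑ i ∈ Finset.range C.numLabels, (C.labelShare i : ℝ) * C.classCost i) ≤
        C.labelDenom * C.wordDenom * C.params.c := by
      refine le_trans (le_of_eq ?_) (h1.trans h2)
      refine Finset.sum_congr rfl fun i _ => ?_
      rw [labelShare, List.toFinset_range, mul_comm]
    have hden : (0 : ℝ) < C.params.c.den := by exact_mod_cast C.params.c.pos
    have h4 : (C.params.c : ℝ) * C.params.c.den = C.params.c.num := by
      exact_mod_cast Rat.mul_den_eq_num C.params.c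
    have h5 := mul_le_mul_of_nonneg_right h3 hden.le
    rw [mul_assoc, h4, mul_comm _ (C.params.c.num : ℝ)] at h5
    exact_mod_cast h5

end Necessary

/-! ### The criterion is sufficient -/

section Sufficient

theorem wordShare_bounds (i : Fin C.numLabels) {q : ℕ × ℕ × ℕ} (hq : C.InGroup i q) :
    (C.params.alpha i : ℝ) * C.wordDenom * C.count q ≤ C.wordShare i q ∧
      (C.wordShare i q : ℝ) ≤ C.params.beta i * C.wordDenom * C.count q := by
  have h1 := wordLo_eq i q
  have h2 := wordHi_eq i q
  rw [if_pos hq] at h1 h2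
  rw [← h1, ← h2]
  exact ⟨by exact_mod_cast le_greedy q, by exact_mod_cast greedy_le q⟩

theorem wordShare_eq_zero (i : ℕ) {q : ℕ × ℕ × ℕ} (h : ¬ (C.InGroup i q ∧ C.count q ≠ 0)) :
    C.wordShare i q = 0 := by
  refine greedy_eq_zero ?_ ?_
  · rw [wordLo]
    split_ifs <;> simp_all
  · rw [wordWidth]
    split_ifs <;> simp_all

theorem sum_wordShare {i : ℕ} (h : C.Usable i) :
    ∑ q ∈ C.states.toFinset, C.wordShare i q = C.wordDenom :=
  sum_greedy injOn_key h.1 h.2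

theorem labelShare_bounds {i : ℕ} (h : C.Usable i) :
    (C.params.lam : ℝ) * C.labelDenom ≤ C.labelShare i ∧
      (C.labelShare i : ℝ) ≤ C.params.rho * C.labelDenom := by
  have h1 := labelLo_eq (C := C) i
  have h2 := labelHi_eq (C := C) i
  rw [if_pos h] at h1 h2
  rw [← h1, ← h2]
  exact ⟨by exact_mod_cast le_greedy i, by exact_mod_cast greedy_le i⟩

theorem labelShare_eq_zero {i : ℕ} (h : ¬ C.Usable i) : C.labelShare i = 0 :=
  greedy_eq_zero (by rw [labelLo, if_neg h]) (by rw [labelWidth, if_neg h])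

theorem countProd_pos : 0 < C.countProd := by
  refine List.prod_pos fun x hx => ?_
  obtain ⟨q, _, rfl⟩ := List.mem_map.1 hx
  split_ifs <;> omega

theorem countProd_div {q : ℕ × ℕ × ℕ} (hq : q ∈ C.states) :
    ((C.countProd / C.count q : ℕ) : ℝ) = C.countProd / C.count q := by
  by_cases h : C.count q = 0
  · simp [h]
  · refine Nat.cast_div ?_ (by exact_mod_cast h)
    refine List.dvd_prod (List.mem_map.2 ⟨q, hq, ?_⟩)
    rw [if_neg h]

theorem weight_eq (i : Fin C.numLabels) {q : ℕ × ℕ × ℕ} (hq : q ∈ C.states)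
    (hi : C.InGroup i q) :
    (C.weight q : ℝ) = C.countProd * C.labelShare i * C.wordShare i q / C.count q := by
  rw [weight, Finset.sum_range, Finset.sum_eq_single i]
  · push_cast
    rw [countProd_div hq]
    ring
  · intro j _ hj
    rw [wordShare_eq_zero, mul_zero, zero_mul]
    rintro ⟨hj', -⟩
    have := hi.2.symm.trans hj'.2
    rw [labelList_getD, labelList_getD] at this
    exact hj (C.labels_injective this).symm
  · simp

theorem weight_eq_zero {q : ℕ × ℕ × ℕ} (hq : C.accN q ≠ true) : C.weight q = 0 := by
  refine Finset.sum_eq_zero fun i _ => ?_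
  rw [wordShare_eq_zero, mul_zero, zero_mul]
  exact fun h => hq h.1.1

/-- The weight of a word, which is zero unless its length is admissible. -/
def wordWeight (w : List (Fin C.s)) : ℕ :=
  if w ∈ C.lengthWords then C.weight (C.reach C.start w) else 0

theorem wordWeight_eq_zero {w : List (Fin C.s)} (hw : w ∉ C.toInst.improvisations) :
    wordWeight w = 0 := by
  rw [wordWeight]
  split_ifs with h
  · exact weight_eq_zero fun h' => hw (mem_improvisations.2 ⟨h, h'⟩)
  · rfl

theorem sum_wordWeight (i : Fin C.numLabels) (g : ℕ × ℕ × ℕ → ℝ) :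
    ∑ w ∈ C.lengthWords with C.InGroup i (C.reach C.start w),
      (wordWeight w : ℝ) * g (C.reach C.start w) =
      C.countProd * C.labelShare i * ∑ q ∈ C.states.toFinset, g q * C.wordShare i q := by
  rw [sum_group i _ _ g fun w => rfl, Finset.mul_sum]
  refine Finset.sum_congr rfl fun q hq => ?_
  rw [List.mem_toFinset] at hq
  split_ifs with hi
  · have h1 : ∑ w ∈ C.lengthWords with C.reach C.start w = q, (wordWeight w : ℝ) =
        C.count q * C.weight q := by
      rw [count_eq, ← nsmul_eq_mul, ← Finset.sum_const]
      refine Finset.sum_congr rfl fun w hw => ?_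
      rw [Finset.mem_filter] at hw
      rw [wordWeight, if_pos hw.1, hw.2]
    rw [h1, weight_eq i hq hi]
    by_cases h : C.count q = 0
    · rw [wordShare_eq_zero i fun h' => h'.2 h, h]
      simp
    · have : (C.count q : ℝ) ≠ 0 := by exact_mod_cast h
      field_simp
  · rw [wordShare_eq_zero i fun h => hi h.1]
    simp

theorem sum_class_wordWeight (i : Fin C.numLabels) :
    ∑ w ∈ C.lengthWords with C.InGroup i (C.reach C.start w), (wordWeight w : ℝ) =
      C.countProd * C.labelShare i * C.wordDenom := by
  have := sum_wordWeight i fun _ => 1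
  simp only [mul_one, one_mul] at this
  rw [this]
  by_cases h : C.Usable i
  · rw [← sum_wordShare h]
    push_cast
    rfl
  · simp [labelShare_eq_zero h]

theorem total_eq_sum_wordWeight : C.total = ∑ w ∈ C.lengthWords, wordWeight w := by
  rw [total_eq]
  exact Finset.sum_congr rfl fun w hw => (if_pos hw).symm

theorem total_eq_mul (h : C.Ok) :
    (C.total : ℝ) = C.countProd * C.labelDenom * C.wordDenom := by
  have h1 : (C.total : ℝ) = ∑ w ∈ C.lengthWords, (wordWeight w : ℝ) := by
    rw [total_eq_sum_wordWeight]
    push_cast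
    rfl
  have h2 : ∑ i ∈ Finset.range C.numLabels, C.labelShare i = C.labelDenom := by
    unfold labelShare
    rw [List.toFinset_range]
    exact sum_greedy (fun _ _ _ _ h => h) h.2.1 h.2.2.1
  rw [h1, ← sum_classes _ fun w hw => by rw [wordWeight_eq_zero hw, Nat.cast_zero],
    Finset.sum_congr rfl fun i _ => sum_class_wordWeight i, ← Finset.sum_mul, ← Finset.mul_sum,
    ← h2, Finset.sum_range]
  push_cast
  rfl

theorem total_pos (h : C.Ok) : 0 < C.total := by
  have h1 : (0 : ℝ) < C.total := by
    rw [total_eq_mul h]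
    have h1 : (0 : ℝ) < C.countProd := by exact_mod_cast C.countProd_pos
    have h2 : (0 : ℝ) < C.labelDenom := by exact_mod_cast C.labelDenom_pos
    have h3 : (0 : ℝ) < C.wordDenom := by exact_mod_cast C.wordDenom_pos
    positivity
  exact_mod_cast h1

/-- If the criterion holds, then the distribution that is proportional to the weights of the words
is improvising. -/
theorem exists_isImprovising (h : C.Ok) : ∃ D : PMF (List (Fin C.s)),
    IsImprovising C.toInst D ∧ ∀ w, D w = (wordWeight w : ℝ≥0∞) / C.total := by
  have hN : (0 : ℝ) < C.countProd := by exact_mod_cast C.countProd_pos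
  have hL : (0 : ℝ) < C.labelDenom := by exact_mod_cast C.labelDenom_pos
  have hM : (0 : ℝ) < C.wordDenom := by exact_mod_cast C.wordDenom_pos
  have hZ0 : (C.total : ℝ≥0∞) ≠ 0 := by exact_mod_cast (total_pos h).ne'
  have hZ := total_eq_mul h
  have hZpos : (0 : ℝ) < C.total := by exact_mod_cast total_pos h
  let D : PMF (List (Fin C.s)) := PMF.ofFinset (fun w => (wordWeight w : ℝ≥0∞) / C.total)
    C.lengthWords (by
      simp only [div_eq_mul_inv]
      rw [← Finset.sum_mul, ← Nat.cast_sum, ← total_eq_sum_wordWeight]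
      exact ENNReal.mul_inv_cancel hZ0 (by simp))
    (fun w hw => by rw [wordWeight, if_neg hw]; simp)
  have hDw : ∀ w, D w = (wordWeight w : ℝ≥0∞) / C.total := fun w => PMF.ofFinset_apply _ _ w
  have hd : ∀ w, (D w).toReal = (wordWeight w : ℝ) / C.total := by
    intro w
    rw [hDw, ENNReal.toReal_div]
    simp
  have hd0 : ∀ w, w ∉ C.toInst.improvisations → (D w).toReal = 0 := by
    intro w hw
    rw [hd, wordWeight_eq_zero hw]
    simp
  have hpr : ∀ i : Fin C.numLabels, pr D (C.toInst.labelClass i) =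
      (C.labelShare i : ℝ) / C.labelDenom := by
    intro i
    rw [pr_labelClass, Finset.sum_congr rfl fun w _ => hd w, ← Finset.sum_div,
      sum_class_wordWeight, hZ]
    field_simp
  refine ⟨D, ⟨?_, ?_, fun i => ?_, fun i hi w hw => ?_⟩, hDw⟩
  · rw [← sum_eq_pr_improvisations hd0, Finset.sum_congr rfl fun w _ => hd w, ← Finset.sum_div,
      ← Nat.cast_sum, ← total_eq_sum_wordWeight, div_self hZpos.ne']
  · rw [tsum_cost hd0]
    have h1 : ∀ i : Fin C.numLabels,
        ∑ w ∈ C.lengthWords with C.InGroup i (C.reach C.start w),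
          (D w).toReal * (C.costN (C.reach C.start w) : ℝ) =
        C.labelShare i * C.classCost i / (C.labelDenom * C.wordDenom) := by
      intro i
      have h2 : ∀ w : List (Fin C.s), (D w).toReal * (C.costN (C.reach C.start w) : ℝ) =
          (wordWeight w : ℝ) * (C.costN (C.reach C.start w) : ℝ) / C.total := by
        intro w
        rw [hd]
        ring
      have h3 : (C.classCost i : ℝ) = ∑ q ∈ C.states.toFinset,
          (C.costN q : ℝ) * (C.wordShare i q : ℝ) := by
        simp [classCost]
      rw [Finset.sum_congr rfl fun w _ => h2 w, ← Finset.sum_div,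
        sum_wordWeight i fun q => (C.costN q : ℝ), hZ, ← h3]
      field_simp
    rw [Finset.sum_congr rfl fun i _ => h1 i, ← Finset.sum_div, div_le_iff₀ (by positivity)]
    have h4 := h.2.2.2
    have h5 : (∑ i : Fin C.numLabels, (C.labelShare i : ℝ) * C.classCost i) * C.params.c.den ≤
        C.params.c.num * (C.labelDenom * C.wordDenom) := by
      rw [Finset.sum_range] at h4
      exact_mod_cast h4
    have hden : (0 : ℝ) < C.params.c.den := by exact_mod_cast C.params.c.pos
    have h6 : (C.params.c : ℝ) * C.params.c.den = C.params.c.num := by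
      exact_mod_cast Rat.mul_den_eq_num C.params.c
    rw [← h6] at h5
    refine le_of_mul_le_mul_right (h5.trans (le_of_eq ?_)) hden
    change _ = (C.params.c : ℝ) * _ * _
    ring
  · change Fin C.numLabels at i
    rw [hpr i, le_div_iff₀ hL, div_le_iff₀ hL]
    by_cases hu : C.Usable i
    · exact labelShare_bounds hu
    · have h1 : scaled C.params.lam C.labelDenom = 0 :=
        (h.1 i (List.mem_range.2 i.2)).resolve_left hu
      have h2 := scaled_lam (C := C)
      have h3 : (0 : ℝ) ≤ C.params.rho := by
        exact_mod_cast C.params.lam_nonneg.trans C.params.lam_le_rho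
      rw [labelShare_eq_zero hu, Nat.cast_zero]
      rw [h1, Nat.cast_zero] at h2
      exact ⟨h2.symm.le, by positivity⟩
  · change Fin C.numLabels at i
    have hw' := mem_labelClass.1 hw
    have hcount : (0 : ℝ) < C.count (C.reach C.start w) := by
      have : 0 < C.count (C.reach C.start w) := by
        rw [count_eq]
        exact Finset.card_pos.2 ⟨w, Finset.mem_filter.2 ⟨hw'.1, rfl⟩⟩
      exact_mod_cast this
    have hy : (C.labelShare i : ℝ) ≠ 0 := by
      intro h0
      rw [hpr i, h0, zero_div] at hi
      exact lt_irrefl _ hi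
    have h1 : condPr D {w} (C.toInst.labelClass i) =
        C.wordShare i (C.reach C.start w) /
          (C.wordDenom * C.count (C.reach C.start w)) := by
      rw [condPr, pr_singleton_inter D hw, hd, hpr i, wordWeight, if_pos hw'.1,
        weight_eq i (reach_mem w) hw'.2, hZ]
      field_simp
    rw [h1, le_div_iff₀ (by positivity), div_le_iff₀ (by positivity), ← mul_assoc, ← mul_assoc]
    exact wordShare_bounds i hw'.2

end Sufficient

theorem feasible_iff_ok : Feasible C.toInst ↔ C.Ok :=
  ⟨fun ⟨_, hD⟩ => ok_of_isImprovising hD, fun h =>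
    let ⟨D, hD, _⟩ := exists_isImprovising h
    ⟨D, hD⟩⟩

end DFAInst

/-! ### The improvisation scheme -/

theorem Val.ofList_injective : Function.Injective Val.ofList := by
  intro l l' h
  induction l generalizing l' with
  | nil => cases l' <;> simp_all [Val.ofList]
  | cons a l ih =>
    cases l' with
    | nil => simp [Val.ofList] at h
    | cons a' l' =>
      simp only [Val.ofList, Val.pair.injEq] at h
      rw [h.1, ih h.2]

theorem enc_natList_injective : Function.Injective (enc : List ℕ → Val) := by
  refine Val.ofList_injective.comp (List.map_injective_iff.2 fun a b h => ?_)
  simpa [enc_nat] using h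

theorem wordCode_eq {s : ℕ} (w : List (Fin s)) :
    wordCode w = enc (w.map fun a : Fin s => (a : ℕ)) := by
  unfold wordCode
  change _ = Val.ofList _
  congr 2
  simp [List.map_eq_flatMap]

/-- A program without coin tosses has exactly one run. -/
theorem run_of_deterministic {p : Prog} {v w : Val} {t : ℕ} (h : Eval p v [] w t) :
    haltProb p v = 1 ∧ ∀ r : Run p v, r.out = w ∧ r.time = t := by
  obtain ⟨φ, hφ⟩ := exists_runEquiv (X := Unit) (s := fun _ => []) (o := fun _ => w)
    (t := fun _ => t) (fun _ => h) (fun _ _ _ => rfl) fun b => ⟨(), [], b, by simp⟩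
  constructor
  · rw [haltProb, ← φ.tsum_eq]
    simp [Run.weight, hφ]
  · intro r
    obtain ⟨x, rfl⟩ := φ.surjective r
    exact (hφ x).2

/-- There is a program that turns the description of a feasible instance into an improviser. -/
theorem exists_improviser : ∃ (G : Prog) (Q : Polynomial ℕ), ∀ C : DFAInst, C.Ok →
    IsImproviser C.toInst (.seq (.op (.const C.code)) G) ∧
    expTime (.seq (.op (.const C.code)) G) (.num 0) ≤ ((Q.eval C.size : ℕ) : ℝ≥0∞) := by
  obtain ⟨G, Q, h⟩ := exists_sampler (α := DFAInst) (β := List ℕ) (Z := fun C => C.total)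
    (f := fun C u => C.unrank C.weights C.flags u C.start) (by fun_prop) (by fun_prop)
  refine ⟨G, Q, fun C hC => ?_⟩
  obtain ⟨h1, h2⟩ := h C (DFAInst.total_pos hC)
  obtain ⟨D, hD, hDw⟩ := DFAInst.exists_isImprovising hC
  refine ⟨⟨h2.trans_lt (ENNReal.natCast_lt_top _), D, hD, fun w => ?_⟩, h2⟩
  classical
  refine (h1 (wordCode w)).trans ?_
  rw [hDw, DFAInst.wordWeight, ← DFAInst.sum_unrank_weights]
  simp only [wordCode_eq, enc_natList_injective.eq_iff]

theorem pt_scheme (G : Prog) [∀ C : DFAInst, Decidable C.Ok] : PT (fun C : DFAInst =>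
    if C.Ok then Val.pair (.num 1) (Prog.seq (.op (.const C.code)) G).code else .num 0) := by
  have h : PT (fun C : DFAInst => ((1 : ℤ), (3 : ℤ), ((0 : ℤ), (1 : ℤ), C), G.code)) := by
    fun_prop
  exact PT.ite (DFAInst.pt_ok PT.id)
    (h.of_enc_eq (g := fun C => Val.pair (.num 1) (Prog.seq (.op (.const C.code)) G).code)
      fun _ => rfl) (PT.const _)

end LQCI

theorem theorem3 : ∃ S : LQCI.Prog, LQCI.IsPolyTimeScheme S := by
  classical
  obtain ⟨G, Q, hG⟩ := LQCI.exists_improviser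
  obtain ⟨S, P, hS⟩ := LQCI.pt_scheme G
  refine ⟨S, P, Q, fun C => ?_⟩
  obtain ⟨t, ht, he⟩ := hS C
  obtain ⟨h1, h2⟩ := LQCI.run_of_deterministic he
  refine ⟨h1, fun r => ?_⟩
  obtain ⟨h3, h4⟩ := h2 r
  rw [h3, h4]
  refine ⟨ht, ?_⟩
  by_cases hC : C.Ok
  · refine Or.inr ⟨LQCI.DFAInst.feasible_iff_ok.2 hC, _, ?_, hG C hC⟩
    dsimp only
    rw [if_pos hC]
    rfl
  · refine Or.inl ⟨fun h => hC (LQCI.DFAInst.feasible_iff_ok.1 h), ?_⟩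
    dsimp only
    rw [if_neg hC]
    rfl
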